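/- **Setting.** Let $d\ge 2$ and $I=\mathbb R/\mathbb Z$. Let $\phi\in C^0(\mathbb R^d,\mathbb R_{\ge0})\cap C^4(\mathbb R^d\setminus\{0\},\mathbb R_{>0})$ satisfy $\phi(\lambda p)=|\lambda|\phi(p)$ for all $\lambda\in\mathbb R$, $p\in\mathbb R^d$, and $\phi''(p)q\cdot q>0$ whenever $|p|=|q|=1$, $p\cdot q=0$. Let $\mathfrak m\in C^3(\mathbb R^d\setminus\{0\},\mathbb R_{>0})$ be $0$-homogeneous, i.e. $\mathfrak m(\lambda p)=\mathfrak m(p)$ for $\lambda>0$. Put $\Phi=\tfrac12\phi^2$ and, for $p\neq0$, $$H(p)=\alpha(p)\Big[\mathrm{Id}+\frac{w\otimes(\mathfrak t-w)-\mathfrak t\otimes(w+|w|^2\mathfrak t)}{1+|w|^2}\Big],\quad \mathfrak t=\tfrac{p}{|p|},\ \ \alpha(p)=\mathfrak m(p)|p|\phi(p),\ \ w=w(p)=\tfrac{|p|}{\phi(p)}\phi'(p)-\tfrac{p}{|p|},$$ where $(a\otimes b)z=(b\cdot z)a$. Let $T>0$. The weak problem is to find $x:I\times[0,T]\to\mathbb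 R^d$ such that for all $t\in(0,T]$ $$\int_I H(x_\rho)x_t\cdot\eta\,d\rho+\int_I\Phi'(x_\rho)\cdot\eta_\rho\,d\rho=0\qquad\forall\,\eta\in[H^1(I)]^d .$$ **Discretization.** For a partition $0=q_0<\dots<q_J=1$ let $I_j=[q_{j-1},q_j]$, $h_j=q_j-q_{j-1}$, $h=\max_jh_j$, and let $\underline V^h$ be the set of continuous functions $I\to\mathbb R^d$ that are affine on each $I_j$. Given a constant $c>0$, only partitions with $h\le c\,h_j$ for all $j$ are considered. Let $\Delta t=T/M$ with $M\in\mathbb N$, $M\ge1$, and $t_m=m\Delta t$. For a curve $y$ with $y_\rho\ne0$, the projection $Q_hy\in\underline V^h$ is defined by $$\int_I\Phi''(y_\rho)(Q_hy-y)_\rho\cdot\eta_{h,\rho}\,d\rho+\int_I(Q_hy-y)\cdot\eta_h\,d\rho=0\qquad\forall\,\eta_h\in\underline V^h .$$ The scheme is: $x_h^0=Q_hx(\cdot,0)$ and, for $m=0,\dots,M-1$, find $x_h^{m+1}\in\underline V^h$ with $$\frac1{\Delta t}\int_IH(x^m_{h,\rho})(x_h^{m+1}-x_h^m)\cdot\eta_h\,d\rho+\int_I\Phi'(x^{m+1}_{h,\rho})\cdot\eta_{h,\rho}\,d\rho=0\qquad\forall\,\eta_h\in\underline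 V^h .$$ **Theorem 3.2.** Suppose that the weak problem has a solution $x$ with $x\in W^{1,\infty}(0,T;[W^{2,\infty}(I)]^d)$, $x_{tt}\in L^\infty(0,T;[L^\infty(I)]^d)$ and $c_0\le|x_\rho|\le C_0$ in $I\times[0,T]$ for some constants $c_0,C_0>0$. Then there exist $\delta>0$, $h_0>0$ and $C>0$, independent of $h$ and $\Delta t$, such that for every such partition and every $M$ with $0<h\le h_0$ and $\Delta t\le\delta h$ the scheme has a unique solution $(x_h^m)_{m=0,\dots,M}$, which satisfies $x^m_{h,\rho}\neq0$ almost everywhere in $I$ for all $m$, and, with $x^m=x(\cdot,t_m)$, $$\max_{0\le m\le M}\|x^m-x_h^m\|_0^2\le C\big(h^4+(\Delta t)^2\big),\qquad \max_{0\le m\le M}|x^m-x_h^m|_1^2\le C\big(h^2+(\Delta t)^2\big),$$ where $\|\cdot\|_0$ is the norm of $L^2(I)$ and $|\cdot|_1$ the seminorm $v\mapsto\|v_\rho\|_0$. -/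

import Mathlib

open MeasureTheory Set
open scoped ContDiff ENNReal

noncomputable section

namespace ACSF

/-! ### Sobolev spaces on the periodic interval

Functions on `I = ℝ/ℤ` are represented by functions on `ℝ` of period one, or, when they are only
defined almost everywhere, by functions on the fundamental domain `(0, 1]`. -/

/-- The Euclidean space `ℝ^d`. -/
abbrev E (d : ℕ) : Type := EuclideanSpace ℝ (Fin d)

/-- Lebesgue measure on the periodic interval `I`. -/
abbrev muI : Measure ℝ := volume.restrict (Ioc (0 : ℝ) 1)

/-- `v` is the weak derivative of `u` on `I = ℝ/ℤ`: integration by parts holds against all smooth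
one-periodic test functions. -/
def IsWeakDeriv {F : Type*} [NormedAddCommGroup F] [NormedSpace ℝ F] (u v : ℝ → F) : Prop :=
  ∀ ψ : ℝ → ℝ, ContDiff ℝ ∞ ψ → Function.Periodic ψ 1 →
    ∫ ρ in (0 : ℝ)..1, deriv ψ ρ • u ρ = -∫ ρ in (0 : ℝ)..1, ψ ρ • v ρ

instance : IsProbabilityMeasure muI := ⟨by simp⟩

theorem exists_bound {ψ : ℝ → ℝ} (hψ : Continuous ψ) :
    ∃ K : ℝ, ∀ᵐ ρ ∂muI, ‖ψ ρ‖ ≤ K := by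
  obtain ⟨K, hK⟩ := isCompact_Icc.exists_bound_of_continuousOn
    (hψ.continuousOn (s := Icc (0 : ℝ) 1))
  exact ⟨K, (ae_restrict_mem measurableSet_Ioc).mono fun ρ hρ => hK ρ (Ioc_subset_Icc_self hρ)⟩

theorem integrable_smul_Lp {F : Type*} [NormedAddCommGroup F] [NormedSpace ℝ F] {p : ℝ≥0∞}
    [hp : Fact (1 ≤ p)] {ψ : ℝ → ℝ} (hψ : Continuous ψ) (u : Lp F p muI) :
    Integrable (fun ρ => ψ ρ • u ρ) muI := by
  obtain ⟨K, hK⟩ := exists_bound hψ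
  exact ((Lp.memLp u).integrable hp.out).bdd_smul K hψ.aestronglyMeasurable hK

/-- The continuous linear functional `u ↦ ∫_I ψ u` on `L^p(I; F)`. -/
def pairing {F : Type*} [NormedAddCommGroup F] [NormedSpace ℝ F] (p : ℝ≥0∞)
    [hp : Fact (1 ≤ p)] (ψ : ℝ → ℝ) (hψ : Continuous ψ) : Lp F p muI →L[ℝ] F :=
  LinearMap.mkContinuousOfExistsBound
    { toFun := fun u => ∫ ρ in (0 : ℝ)..1, ψ ρ • u ρ
      map_add' := fun u v => by
        simp only [intervalIntegral.integral_of_le zero_le_one]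
        rw [← integral_add (integrable_smul_Lp hψ u) (integrable_smul_Lp hψ v)]
        refine integral_congr_ae ?_
        filter_upwards [Lp.coeFn_add u v] with ρ h
        rw [h, Pi.add_apply, smul_add]
      map_smul' := fun a u => by
        simp only [intervalIntegral.integral_of_le zero_le_one, RingHom.id_apply]
        rw [← integral_smul]
        refine integral_congr_ae ?_
        filter_upwards [Lp.coeFn_smul a u] with ρ h
        rw [h, Pi.smul_apply, smul_comm] }
    (by
      obtain ⟨K, hK⟩ := exists_bound hψ
      refine ⟨|K|, fun u => ?_⟩
      have hu := (Lp.memLp u).integrable hp.out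
      have h1 : ∫ ρ, ‖u ρ‖ ∂muI ≤ ‖u‖ := by
        rw [integral_norm_eq_lintegral_enorm hu.1, Lp.norm_def, ← eLpNorm_one_eq_lintegral_enorm]
        exact ENNReal.toReal_mono (Lp.eLpNorm_ne_top u)
          (eLpNorm_le_eLpNorm_of_exponent_le hp.out hu.1)
      have h2 : ‖∫ ρ, ψ ρ • u ρ ∂muI‖ ≤ ∫ ρ, |K| * ‖u ρ‖ ∂muI := by
        refine norm_integral_le_of_norm_le (hu.norm.const_mul _) ?_
        filter_upwards [hK] with ρ h
        rw [norm_smul]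
        exact mul_le_mul_of_nonneg_right (h.trans (le_abs_self K)) (norm_nonneg _)
      rw [integral_const_mul] at h2
      simp only [LinearMap.coe_mk, AddHom.coe_mk, intervalIntegral.integral_of_le zero_le_one]
      exact h2.trans (mul_le_mul_of_nonneg_left h1 (abs_nonneg K)))

/-- The Sobolev space `W^{ℓ,p}(I; F)`: an element is the family `(u, u', …, u^{(ℓ)})` of a function
and its weak derivatives, all of them in `L^p(I; F)`, with the maximum of the `L^p` norms as its
norm. -/
def Sobolev (F : Type*) [NormedAddCommGroup F] [NormedSpace ℝ F] (ℓ : ℕ) (p : ℝ≥0∞)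
    [Fact (1 ≤ p)] : Submodule ℝ (Fin (ℓ + 1) → Lp F p muI) where
  carrier := {u | ∀ i : Fin ℓ, IsWeakDeriv (u i.castSucc) (u i.succ)}
  add_mem' {u v} hu hv i ψ hψ hper := by
    have e1 := map_add (pairing p (deriv ψ) (hψ.continuous_deriv (by simp)))
      (u i.castSucc) (v i.castSucc)
    have e2 := map_add (pairing p ψ hψ.continuous) (u i.succ) (v i.succ)
    have hu' := hu i ψ hψ hper
    have hv' := hv i ψ hψ hper
    simp only [pairing, LinearMap.mkContinuousOfExistsBound_apply, LinearMap.coe_mk,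
      AddHom.coe_mk] at e1 e2
    rw [Pi.add_apply, Pi.add_apply, e1, e2, hu', hv', neg_add]
  zero_mem' i ψ hψ hper := by
    have e1 := map_zero (pairing (F := F) p (deriv ψ) (hψ.continuous_deriv (by simp)))
    have e2 := map_zero (pairing (F := F) p ψ hψ.continuous)
    simp only [pairing, LinearMap.mkContinuousOfExistsBound_apply, LinearMap.coe_mk,
      AddHom.coe_mk] at e1 e2
    rw [Pi.zero_apply, Pi.zero_apply, e1, e2, neg_zero]
  smul_mem' a u hu i ψ hψ hper := by
    have e1 := map_smul (pairing p (deriv ψ) (hψ.continuous_deriv (by simp))) a (u i.castSucc)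
    have e2 := map_smul (pairing p ψ hψ.continuous) a (u i.succ)
    have hu' := hu i ψ hψ hper
    simp only [pairing, LinearMap.mkContinuousOfExistsBound_apply, LinearMap.coe_mk,
      AddHom.coe_mk] at e1 e2
    rw [Pi.smul_apply, Pi.smul_apply, e1, e2, hu', smul_neg]

theorem isClosed_sobolev (F : Type*) [NormedAddCommGroup F] [NormedSpace ℝ F] (ℓ : ℕ) (p : ℝ≥0∞)
    [Fact (1 ≤ p)] : IsClosed (Sobolev F ℓ p : Set (Fin (ℓ + 1) → Lp F p muI)) := by
  have h : (Sobolev F ℓ p : Set (Fin (ℓ + 1) → Lp F p muI)) =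
      ⋂ (i : Fin ℓ) (ψ : ℝ → ℝ) (hψ : ContDiff ℝ ∞ ψ) (_ : Function.Periodic ψ 1),
        {u | pairing p (deriv ψ) (hψ.continuous_deriv (by simp)) (u i.castSucc) =
          -pairing p ψ hψ.continuous (u i.succ)} := by
    ext u
    simp only [mem_iInter]
    exact Iff.rfl
  rw [h]
  refine isClosed_iInter fun i => isClosed_iInter fun ψ => isClosed_iInter fun hψ =>
    isClosed_iInter fun _ => isClosed_eq ?_ ?_
  · exact (ContinuousLinearMap.continuous _).comp (continuous_apply _)
  · exact ((ContinuousLinearMap.continuous _).comp (continuous_apply _)).neg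

/-- `W^{ℓ,p}(I; F)` is a Banach space. -/
instance (F : Type*) [NormedAddCommGroup F] [NormedSpace ℝ F] [CompleteSpace F] (ℓ : ℕ)
    (p : ℝ≥0∞) [Fact (1 ≤ p)] : CompleteSpace (Sobolev F ℓ p) :=
  (isClosed_sobolev F ℓ p).completeSpace_coe

/-- `W^{2,∞}(I; ℝ^d)`. -/
abbrev W2inf (d : ℕ) := Sobolev (E d) 2 ∞

/-- `H^1(I; ℝ^d)`. -/
abbrev H1 (d : ℕ) := Sobolev (E d) 1 2

/-! ### Time-dependent functions -/

/-- `v` is the weak derivative on `(0, T)` of the Banach space valued function `u`. -/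
def IsWeakTimeDeriv {B : Type*} [NormedAddCommGroup B] [NormedSpace ℝ B] (T : ℝ) (u v : ℝ → B) :
    Prop :=
  ∀ ψ : ℝ → ℝ, ContDiff ℝ ∞ ψ → tsupport ψ ⊆ Ioo 0 T →
    ∫ t in (0 : ℝ)..T, deriv ψ t • u t = -∫ t in (0 : ℝ)..T, ψ t • v t

/-- `u ∈ L^∞(0, T; B)`. -/
def MemLinfTime {B : Type*} [NormedAddCommGroup B] (T : ℝ) (u : ℝ → B) : Prop :=
  MemLp u ∞ (volume.restrict (Ioo 0 T))

/-- The function `x : [0, T] × I → ℝ^d`, written `x t ρ`, satisfies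
`x ∈ W^{1,∞}(0, T; W^{2,∞}(I; ℝ^d))` and `x_tt ∈ L^∞(0, T; L^∞(I; ℝ^d))`.
As usual, `x` is the representative that is continuous on `[0, T] × I`. -/
structure HasRegularity {d : ℕ} (T : ℝ) (x : ℝ → ℝ → E d) : Prop where
  continuousOn : ContinuousOn (fun z : ℝ × ℝ => x z.1 z.2) (Icc 0 T ×ˢ univ)
  periodic : ∀ t ∈ Icc 0 T, Function.Periodic (x t) 1
  sobolev : ∃ (U V : ℝ → W2inf d) (A : ℝ → Lp (E d) ∞ muI),
    -- `U` is `x`, seen as a function of time with values in `W^{2,∞}(I; ℝ^d)`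
    (∀ᵐ t ∂volume.restrict (Ioo 0 T), (U t).1 0 =ᵐ[muI] x t) ∧
    -- `x` and `x_t = V` belong to `L^∞(0, T; W^{2,∞})`
    MemLinfTime T U ∧ MemLinfTime T V ∧ IsWeakTimeDeriv T U V ∧
    -- `x_tt = A` belongs to `L^∞(0, T; L^∞)`
    MemLinfTime T A ∧ IsWeakTimeDeriv T (fun t => (V t).1 0) A

/-! ### Anisotropy, mobility and the matrix `H` -/

/-- The Hessian of `f` at `p`, as a linear map. -/
def hess {d : ℕ} (f : E d → ℝ) (p : E d) : E d →L[ℝ] E d := fderiv ℝ (gradient f) p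

/-- Assumptions on the anisotropic energy density `φ`. -/
structure IsAnisotropy {d : ℕ} (φ : E d → ℝ) : Prop where
  continuous : Continuous φ
  nonneg : ∀ p, 0 ≤ φ p
  pos : ∀ p, p ≠ 0 → 0 < φ p
  contDiffOn : ContDiffOn ℝ 4 φ {0}ᶜ
  homogeneous : ∀ (a : ℝ) (p : E d), φ (a • p) = |a| * φ p
  strictConvex : ∀ p q : E d, ‖p‖ = 1 → ‖q‖ = 1 → inner ℝ p q = 0 →
    0 < inner ℝ (hess φ p q) q

/-- Assumptions on the mobility, extended 0-homogeneously to `ℝ^d \ {0}`. -/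
structure IsMobility {d : ℕ} (mob : E d → ℝ) : Prop where
  pos : ∀ p, p ≠ 0 → 0 < mob p
  contDiffOn : ContDiffOn ℝ 3 mob {0}ᶜ
  homogeneous : ∀ (a : ℝ) (p : E d), 0 < a → p ≠ 0 → mob (a • p) = mob p

/-- `Φ = φ²/2`. -/
def Phi {d : ℕ} (φ : E d → ℝ) (p : E d) : ℝ := φ p ^ 2 / 2

/-- The tensor product `a ⊗ b`, acting by `(a ⊗ b) z = (b · z) a`. -/
def tens {d : ℕ} (a b : E d) : E d →L[ℝ] E d := (innerSL ℝ b).smulRight a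

/-- `w(p) = (|p| / φ(p)) φ'(p) - p / |p|`. -/
def wvec {d : ℕ} (φ : E d → ℝ) (p : E d) : E d :=
  (‖p‖ / φ p) • gradient φ p - ‖p‖⁻¹ • p

/-- `H(p)`, used for `p ≠ 0`, with `α(p) = mob(p) |p| φ(p)` and `w = w(p)`. -/
def Hmat {d : ℕ} (φ mob : E d → ℝ) (p : E d) : E d →L[ℝ] E d :=
  (mob p * ‖p‖ * φ p) •
    (ContinuousLinearMap.id ℝ (E d) +
      (1 + ‖wvec φ p‖ ^ 2)⁻¹ •
        (tens (wvec φ p) (‖p‖⁻¹ • p - wvec φ p) -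
          tens (‖p‖⁻¹ • p) (wvec φ p + ‖wvec φ p‖ ^ 2 • (‖p‖⁻¹ • p))))

/-- `x` solves, for every `t ∈ (0, T]`,
`∫_I H(x_ρ) x_t · η + ∫_I Φ'(x_ρ) · η_ρ = 0` for all `η ∈ H^1(I; ℝ^d)`.
The time derivative at `t = T` is one-sided. -/
def IsWeakSolution {d : ℕ} (φ mob : E d → ℝ) (T : ℝ) (x : ℝ → ℝ → E d) : Prop :=
  ∀ t ∈ Ioc 0 T, ∀ η : H1 d,
    (∫ ρ in (0 : ℝ)..1,
      inner ℝ (Hmat φ mob (deriv (x t) ρ) (derivWithin (fun s => x s ρ) (Icc 0 T) t)) (η.1 0 ρ)) +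
    (∫ ρ in (0 : ℝ)..1, inner ℝ (gradient (Phi φ) (deriv (x t) ρ)) (η.1 1 ρ)) = 0

/-! ### Finite elements -/

/-- A partition `0 = q_0 < q_1 < … < q_J = 1`. -/
structure Mesh (J : ℕ) where
  q : Fin (J + 1) → ℝ
  strictMono : StrictMono q
  first : q 0 = 0
  last : q (Fin.last J) = 1

/-- The length of a subinterval. -/
def Mesh.len {J : ℕ} (Q : Mesh J) (j : Fin J) : ℝ := Q.q j.succ - Q.q j.castSucc

/-- The mesh size `h`, the largest length (note that `J ≥ 1` for every mesh). -/
def Mesh.size {J : ℕ} (Q : Mesh J) : ℝ := ⨆ j, Q.len j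

/-- `χ ∈ [V^h]^d`: `χ` is continuous on `I` and affine on each subinterval. -/
structure IsFE {d J : ℕ} (Q : Mesh J) (χ : ℝ → E d) : Prop where
  continuous : Continuous χ
  periodic : Function.Periodic χ 1
  affine : ∀ j : Fin J, ∃ a b : E d, ∀ ρ ∈ Icc (Q.q j.castSucc) (Q.q j.succ), χ ρ = a + ρ • b

/-- `z = Q_h y`, the nonlinear Ritz-type projection of `y`. -/
def IsRitz {d J : ℕ} (φ : E d → ℝ) (Q : Mesh J) (y z : ℝ → E d) : Prop :=
  IsFE Q z ∧ ∀ η : ℝ → E d, IsFE Q η →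
    (∫ ρ in (0 : ℝ)..1,
      inner ℝ (hess (Phi φ) (deriv y ρ) (deriv z ρ - deriv y ρ)) (deriv η ρ)) +
    (∫ ρ in (0 : ℝ)..1, inner ℝ (z ρ - y ρ) (η ρ)) = 0

/-- `X = (x_h^0, …, x_h^M)` solves the fully discrete scheme with initial curve `x0` and time step
`dt`. The derivative of a finite element function is its elementwise derivative; the values at the
nodes are irrelevant. -/
structure IsDiscreteSolution {d J M : ℕ} (φ mob : E d → ℝ) (Q : Mesh J) (dt : ℝ) (x0 : ℝ → E d)
    (X : Fin (M + 1) → ℝ → E d) : Prop where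
  initial : IsRitz φ Q x0 (X 0)
  mem : ∀ m, IsFE Q (X m)
  step : ∀ m : Fin M, ∀ η : ℝ → E d, IsFE Q η →
    1 / dt * (∫ ρ in (0 : ℝ)..1,
      inner ℝ (Hmat φ mob (deriv (X m.castSucc) ρ) (X m.succ ρ - X m.castSucc ρ)) (η ρ)) +
    (∫ ρ in (0 : ℝ)..1, inner ℝ (gradient (Phi φ) (deriv (X m.succ) ρ)) (deriv η ρ)) = 0

/-- `‖u - v‖_0²`, the squared `L²(I)` distance. -/
def errL2sq {d : ℕ} (u v : ℝ → E d) : ℝ := ∫ ρ in (0 : ℝ)..1, ‖u ρ - v ρ‖ ^ 2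

/-- `|u - v|_1²`, the squared `H¹(I)` semi-distance, for (piecewise) differentiable functions. -/
def errH1sq {d : ℕ} (u v : ℝ → E d) : ℝ := ∫ ρ in (0 : ℝ)..1, ‖deriv u ρ - deriv v ρ‖ ^ 2

end ACSF

end

open ACSF

/-! The discrete curve is compared with the nodal interpolant `y` of the exact curve at each time
level; the Ritz projection matters only for the initial value. In one dimension the interpolant is
superclose: `x - y` vanishes at the nodes, so on each element `(x - y)_ρ` integrates to zero against
constants. Applied to the linear parts of `H(x_ρ) - H(y_ρ)` and `Φ'(x_ρ) - Φ'(y_ρ)`, which are only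
of order `h`, this leaves terms of order `h²`. Hence (`consistency`, `Setup.exists_approxScheme`)
the interpolant solves the scheme up to a residual `R` of order `h² + Δt` tested with `η` and a
residual `F` of order `h²` tested with `η_ρ`; moreover `F` changes only by `O(h² Δt)` in one time
step.

For stability, the equation for the error `e = y - X` is tested with its time increment `g`.
Coercivity of `H` yields `‖g‖² / Δt`, which absorbs `R` and the Lipschitz error of `H`. By convexity
the elliptic term dominates the increment of the Bregman distance `breg`, which is comparable to
`|e_ρ|²`; its dependence on the moving base point is controlled by third derivatives of `Φ` away
from the origin. Since `g_ρ` is not controlled, the term with `F` is summed by parts in time: `∫ F ·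
e_ρ` becomes part of `energy`. With a multiple of `‖e‖²` and a multiple of `ε²` added, where `ε = h²
+ Δt`, one step multiplies the energy by at most `1 + C Δt` (`ApproxScheme.energy_succ_le`). A
discrete Gronwall argument gives `e = O(ε)` in both `L²` and `H¹`, and the interpolation error is
added at the end.

These estimates need `X_ρ` to stay in an annulus, where the data are smooth and `H` is uniformly
coercive. As `Δt ≤ h`, `|e|_1² = O(ε²) = O(h²)`, and the inverse inequality `h ‖e_ρ‖_∞² ≤ c |e|_1²`
gives `‖e_ρ‖_∞² = O(h)`; for small `h` the induction over time levels closes. On the annulus `Φ`,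
`Φ'` and `H` are replaced by compactly supported `P`, `Ψ` and `Hh` with global Taylor bounds.

Each step is uniquely solvable because the matrix is frozen at the old curve and `Φ'` is strongly
monotone on all of `ℝ^d`, even across the origin (`IsAnisotropy.exists_convexBounds`). The Sobolev
hypotheses on `x` enter only through the pointwise Lipschitz bounds of `CurveRegularity`. -/

noncomputable section

open MeasureTheory Set
open scoped ContDiff ENNReal

namespace ACSF

/-! ### Strongly monotone operators -/

/-- A Lipschitz continuous, strongly monotone map of a Hilbert space has a unique zero. -/
theorem existsUnique_zero_of_stronglyMonotone {V : Type*} [NormedAddCommGroup V]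
    [InnerProductSpace ℝ V] [CompleteSpace V] (A : V → V) {c M : ℝ} (hc : 0 < c) (hM : 0 ≤ M)
    (hmono : ∀ u v, c * ‖u - v‖ ^ 2 ≤ inner ℝ (A u - A v) (u - v))
    (hlip : ∀ u v, ‖A u - A v‖ ≤ M * ‖u - v‖) : ∃! u, A u = 0 := by
  -- The zeros of `A` are the fixed points of `u ↦ u - τ • A u`, whose Lipschitz constant is at most
  -- `√q` for this choice of `τ`. Enlarging `M` to `M + c` makes it positive and gives `c ≤ M'`,
  -- hence `0 ≤ q`.
  set M' := M + c with hM'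
  have hM'pos : 0 < M' := by positivity
  set τ := c / M' ^ 2 with hτ
  have hτpos : 0 < τ := by positivity
  set q := 1 - c ^ 2 / M' ^ 2 with hq
  have hq0 : 0 ≤ q := by
    have : c ^ 2 / M' ^ 2 ≤ 1 := by
      rw [div_le_one (by positivity)]
      gcongr
      linarith
    linarith
  have hq1 : q < 1 := by
    have : 0 < c ^ 2 / M' ^ 2 := by positivity
    linarith
  have hcontr : ContractingWith (Real.toNNReal (√q)) (fun u => u - τ • A u) := by
    refine ⟨?_, LipschitzWith.of_dist_le_mul fun u v => ?_⟩
    · rw [← NNReal.coe_lt_coe, Real.coe_toNNReal _ (Real.sqrt_nonneg _), NNReal.coe_one,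
        Real.sqrt_lt' one_pos]
      simpa using hq1
    · rw [Real.coe_toNNReal _ (Real.sqrt_nonneg _), dist_eq_norm, dist_eq_norm]
      have e1 : (u - τ • A u) - (v - τ • A v) = (u - v) - τ • (A u - A v) := by
        rw [smul_sub]; abel
      rw [e1]
      refine abs_le_of_sq_le_sq' ?_ (by positivity) |>.2
      rw [norm_sub_sq_real, mul_pow, Real.sq_sqrt hq0, inner_smul_right, norm_smul, mul_pow,
        Real.norm_of_nonneg hτpos.le]
      have h1 := hmono u v
      rw [real_inner_comm] at h1
      have h2 : ‖A u - A v‖ ^ 2 ≤ M' ^ 2 * ‖u - v‖ ^ 2 := by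
        rw [← mul_pow]
        gcongr
        exact (hlip u v).trans (by gcongr; linarith)
      have h3 : τ ^ 2 * ‖A u - A v‖ ^ 2 ≤ τ ^ 2 * (M' ^ 2 * ‖u - v‖ ^ 2) := by gcongr
      have h4 : τ * (c * ‖u - v‖ ^ 2) ≤ τ * inner ℝ (u - v) (A u - A v) := by gcongr
      have h5 : q * ‖u - v‖ ^ 2 = ‖u - v‖ ^ 2 - 2 * (τ * (c * ‖u - v‖ ^ 2))
          + τ ^ 2 * (M' ^ 2 * ‖u - v‖ ^ 2) := by
        rw [hq, hτ]; field_simp; ring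
      rw [h5]; linarith
  refine ⟨hcontr.fixedPoint, ?_, fun v hv => ?_⟩
  · have h := hcontr.fixedPoint_isFixedPt
    unfold Function.IsFixedPt at h
    have h' : τ • A hcontr.fixedPoint = 0 := by
      simpa using h
    exact (smul_eq_zero.mp h').resolve_left hτpos.ne'
  · apply hcontr.fixedPoint_unique
    simp only [] at hv
    simp [Function.IsFixedPt, hv]

/-- Unique solvability of strongly monotone variational equations in finite dimensions. -/
theorem existsUnique_variational {V : Type*} [AddCommGroup V] [Module ℝ V] [FiniteDimensional ℝ V]
    (b : InnerProductSpace.Core ℝ V) (a : V → V →ₗ[ℝ] ℝ) {c M : ℝ} (hc : 0 < c) (hM : 0 ≤ M)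
    (hmono : ∀ u v, c * b.inner (u - v) (u - v) ≤ a u (u - v) - a v (u - v))
    (hlip : ∀ u v w, (a u w - a v w) ^ 2 ≤ M ^ 2 * b.inner (u - v) (u - v) * b.inner w w) :
    ∃! u, ∀ w, a u w = 0 := by
  -- The form `b` turns `V` into a Hilbert space, and the Riesz representation of `a u` turns the
  -- variational equation into `A u = 0`.
  let _ : NormedAddCommGroup V := b.toNormedAddCommGroup
  let _ : InnerProductSpace ℝ V := InnerProductSpace.ofCore b.toCore
  have : CompleteSpace V := FiniteDimensional.complete ℝ V
  have hn : ∀ u : V, b.inner u u = ‖u‖ ^ 2 := fun u => real_inner_self_eq_norm_sq u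
  simp only [hn] at hmono hlip
  set A : V → V := fun u => (InnerProductSpace.toDual ℝ V).symm (LinearMap.toContinuousLinearMap (a u))
    with hA
  have hAi : ∀ u w, inner ℝ (A u) w = a u w := fun u w => by
    simp [hA, InnerProductSpace.toDual_symm_apply]
  have key := existsUnique_zero_of_stronglyMonotone A hc hM
    (fun u v => by rw [inner_sub_left, hAi, hAi]; exact hmono u v)
    (fun u v => by
      have h := hlip u v (A u - A v)
      rw [← hAi, ← hAi, ← inner_sub_left, real_inner_self_eq_norm_sq, ← mul_pow, ← mul_pow] at h
      have h' := abs_le_of_sq_le_sq' h (by positivity) |>.2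
      rcases (norm_nonneg (A u - A v)).eq_or_lt with h0 | h0
      · rw [← h0]; positivity
      · rw [sq] at h'
        exact le_of_mul_le_mul_right h' h0)
  have hiff : ∀ u, A u = 0 ↔ ∀ w, a u w = 0 := fun u => by
    constructor
    · intro h w; rw [← hAi, h, inner_zero_left]
    · intro h
      have := h (A u)
      rw [← hAi] at this
      exact inner_self_eq_zero.mp this
  obtain ⟨u, hu, huniq⟩ := key
  exact ⟨u, (hiff u).mp hu, fun v hv => huniq v ((hiff v).mpr hv)⟩

/-! ### Taylor remainders -/

section Taylor

variable {G F : Type*} [NormedAddCommGroup G] [NormedSpace ℝ G] [NormedAddCommGroup F]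
  [NormedSpace ℝ F]

/-- The first order Taylor remainder of `f` at `p`. -/
def taylorRem (f : G → F) (p ξ : G) : F := f (p + ξ) - f p - fderiv ℝ f p ξ

/-- Mean value inequality: the derivative of the remainder at `ζ` is `f'(p + ζ) - f'(p)`, and `‖ζ‖ ≤
‖ξ‖ + ‖ξ'‖` on the segment. -/
theorem norm_taylorRem_sub_le {f : G → F} (hf : Differentiable ℝ f) {K : ℝ}
    (hK : ∀ p q, ‖fderiv ℝ f p - fderiv ℝ f q‖ ≤ K * ‖p - q‖) (hK0 : 0 ≤ K) (p ξ ξ' : G) :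
    ‖taylorRem f p ξ - taylorRem f p ξ'‖ ≤ K * ‖ξ - ξ'‖ * (‖ξ‖ + ‖ξ'‖) := by
  have hd : ∀ ζ ∈ segment ℝ ξ' ξ, HasFDerivWithinAt (taylorRem f p)
      (fderiv ℝ f (p + ζ) - fderiv ℝ f p) (segment ℝ ξ' ξ) ζ := by
    intro ζ _
    have h1 : HasFDerivAt (fun ζ => f (p + ζ)) (fderiv ℝ f (p + ζ)) ζ := by
      simpa [Function.comp_def] using
        (hf (p + ζ)).hasFDerivAt.comp ζ ((hasFDerivAt_id ζ).const_add p)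
    exact ((h1.sub_const (f p)).sub (fderiv ℝ f p).hasFDerivAt).hasFDerivWithinAt
  have hb : ∀ ζ ∈ segment ℝ ξ' ξ, ‖fderiv ℝ f (p + ζ) - fderiv ℝ f p‖ ≤ K * (‖ξ‖ + ‖ξ'‖) := by
    intro ζ hζ
    refine (hK _ _).trans ?_
    gcongr
    rw [add_sub_cancel_left]
    obtain ⟨s, t, hs, ht, hst, rfl⟩ := hζ
    refine (norm_add_le _ _).trans ?_
    rw [norm_smul, norm_smul, Real.norm_of_nonneg hs, Real.norm_of_nonneg ht]
    nlinarith [norm_nonneg ξ, norm_nonneg ξ']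
  have := (convex_segment ξ' ξ).norm_image_sub_le_of_norm_hasFDerivWithin_le hd hb
    (left_mem_segment ℝ ξ' ξ) (right_mem_segment ℝ ξ' ξ)
  calc _ ≤ _ := this
    _ = _ := by ring

theorem norm_taylorRem_le {f : G → F} (hf : Differentiable ℝ f) {K : ℝ}
    (hK : ∀ p q, ‖fderiv ℝ f p - fderiv ℝ f q‖ ≤ K * ‖p - q‖) (hK0 : 0 ≤ K) (p ξ : G) :
    ‖taylorRem f p ξ‖ ≤ K * ‖ξ‖ ^ 2 := by
  have := norm_taylorRem_sub_le hf hK hK0 p ξ 0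
  simpa [taylorRem, sq, mul_assoc] using this

/-- By symmetry of the second derivative, differentiating the remainder of `f` in the base point
gives the remainder of `f'`. That is quadratic in `ξ` with the Lipschitz constant of `f''`, and the
mean value inequality in the base point concludes. -/
theorem norm_taylorRem_base_sub_le {f : G → F} (hf : ContDiff ℝ 2 f) {K : ℝ}
    (hK : ∀ p q, ‖fderiv ℝ (fderiv ℝ f) p - fderiv ℝ (fderiv ℝ f) q‖ ≤ K * ‖p - q‖)
    (hK0 : 0 ≤ K) (p p' ξ : G) :
    ‖taylorRem f p ξ - taylorRem f p' ξ‖ ≤ K * ‖p - p'‖ * ‖ξ‖ ^ 2 := by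
  have hf1 : Differentiable ℝ f := hf.differentiable (by norm_num)
  have hf2 : Differentiable ℝ (fderiv ℝ f) :=
    (hf.fderiv_right (m := 1) (by norm_num)).differentiable (by norm_num)
  have hsymm : ∀ q ζ η : G, fderiv ℝ (fderiv ℝ f) q ζ η = fderiv ℝ (fderiv ℝ f) q η ζ :=
    fun q ζ η => second_derivative_symmetric (fun y => (hf1 y).hasFDerivAt) (hf2 q).hasFDerivAt ζ η
  have hd : ∀ q ∈ segment ℝ p' p, HasFDerivWithinAt (fun q => taylorRem f q ξ)
      (taylorRem (fderiv ℝ f) q ξ) (segment ℝ p' p) q := by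
    intro q _
    have h1 : HasFDerivAt (fun q => f (q + ξ)) (fderiv ℝ f (q + ξ)) q := by
      simpa [Function.comp_def] using
        (hf1 (q + ξ)).hasFDerivAt.comp q ((hasFDerivAt_id q).add_const ξ)
    have h2 : HasFDerivAt (fun q => fderiv ℝ f q ξ) ((fderiv ℝ (fderiv ℝ f) q).flip ξ) q :=
      (hf2 q).hasFDerivAt.clm_apply (hasFDerivAt_const ξ q) |>.congr_fderiv (by ext; simp)
    refine (((h1.sub (hf1 q).hasFDerivAt).sub h2).congr_fderiv ?_).hasFDerivWithinAt
    ext η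
    simp [taylorRem, hsymm q η ξ]
  have hb : ∀ q ∈ segment ℝ p' p, ‖taylorRem (fderiv ℝ f) q ξ‖ ≤ K * ‖ξ‖ ^ 2 :=
    fun q _ => norm_taylorRem_le hf2 hK hK0 q ξ
  have := (convex_segment p' p).norm_image_sub_le_of_norm_hasFDerivWithin_le hd hb
    (left_mem_segment ℝ p' p) (right_mem_segment ℝ p' p)
  calc _ ≤ _ := this
    _ = _ := by ring

/-- Bounds on a function, its first derivative and its first order Taylor remainder. -/
structure TaylorBound (f : G → F) (K : ℝ) : Prop where
  differentiable : Differentiable ℝ f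
  nonneg : 0 ≤ K
  norm_le : ∀ p, ‖f p‖ ≤ K
  fderiv_le : ∀ p, ‖fderiv ℝ f p‖ ≤ K
  lipschitz : ∀ p q, ‖f p - f q‖ ≤ K * ‖p - q‖
  fderiv_lipschitz : ∀ p q, ‖fderiv ℝ f p - fderiv ℝ f q‖ ≤ K * ‖p - q‖
  rem_le : ∀ p ξ, ‖taylorRem f p ξ‖ ≤ K * ‖ξ‖ ^ 2
  rem_sub_le : ∀ p ξ ξ', ‖taylorRem f p ξ - taylorRem f p ξ'‖ ≤ K * ‖ξ - ξ'‖ * (‖ξ‖ + ‖ξ'‖)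
  rem_base_sub_le : ∀ p p' ξ, ‖taylorRem f p ξ - taylorRem f p' ξ‖ ≤ K * ‖p - p'‖ * ‖ξ‖ ^ 2

theorem lipschitz_of_norm_fderiv_le {f : G → F} (hf : Differentiable ℝ f) {K : ℝ}
    (hK : ∀ p, ‖fderiv ℝ f p‖ ≤ K) (p q : G) : ‖f p - f q‖ ≤ K * ‖p - q‖ :=
  convex_univ.norm_image_sub_le_of_norm_fderiv_le (fun x _ => hf x) (fun x _ => hK x)
    (mem_univ q) (mem_univ p)

theorem exists_norm_fderiv_le {f : G → F} (hf : ContDiff ℝ 1 f) (hs : HasCompactSupport f) :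
    ∃ K, ∀ p, ‖fderiv ℝ f p‖ ≤ K :=
  (hs.fderiv (𝕜 := ℝ)).exists_bound_of_continuous (hf.continuous_fderiv (by norm_num))

theorem exists_taylorBound {f : G → F} (hf : ContDiff ℝ 3 f) (hs : HasCompactSupport f) :
    ∃ K, TaylorBound f K := by
  have h1 : ContDiff ℝ 2 (fderiv ℝ f) := hf.fderiv_right (m := 2) (by norm_num)
  have h2 : ContDiff ℝ 1 (fderiv ℝ (fderiv ℝ f)) := h1.fderiv_right (m := 1) (by norm_num)
  have s1 := hs.fderiv (𝕜 := ℝ)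
  obtain ⟨K0, hK0⟩ := hs.exists_bound_of_continuous hf.continuous
  obtain ⟨K1, hK1⟩ := exists_norm_fderiv_le (hf.of_le (by norm_num)) hs
  obtain ⟨K2, hK2⟩ := exists_norm_fderiv_le (h1.of_le (by norm_num)) s1
  obtain ⟨K3, hK3⟩ := exists_norm_fderiv_le h2 (s1.fderiv (𝕜 := ℝ))
  obtain ⟨K, k0, k1, k2, k3⟩ : ∃ K, K0 ≤ K ∧ K1 ≤ K ∧ K2 ≤ K ∧ K3 ≤ K :=
    ⟨max (max K0 K1) (max K2 K3), by simp, by simp, by simp, by simp⟩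
  have hK : 0 ≤ K := (norm_nonneg _).trans ((hK0 0).trans k0)
  have d0 : Differentiable ℝ f := hf.differentiable (by norm_num)
  have l1 := lipschitz_of_norm_fderiv_le (h1.differentiable (by norm_num))
    fun p => (hK2 p).trans k2
  have l2 := lipschitz_of_norm_fderiv_le (h2.differentiable (by norm_num))
    fun p => (hK3 p).trans k3
  refine ⟨K, ?_⟩
  exact
    { differentiable := d0
      nonneg := hK
      norm_le := fun p => (hK0 p).trans k0
      fderiv_le := fun p => (hK1 p).trans k1
      lipschitz := lipschitz_of_norm_fderiv_le d0 fun p => (hK1 p).trans k1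
      fderiv_lipschitz := l1
      rem_le := norm_taylorRem_le d0 l1 hK
      rem_sub_le := norm_taylorRem_sub_le d0 l1 hK
      rem_base_sub_le := norm_taylorRem_base_sub_le (hf.of_le (by norm_num)) l2 hK }

end Taylor

/-- A function that is smooth away from the origin agrees on an annulus with a compactly supported
smooth function. -/
theorem exists_truncation {d : ℕ} {F : Type*} [NormedAddCommGroup F] [NormedSpace ℝ F] {n : ℕ}
    {f : E d → F} (hf : ContDiffOn ℝ n f {0}ᶜ) {a b : ℝ} (ha : 0 < a) (hab : a < b) :
    ∃ g : E d → F, ContDiff ℝ n g ∧ HasCompactSupport g ∧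
      ∀ p, a ≤ ‖p‖ → ‖p‖ ≤ b → g p = f p := by
  have hb : 0 < b := ha.trans hab
  -- `χ₁` cuts off at infinity and `1 - χ₂` near the origin; their product is one on the annulus.
  let χ₁ : ContDiffBump (0 : E d) := ⟨b, 2 * b, hb, by linarith⟩
  let χ₂ : ContDiffBump (0 : E d) := ⟨a / 2, a, by linarith, by linarith⟩
  refine ⟨fun p => (χ₁ p * (1 - χ₂ p)) • f p, ?_, ?_, ?_⟩
  · rw [contDiff_iff_contDiffAt]
    intro p
    by_cases hp : p = 0
    · have : (fun p => (χ₁ p * (1 - χ₂ p)) • f p) =ᶠ[nhds p] fun _ => 0 := by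
        rw [hp]
        filter_upwards [Metric.ball_mem_nhds (0 : E d) (half_pos ha)] with q hq
        rw [χ₂.one_of_mem_closedBall (Metric.ball_subset_closedBall hq)]
        simp
      exact contDiffAt_const.congr_of_eventuallyEq this
    · exact (χ₁.contDiffAt.mul (contDiffAt_const.sub χ₂.contDiffAt)).smul
        (hf.contDiffAt (isOpen_compl_singleton.mem_nhds hp))
  · exact χ₁.hasCompactSupport.mul_right.smul_right
  · intro p h1 h2
    have e1 : χ₁ p = 1 := χ₁.one_of_mem_closedBall (by simpa using h2)
    have e2 : χ₂ p = 0 := χ₂.zero_of_le_dist (by simpa using h1)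
    simp [e1, e2]

/-! ### Essentially bounded integrands -/

section Bounded

variable {F F' : Type*} [NormedAddCommGroup F] [NormedAddCommGroup F']

/-- Essentially bounded functions on the periodic interval. -/
def Bdd (f : ℝ → F) : Prop := MemLp f ∞ muI

theorem Bdd.add {f g : ℝ → F} (hf : Bdd f) (hg : Bdd g) : Bdd (fun ρ => f ρ + g ρ) :=
  MemLp.add hf hg

theorem Bdd.sub {f g : ℝ → F} (hf : Bdd f) (hg : Bdd g) : Bdd (fun ρ => f ρ - g ρ) :=
  MemLp.sub hf hg

theorem Bdd.norm {f : ℝ → F} (hf : Bdd f) : Bdd (fun ρ => ‖f ρ‖) := MemLp.norm hf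

theorem Bdd.integrable {f : ℝ → F} (hf : Bdd f) : Integrable f muI :=
  MemLp.integrable (by simp) hf

theorem Bdd.exists_bound {f : ℝ → F} (hf : Bdd f) : ∃ K, 0 ≤ K ∧ ∀ᵐ ρ ∂muI, ‖f ρ‖ ≤ K := by
  refine ⟨(eLpNorm f ∞ muI).toReal, ENNReal.toReal_nonneg, ?_⟩
  have h := ae_le_eLpNormEssSup (f := f) (μ := muI)
  filter_upwards [h] with ρ hρ
  rw [← eLpNorm_exponent_top] at hρ
  have := ENNReal.toReal_mono hf.2.ne hρ
  simpa using this

theorem Bdd.of_bound {f : ℝ → F} (hf : AEStronglyMeasurable f muI) {K : ℝ}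
    (hK : ∀ᵐ ρ ∂muI, ‖f ρ‖ ≤ K) : Bdd f := memLp_top_of_bound hf K hK

theorem Bdd.of_continuous [SecondCountableTopology F] {f : ℝ → F} (hf : Continuous f) : Bdd f := by
  obtain ⟨K, hK⟩ := isCompact_Icc.exists_bound_of_continuousOn
    (hf.continuousOn (s := Icc (0 : ℝ) 1))
  exact .of_bound hf.aestronglyMeasurable (K := K)
    ((ae_restrict_mem measurableSet_Ioc).mono fun ρ hρ => hK ρ (Ioc_subset_Icc_self hρ))

theorem Bdd.const (a : F) : Bdd (fun _ => a) := memLp_const a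

theorem Bdd.smul [NormedSpace ℝ F] {f : ℝ → ℝ} {g : ℝ → F} (hf : Bdd f) (hg : Bdd g) :
    Bdd (fun ρ => f ρ • g ρ) := by
  obtain ⟨K, hK0, hK⟩ := hf.exists_bound
  obtain ⟨L, hL0, hL⟩ := hg.exists_bound
  refine .of_bound (hf.1.smul hg.1) (K := K * L) ?_
  filter_upwards [hK, hL] with ρ h1 h2
  rw [norm_smul]; gcongr

theorem Bdd.mul {f g : ℝ → ℝ} (hf : Bdd f) (hg : Bdd g) : Bdd (fun ρ => f ρ * g ρ) := hf.smul hg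

theorem Bdd.norm_sq {f : ℝ → F} (hf : Bdd f) : Bdd (fun ρ => ‖f ρ‖ ^ 2) := by
  simpa only [sq] using hf.norm.mul hf.norm

theorem Bdd.norm_mul {f : ℝ → F} {g : ℝ → F'} (hf : Bdd f) (hg : Bdd g) :
    Bdd (fun ρ => ‖f ρ‖ * ‖g ρ‖) := hf.norm.mul hg.norm

theorem Bdd.inner [InnerProductSpace ℝ F] {f g : ℝ → F} (hf : Bdd f) (hg : Bdd g) :
    Bdd (fun ρ => inner ℝ (f ρ) (g ρ)) := by
  obtain ⟨K, hK0, hK⟩ := hf.exists_bound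
  obtain ⟨L, hL0, hL⟩ := hg.exists_bound
  refine .of_bound (hf.1.inner hg.1) (K := K * L) ?_
  filter_upwards [hK, hL] with ρ h1 h2
  exact (norm_inner_le_norm _ _).trans (by gcongr)

theorem Bdd.clm_apply [NormedSpace ℝ F] [NormedSpace ℝ F'] {f : ℝ → F →L[ℝ] F'} {g : ℝ → F}
    (hf : Bdd f) (hg : Bdd g) : Bdd (fun ρ => f ρ (g ρ)) := by
  obtain ⟨K, hK0, hK⟩ := hf.exists_bound
  obtain ⟨L, hL0, hL⟩ := hg.exists_bound
  refine .of_bound (isBoundedBilinearMap_apply.continuous.comp_aestronglyMeasurable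
    (hf.1.prodMk hg.1)) (K := K * L) ?_
  filter_upwards [hK, hL] with ρ h1 h2
  exact ((f ρ).le_opNorm _).trans (by gcongr)

theorem integral_mono_bdd {f g : ℝ → ℝ} (hf : Bdd f) (hg : Bdd g)
    (h : ∀ᵐ ρ ∂muI, f ρ ≤ g ρ) : ∫ ρ, f ρ ∂muI ≤ ∫ ρ, g ρ ∂muI :=
  integral_mono_ae hf.integrable hg.integrable h

/-- The Cauchy-Schwarz inequality on the periodic interval. -/
theorem sq_integral_mul_le {f g : ℝ → ℝ} (hf : Bdd f) (hg : Bdd g) :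
    (∫ ρ, f ρ * g ρ ∂muI) ^ 2 ≤ (∫ ρ, f ρ ^ 2 ∂muI) * ∫ ρ, g ρ ^ 2 ∂muI := by
  have key : ∀ s : ℝ, 0 ≤ (∫ ρ, g ρ ^ 2 ∂muI) * (s * s) + (2 * ∫ ρ, f ρ * g ρ ∂muI) * s
      + ∫ ρ, f ρ ^ 2 ∂muI := by
    intro s
    have hf2 : Bdd (fun ρ => f ρ ^ 2) := by simpa only [sq] using hf.mul hf
    have hg2 : Bdd (fun ρ => g ρ ^ 2) := by simpa only [sq] using hg.mul hg
    have e : ∫ ρ, (f ρ + s * g ρ) ^ 2 ∂muI = (∫ ρ, g ρ ^ 2 ∂muI) * (s * s)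
        + (2 * ∫ ρ, f ρ * g ρ ∂muI) * s + ∫ ρ, f ρ ^ 2 ∂muI := by
      have : ∀ ρ, (f ρ + s * g ρ) ^ 2 = (s * s) * g ρ ^ 2 + (2 * s) * (f ρ * g ρ) + f ρ ^ 2 :=
        fun ρ => by ring
      simp_rw [this]
      have i1 := hg2.integrable.const_mul (s * s)
      have i2 := (hf.mul hg).integrable.const_mul (2 * s)
      rw [integral_add (f := fun ρ => s * s * g ρ ^ 2 + 2 * s * (f ρ * g ρ)) (i1.add i2) hf2.integrable,
        integral_add i1 i2, integral_const_mul,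
        integral_const_mul]
      ring
    rw [← e]
    exact integral_nonneg fun ρ => sq_nonneg _
  -- The quadratic polynomial `s ↦ ∫ (f + s g)²` is nonnegative, so its discriminant is not
  -- positive.
  have := discrim_le_zero key
  unfold discrim at this
  nlinarith

theorem sq_integral_norm_mul_norm_le {f : ℝ → F} {g : ℝ → F'} (hf : Bdd f) (hg : Bdd g) :
    (∫ ρ, ‖f ρ‖ * ‖g ρ‖ ∂muI) ^ 2 ≤ (∫ ρ, ‖f ρ‖ ^ 2 ∂muI) * ∫ ρ, ‖g ρ‖ ^ 2 ∂muI :=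
  sq_integral_mul_le hf.norm hg.norm

end Bounded

/-! ### The anisotropic energy density -/

section Anisotropy

variable {d : ℕ} {φ mob : E d → ℝ}

theorem contDiffOn_gradient {f : E d → ℝ} {n : ℕ} (hf : ContDiffOn ℝ (n + 1 : ℕ) f {0}ᶜ) :
    ContDiffOn ℝ n (gradient f) {0}ᶜ := by
  have h : ContDiffOn ℝ n (fderiv ℝ f) {0}ᶜ :=
    hf.fderiv_of_isOpen isOpen_compl_singleton (by norm_cast)
  exact (InnerProductSpace.toDual ℝ (E d)).symm.toContinuousLinearEquiv.contDiff.comp_contDiffOn h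

theorem IsAnisotropy.contDiffOn_gradient (hφ : IsAnisotropy φ) :
    ContDiffOn ℝ (3 : ℕ) (gradient φ) {0}ᶜ :=
  ACSF.contDiffOn_gradient (n := 3) (by exact_mod_cast hφ.contDiffOn)

theorem IsAnisotropy.contDiffOn_Phi (hφ : IsAnisotropy φ) :
    ContDiffOn ℝ (4 : ℕ) (Phi φ) {0}ᶜ := by
  have h : ContDiffOn ℝ (4 : ℕ) φ {0}ᶜ := by exact_mod_cast hφ.contDiffOn
  exact (h.pow 2).div_const 2

theorem IsAnisotropy.contDiffOn_gradient_Phi (hφ : IsAnisotropy φ) :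
    ContDiffOn ℝ (3 : ℕ) (gradient (Phi φ)) {0}ᶜ :=
  ACSF.contDiffOn_gradient (n := 3) hφ.contDiffOn_Phi

theorem differentiableAt_of_contDiffOn_compl {F : Type*} [NormedAddCommGroup F] [NormedSpace ℝ F]
    {f : E d → F} {n : ℕ} (hn : n ≠ 0) (hf : ContDiffOn ℝ n f {0}ᶜ) {p : E d} (hp : p ≠ 0) :
    DifferentiableAt ℝ f p :=
  (hf.contDiffAt (isOpen_compl_singleton.mem_nhds hp)).differentiableAt (by exact_mod_cast hn)

theorem IsAnisotropy.differentiableAt (hφ : IsAnisotropy φ) {p : E d} (hp : p ≠ 0) :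
    DifferentiableAt ℝ φ p :=
  differentiableAt_of_contDiffOn_compl (n := 4) (by norm_num)
    (by exact_mod_cast hφ.contDiffOn) hp

theorem IsAnisotropy.differentiableAt_gradient (hφ : IsAnisotropy φ) {p : E d} (hp : p ≠ 0) :
    DifferentiableAt ℝ (gradient φ) p :=
  differentiableAt_of_contDiffOn_compl (by norm_num) hφ.contDiffOn_gradient hp

theorem IsAnisotropy.differentiableAt_gradient_Phi (hφ : IsAnisotropy φ) {p : E d} (hp : p ≠ 0) :
    DifferentiableAt ℝ (gradient (Phi φ)) p :=
  differentiableAt_of_contDiffOn_compl (by norm_num) hφ.contDiffOn_gradient_Phi hp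

theorem IsAnisotropy.apply_zero (hφ : IsAnisotropy φ) : φ 0 = 0 := by
  simpa using hφ.homogeneous 0 0

theorem IsAnisotropy.exists_le_norm (hφ : IsAnisotropy φ) : ∃ K, ∀ p, φ p ≤ K * ‖p‖ := by
  obtain ⟨K, hK⟩ := (isCompact_sphere (0 : E d) 1).exists_bound_of_continuousOn
    hφ.continuous.continuousOn
  refine ⟨K, fun p => ?_⟩
  by_cases hp : p = 0
  · simp [hp, hφ.apply_zero]
  · have h0 : 0 < ‖p‖ := norm_pos_iff.mpr hp
    have h1 := hK (‖p‖⁻¹ • p) (by simp [norm_smul, h0.ne'])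
    rw [hφ.homogeneous, abs_of_pos (inv_pos.mpr h0), Real.norm_eq_abs] at h1
    have h2 := (le_abs_self _).trans h1
    calc φ p = (‖p‖⁻¹ * φ p) * ‖p‖ := by field_simp
      _ ≤ K * ‖p‖ := by gcongr

/-- Only the origin needs an argument: there `Φ` is `O(|p|²)` by homogeneity, although `φ` itself
has a kink. -/
theorem IsAnisotropy.differentiable_Phi (hφ : IsAnisotropy φ) : Differentiable ℝ (Phi φ) := by
  intro p
  by_cases hp : p = 0
  · subst hp
    obtain ⟨K, hK⟩ := hφ.exists_le_norm
    have : Phi φ =O[nhds 0] fun p : E d => ‖p - 0‖ ^ 2 := by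
      refine Asymptotics.IsBigO.of_bound (K ^ 2 / 2) (Filter.Eventually.of_forall fun p => ?_)
      have h1 : φ p ^ 2 ≤ (K * ‖p‖) ^ 2 := by
        have := hK p
        have := hφ.nonneg p
        gcongr
      rw [sub_zero, norm_pow, norm_norm, Phi, Real.norm_of_nonneg (by positivity)]
      rw [mul_pow] at h1
      linarith
    exact (this.hasFDerivAt (by norm_num)).differentiableAt
  · exact differentiableAt_of_contDiffOn_compl (by norm_num) hφ.contDiffOn_Phi hp

theorem IsAnisotropy.Phi_smul (hφ : IsAnisotropy φ) (a : ℝ) (p : E d) :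
    Phi φ (a • p) = a ^ 2 * Phi φ p := by
  rw [Phi, Phi, hφ.homogeneous, mul_pow, sq_abs]; ring

theorem IsAnisotropy.gradient_Phi_smul (hφ : IsAnisotropy φ) (a : ℝ) (p : E d) :
    gradient (Phi φ) (a • p) = a • gradient (Phi φ) p := by
  have key : ∀ a : ℝ, a ≠ 0 → ∀ p, gradient (Phi φ) (a • p) = a • gradient (Phi φ) p := by
    intro a ha p
    have h1 : (fun p => Phi φ (a • p)) = fun p => a ^ 2 • Phi φ p := by
      ext p; rw [hφ.Phi_smul, smul_eq_mul]
    have h2 := congrArg (fun f => fderiv ℝ f p) h1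
    simp only [fderiv_comp_smul] at h2
    rw [fderiv_fun_const_smul (hφ.differentiable_Phi p), sq, mul_smul] at h2
    have h3 := smul_right_injective _ ha h2
    rw [gradient, gradient, h3]
    simp
  by_cases ha : a = 0
  · have h := key (-1) (by norm_num) 0
    rw [smul_zero, neg_one_smul] at h
    have h' : gradient (Phi φ) (0 : E d) = 0 := by
      have h2 : (2 : ℝ) • gradient (Phi φ) (0 : E d) = 0 := by
        rw [two_smul]; nth_rewrite 1 [h]; exact neg_add_cancel _
      exact (smul_eq_zero.mp h2).resolve_left (by norm_num)
    rw [ha, zero_smul, zero_smul, h']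
  · exact key a ha p

theorem IsAnisotropy.hess_Phi_smul (hφ : IsAnisotropy φ) {a : ℝ} (ha : a ≠ 0) {p : E d}
    (hp : p ≠ 0) : hess (Phi φ) (a • p) = hess (Phi φ) p := by
  have h1 : (fun p => gradient (Phi φ) (a • p)) = fun p => a • gradient (Phi φ) p := by
    ext1 p; exact hφ.gradient_Phi_smul a p
  have h2 := congrArg (fun f => fderiv ℝ f p) h1
  simp only [fderiv_comp_smul] at h2
  rw [fderiv_fun_const_smul (hφ.differentiableAt_gradient_Phi hp)] at h2
  exact smul_right_injective _ ha h2

/-- Euler's identity. -/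
theorem IsAnisotropy.inner_gradient_self (hφ : IsAnisotropy φ) {p : E d} (hp : p ≠ 0) :
    inner ℝ (gradient φ p) p = φ p := by
  have h1 : HasDerivAt (fun s : ℝ => φ (s • p)) (fderiv ℝ φ p p) 1 := by
    have h := (hφ.differentiableAt hp).hasFDerivAt
    have hs : HasDerivAt (fun s : ℝ => s • p) p 1 := by
      simpa using (hasDerivAt_id (1 : ℝ)).smul_const p
    rw [← one_smul ℝ p] at h
    simpa [Function.comp_def] using h.comp_hasDerivAt (1 : ℝ) hs
  have h2 : HasDerivAt (fun s : ℝ => φ (s • p)) (φ p) 1 := by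
    have : HasDerivAt (fun s : ℝ => s * φ p) (φ p) 1 := by
      simpa using (hasDerivAt_id (1 : ℝ)).mul_const (φ p)
    refine this.congr_of_eventuallyEq ?_
    filter_upwards [lt_mem_nhds (zero_lt_one' ℝ)] with s hs
    rw [hφ.homogeneous, abs_of_pos hs]
  rw [inner_gradient_left]
  exact h1.unique h2

theorem IsAnisotropy.gradient_smul (hφ : IsAnisotropy φ) {a : ℝ} (ha : 0 < a) {p : E d}
    (hp : p ≠ 0) : gradient φ (a • p) = gradient φ p := by
  have h1 : (fun p => φ (a • p)) = fun p => a • φ p := by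
    ext p; rw [hφ.homogeneous, abs_of_pos ha, smul_eq_mul]
  have h2 := congrArg (fun f => fderiv ℝ f p) h1
  simp only [fderiv_comp_smul] at h2
  rw [fderiv_fun_const_smul (hφ.differentiableAt hp)] at h2
  rw [gradient, gradient, smul_right_injective _ ha.ne' h2]

theorem IsAnisotropy.hess_self (hφ : IsAnisotropy φ) {p : E d} (hp : p ≠ 0) :
    hess φ p p = 0 := by
  have h1 : HasDerivAt (fun s : ℝ => gradient φ (s • p)) (hess φ p p) 1 := by
    have h := (hφ.differentiableAt_gradient hp).hasFDerivAt
    have hs : HasDerivAt (fun s : ℝ => s • p) p 1 := by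
      simpa using (hasDerivAt_id (1 : ℝ)).smul_const p
    rw [← one_smul ℝ p] at h
    simpa [hess, Function.comp_def] using h.comp_hasDerivAt (1 : ℝ) hs
  refine h1.unique ((hasDerivAt_const (1 : ℝ) (gradient φ p)).congr_of_eventuallyEq ?_)
  filter_upwards [lt_mem_nhds (zero_lt_one' ℝ)] with s hs
  exact hφ.gradient_smul hs hp

/-- Differentiating Euler's identity `φ'(p) · p = φ(p)` in direction `r` gives `φ''(p) r · p + φ'(p)
· r = φ'(p) · r`. -/
theorem IsAnisotropy.inner_hess_self (hφ : IsAnisotropy φ) {p : E d} (hp : p ≠ 0) (r : E d) :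
    inner ℝ (hess φ p r) p = 0 := by
  have h1 : HasFDerivAt (fun p => inner ℝ (gradient φ p) p) _ p :=
    (hφ.differentiableAt_gradient hp).hasFDerivAt.inner ℝ (hasFDerivAt_id p)
  have h2 : HasFDerivAt (fun p => inner ℝ (gradient φ p) p) (fderiv ℝ φ p) p := by
    refine (hφ.differentiableAt hp).hasFDerivAt.congr_of_eventuallyEq ?_
    filter_upwards [isOpen_compl_singleton.mem_nhds hp] with q hq
    exact hφ.inner_gradient_self hq
  have h3 := congrArg (fun l => l r) (h1.unique h2)
  simp [fderivInnerCLM_apply, inner_gradient_left] at h3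
  exact h3

theorem IsAnisotropy.gradient_Phi (hφ : IsAnisotropy φ) {p : E d} (hp : p ≠ 0) :
    gradient (Phi φ) p = φ p • gradient φ p := by
  have h : HasFDerivAt (Phi φ) (φ p • fderiv ℝ φ p) p := by
    have h1 := ((hφ.differentiableAt hp).hasFDerivAt.pow 2).mul_const (1 / 2 : ℝ)
    refine (h1.congr_of_eventuallyEq (Filter.Eventually.of_forall fun q => ?_)).congr_fderiv ?_
    · simp [Phi]; ring
    · ext q; simp; ring
  rw [gradient, gradient, h.fderiv]
  simp

theorem IsAnisotropy.hess_Phi_apply (hφ : IsAnisotropy φ) {p : E d} (hp : p ≠ 0) (q : E d) :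
    hess (Phi φ) p q = inner ℝ (gradient φ p) q • gradient φ p + φ p • hess φ p q := by
  have h1 : HasFDerivAt (fun p => φ p • gradient φ p) _ p :=
    (hφ.differentiableAt hp).hasFDerivAt.smul (hφ.differentiableAt_gradient hp).hasFDerivAt
  have h2 := h1.congr_of_eventuallyEq (f₁ := gradient (Phi φ)) (by
    filter_upwards [isOpen_compl_singleton.mem_nhds hp] with q hq
    exact hφ.gradient_Phi hq)
  rw [hess, h2.fderiv]
  simp [inner_gradient_left, hess, add_comm]

theorem IsAnisotropy.inner_hess_pos (hφ : IsAnisotropy φ) {p r : E d} (hp : ‖p‖ = 1) (hr : r ≠ 0)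
    (hpr : inner ℝ p r = 0) : 0 < inner ℝ (hess φ p r) r := by
  have h0 : 0 < ‖r‖ := norm_pos_iff.mpr hr
  have h := hφ.strictConvex p (‖r‖⁻¹ • r) hp (by simp [norm_smul, h0.ne'])
    (by rw [inner_smul_right, hpr, mul_zero])
  rw [map_smul, inner_smul_left, inner_smul_right] at h
  have hi : 0 < ‖r‖⁻¹ := inv_pos.mpr h0
  simp only [conj_trivial] at h
  exact pos_of_mul_pos_right (pos_of_mul_pos_right h hi.le) hi.le

/-- Here `Φ'' = φ' ⊗ φ' + φ φ''`. The second summand sees only the part `r` of `q` orthogonal to `p`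
and is positive unless `r = 0`; in that case `q` is a multiple of `p` and the first summand is
positive because `φ'(p) · p = φ(p) > 0`. -/
theorem IsAnisotropy.inner_hess_Phi_pos (hφ : IsAnisotropy φ) {p q : E d} (hp : ‖p‖ = 1)
    (hq : q ≠ 0) : 0 < inner ℝ (hess (Phi φ) p q) q := by
  have hp0 : p ≠ 0 := fun h => by simp [h] at hp
  have hφp := hφ.pos p hp0
  set a := inner ℝ p q with ha
  set r := q - a • p with hr
  have hpr : inner ℝ p r = 0 := by
    rw [hr, inner_sub_right, inner_smul_right, real_inner_self_eq_norm_sq, hp, ← ha]; ring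
  have hqe : q = a • p + r := by rw [hr]; abel
  have e1 : inner ℝ (hess φ p q) q = inner ℝ (hess φ p r) r := by
    conv_lhs => rw [hqe]
    rw [map_add, map_smul, hφ.hess_self hp0, smul_zero, zero_add, inner_add_right,
      inner_smul_right, hφ.inner_hess_self hp0, mul_zero, zero_add]
  rw [hφ.hess_Phi_apply hp0, inner_add_left, inner_smul_left, inner_smul_left, e1]
  simp only [conj_trivial]
  by_cases hr0 : r = 0
  · have hqa : q = a • p := by rw [hqe, hr0, add_zero]
    have ha0 : a ≠ 0 := fun h => hq (by rw [hqa, h, zero_smul])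
    have : inner ℝ (gradient φ p) q = a * φ p := by
      rw [hqa, inner_smul_right, hφ.inner_gradient_self hp0]
    rw [this, hr0, map_zero, inner_zero_left, mul_zero, add_zero]
    exact mul_self_pos.mpr (mul_ne_zero ha0 hφp.ne')
  · have := hφ.inner_hess_pos hp hr0 hpr
    have := mul_pos hφp this
    nlinarith [mul_self_nonneg (inner ℝ (gradient φ p) q)]

theorem IsAnisotropy.continuousOn_hess_Phi (hφ : IsAnisotropy φ) :
    ContinuousOn (hess (Phi φ)) {0}ᶜ :=
  hφ.contDiffOn_gradient_Phi.continuousOn_fderiv_of_isOpen isOpen_compl_singleton (by norm_num)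

/-- The Hessian of `Φ` is uniformly positive definite and bounded. -/
theorem IsAnisotropy.exists_hess_Phi_bounds (hφ : IsAnisotropy φ) : ∃ lam Lam : ℝ, 0 < lam ∧
    0 ≤ Lam ∧ ∀ p : E d, p ≠ 0 →
      (∀ q, lam * ‖q‖ ^ 2 ≤ inner ℝ (hess (Phi φ) p q) q) ∧ ‖hess (Phi φ) p‖ ≤ Lam := by
  have hS : Metric.sphere (0 : E d) 1 ⊆ {0}ᶜ := fun p hp h => by
    rw [mem_singleton_iff] at h
    simp [h] at hp
  have hc := hφ.continuousOn_hess_Phi.mono hS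
  obtain ⟨Lam, hLam⟩ := (isCompact_sphere (0 : E d) 1).exists_bound_of_continuousOn hc
  -- `Φ''` is homogeneous of degree zero in `p` and the form is quadratic in `q`, so a positive
  -- minimum over a product of unit spheres suffices.
  obtain ⟨lam, hl0, hl⟩ := ((isCompact_sphere (0 : E d) 1).prod
    (isCompact_sphere (0 : E d) 1)).exists_forall_le' (a := (0 : ℝ))
    (f := fun z : E d × E d => inner ℝ (hess (Phi φ) z.1 z.2) z.2)
    (by
      have h1 : ContinuousOn (fun z : E d × E d => hess (Phi φ) z.1)
          (Metric.sphere (0 : E d) 1 ×ˢ Metric.sphere (0 : E d) 1) :=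
        hc.comp continuousOn_fst fun z hz => hz.1
      exact (h1.clm_apply continuousOn_snd).inner continuousOn_snd)
    (fun z hz => hφ.inner_hess_Phi_pos (by simpa using hz.1)
      fun h => by have := hz.2; simp [h] at this)
  have hunit : ∀ p : E d, p ≠ 0 → ‖p‖⁻¹ • p ∈ Metric.sphere (0 : E d) 1 := fun p hp => by
    simp [norm_smul, hp]
  refine ⟨lam, max Lam 0, hl0, le_max_right _ _, fun p hp => ⟨fun q => ?_, ?_⟩⟩
  · by_cases hq : q = 0
    · simp [hq]
    · have h := hl (‖p‖⁻¹ • p, ‖q‖⁻¹ • q) ⟨hunit p hp, hunit q hq⟩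
      have hq0 : 0 < ‖q‖ := norm_pos_iff.mpr hq
      simp only [hφ.hess_Phi_smul (inv_ne_zero (norm_ne_zero_iff.mpr hp)) hp, map_smul,
        inner_smul_left, inner_smul_right, conj_trivial] at h
      calc lam * ‖q‖ ^ 2 ≤ (‖q‖⁻¹ * (‖q‖⁻¹ * inner ℝ (hess (Phi φ) p q) q)) * ‖q‖ ^ 2 := by
            gcongr
        _ = _ := by field_simp
  · have h := hLam _ (hunit p hp)
    rw [hφ.hess_Phi_smul (inv_ne_zero (norm_ne_zero_iff.mpr hp)) hp] at h
    exact h.trans (le_max_left _ _)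

/-- Singles out the segments on which the mean value argument for `Φ'` fails, since `Φ'` need not be
differentiable at the origin. Their end points are collinear, so homogeneity replaces that argument.
-/
theorem exists_smul_eq_of_zero_mem_segment {p q : E d} (h : (0 : E d) ∈ segment ℝ q p) :
    ∃ (v : E d) (a b : ℝ), p = a • v ∧ q = b • v := by
  obtain ⟨s, t, hs, ht, hst, h0⟩ := h
  by_cases ht0 : t = 0
  · have : s = 1 := by linarith
    rw [ht0, this] at h0
    exact ⟨p, 1, 0, by simp, by simpa using h0⟩
  · refine ⟨q, -(s / t), 1, ?_, by simp⟩
    have : t • p = -(s • q) := by rw [eq_neg_iff_add_eq_zero, add_comm]; exact h0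
    rw [← smul_right_inj ht0, this, smul_smul, ← neg_smul]
    congr 1
    field_simp

/-- Quantitative convexity of `Φ`. -/
structure ConvexBounds (φ : E d → ℝ) (lam Lam : ℝ) : Prop where
  pos : 0 < lam
  nonneg : 0 ≤ Lam
  differentiable : Differentiable ℝ (Phi φ)
  monotone : ∀ p q, lam * ‖p - q‖ ^ 2 ≤
    inner ℝ (gradient (Phi φ) p - gradient (Phi φ) q) (p - q)
  lipschitz : ∀ p q, ‖gradient (Phi φ) p - gradient (Phi φ) q‖ ≤ Lam * ‖p - q‖
  hess_lower : ∀ p, p ≠ 0 → ∀ q, lam * ‖q‖ ^ 2 ≤ inner ℝ (hess (Phi φ) p q) q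
  hess_upper : ∀ p, p ≠ 0 → ‖hess (Phi φ) p‖ ≤ Lam

/-- If the segment from `q` to `p` avoids the origin, the bounds on `Φ''` are integrated along it.
Otherwise `p = a v` and `q = b v`, and `Φ'(a v) - Φ'(b v) = (a - b) Φ'(v)` with `Φ'(v) = Φ''(v) v`,
so the same two constants serve on all of `ℝ^d`. -/
theorem IsAnisotropy.exists_convexBounds (hφ : IsAnisotropy φ) :
    ∃ lam Lam, ConvexBounds φ lam Lam := by
  obtain ⟨lam, Lam, hl, hL, hb⟩ := hφ.exists_hess_Phi_bounds
  have hunif : ∀ v : E d, lam * ‖v‖ ^ 2 ≤ inner ℝ (gradient (Phi φ) v) v := by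
    intro v
    by_cases hv : v = 0
    · simp [hv]
    · have h1 := (hb v hv).1 v
      have h2 : hess (Phi φ) v v = gradient (Phi φ) v := by
        rw [hφ.hess_Phi_apply hv, hφ.inner_gradient_self hv, hφ.hess_self hv, smul_zero, add_zero,
          hφ.gradient_Phi hv]
      rwa [h2] at h1
  have hgrad : ∀ v : E d, ‖gradient (Phi φ) v‖ ≤ Lam * ‖v‖ := by
    intro v
    by_cases hv : v = 0
    · have := hφ.gradient_Phi_smul 0 v
      rw [zero_smul, zero_smul] at this
      simp [hv, this]
    · have h2 : hess (Phi φ) v v = gradient (Phi φ) v := by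
        rw [hφ.hess_Phi_apply hv, hφ.inner_gradient_self hv, hφ.hess_self hv, smul_zero, add_zero,
          hφ.gradient_Phi hv]
      rw [← h2]
      exact (ContinuousLinearMap.le_opNorm _ _).trans (by gcongr; exact (hb v hv).2)
  refine ⟨lam, Lam, hl, hL, hφ.differentiable_Phi, fun p q => ?_, fun p q => ?_,
    fun p hp => (hb p hp).1, fun p hp => (hb p hp).2⟩
  · by_cases h0 : (0 : E d) ∈ segment ℝ q p
    · obtain ⟨v, a, b, rfl, rfl⟩ := exists_smul_eq_of_zero_mem_segment h0
      rw [hφ.gradient_Phi_smul, hφ.gradient_Phi_smul, ← sub_smul, ← sub_smul, norm_smul,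
        inner_smul_left, inner_smul_right, mul_pow, Real.norm_eq_abs, sq_abs]
      have := hunif v
      simp only [conj_trivial]
      nlinarith [sq_nonneg (a - b), mul_le_mul_of_nonneg_left this (sq_nonneg (a - b))]
    · have hne : ∀ s ∈ Icc (0 : ℝ) 1, q + s • (p - q) ≠ 0 := by
        intro s hs h
        apply h0
        rw [segment_eq_image']
        exact ⟨s, hs, h⟩
      have hd : ∀ s ∈ Icc (0 : ℝ) 1,
          HasDerivAt (fun s : ℝ => inner ℝ (gradient (Phi φ) (q + s • (p - q))) (p - q))
            (inner ℝ (hess (Phi φ) (q + s • (p - q)) (p - q)) (p - q)) s := by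
        intro s hs
        have h1 := (hφ.differentiableAt_gradient_Phi (hne s hs)).hasFDerivAt
        have h2 : HasDerivAt (fun s : ℝ => q + s • (p - q)) (p - q) s := by
          simpa using ((hasDerivAt_id s).smul_const (p - q)).const_add q
        have h3 := (h1.comp_hasDerivAt s h2).inner ℝ (hasDerivAt_const s (p - q))
        simpa [hess] using h3
      obtain ⟨s, hs, he⟩ := exists_hasDerivAt_eq_slope _ _ (zero_lt_one' ℝ)
        (fun s hs => (hd s hs).continuousAt.continuousWithinAt)
        (fun s hs => hd s (Ioo_subset_Icc_self hs))
      have h4 := (hb _ (hne s (Ioo_subset_Icc_self hs))).1 (p - q)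
      rw [he] at h4
      simpa [inner_sub_left] using h4
  · by_cases h0 : (0 : E d) ∈ segment ℝ q p
    · obtain ⟨v, a, b, rfl, rfl⟩ := exists_smul_eq_of_zero_mem_segment h0
      rw [hφ.gradient_Phi_smul, hφ.gradient_Phi_smul, ← sub_smul, ← sub_smul, norm_smul,
        norm_smul]
      calc _ ≤ ‖a - b‖ * (Lam * ‖v‖) := by gcongr; exact hgrad v
        _ = _ := by ring
    · have hne : ∀ v ∈ segment ℝ q p, v ≠ 0 := fun v hv h => h0 (h ▸ hv)
      exact (convex_segment q p).norm_image_sub_le_of_norm_hasFDerivWithin_le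
        (fun v hv => (hφ.differentiableAt_gradient_Phi (hne v hv)).hasFDerivAt.hasFDerivWithinAt)
        (fun v hv => (hb v (hne v hv)).2) (left_mem_segment ℝ q p) (right_mem_segment ℝ q p)

/-- Along the segment, `Φ` minus its tangent and minus the quadratic has nonnegative derivative by
strong monotonicity. This uses only first derivatives, so the origin needs no separate treatment. -/
theorem ConvexBounds.lower {lam Lam : ℝ} (h : ConvexBounds φ lam Lam) (a b : E d) :
    Phi φ a + inner ℝ (gradient (Phi φ) a) (b - a) + lam / 2 * ‖b - a‖ ^ 2 ≤ Phi φ b := by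
  have hd : ∀ s : ℝ, HasDerivAt (fun s : ℝ => Phi φ (a + s • (b - a))
      - s * inner ℝ (gradient (Phi φ) a) (b - a) - lam / 2 * ‖b - a‖ ^ 2 * s ^ 2)
      (inner ℝ (gradient (Phi φ) (a + s • (b - a))) (b - a)
        - inner ℝ (gradient (Phi φ) a) (b - a) - lam * ‖b - a‖ ^ 2 * s) s := by
    intro s
    have h1 := (h.differentiable (a + s • (b - a))).hasFDerivAt
    have h2 : HasDerivAt (fun s : ℝ => a + s • (b - a)) (b - a) s := by
      simpa using ((hasDerivAt_id s).smul_const (b - a)).const_add a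
    have h3 := h1.comp_hasDerivAt s h2
    rw [← inner_gradient_left] at h3
    have h4 := (hasDerivAt_id s).mul_const (inner ℝ (gradient (Phi φ) a) (b - a))
    have h5 := (hasDerivAt_pow 2 s).const_mul (lam / 2 * ‖b - a‖ ^ 2)
    refine ((h3.sub h4).sub h5).congr_deriv ?_
    simp
    ring
  have hm : MonotoneOn (fun s : ℝ => Phi φ (a + s • (b - a))
      - s * inner ℝ (gradient (Phi φ) a) (b - a) - lam / 2 * ‖b - a‖ ^ 2 * s ^ 2) (Icc 0 1) := by
    refine monotoneOn_of_deriv_nonneg (convex_Icc 0 1)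
      (fun s _ => (hd s).continuousAt.continuousWithinAt)
      (fun s _ => (hd s).differentiableAt.differentiableWithinAt) fun s hs => ?_
    rw [interior_Icc] at hs
    rw [(hd s).deriv]
    have h1 := h.monotone (a + s • (b - a)) a
    rw [add_sub_cancel_left, inner_smul_right, norm_smul, Real.norm_of_nonneg hs.1.le,
      inner_sub_left] at h1
    have h2 : s * (lam * ‖b - a‖ ^ 2 * s) ≤ s * (inner ℝ (gradient (Phi φ) (a + s • (b - a))) (b - a)
        - inner ℝ (gradient (Phi φ) a) (b - a)) := by
      calc _ = lam * (s * ‖b - a‖) ^ 2 := by ring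
        _ ≤ _ := h1
    have := le_of_mul_le_mul_left h2 hs.1
    linarith
  have := hm (left_mem_Icc.mpr zero_le_one) (right_mem_Icc.mpr zero_le_one) zero_le_one
  simp only [zero_smul, add_zero, one_smul, add_sub_cancel, zero_mul, one_mul, one_pow, mul_one,
    sub_zero, ne_eq, OfNat.ofNat_ne_zero, not_false_eq_true, zero_pow, mul_zero] at this
  linarith

theorem ConvexBounds.upper {lam Lam : ℝ} (h : ConvexBounds φ lam Lam) (a b : E d) :
    Phi φ b ≤ Phi φ a + inner ℝ (gradient (Phi φ) a) (b - a) + Lam * ‖b - a‖ ^ 2 := by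
  have hK : ∀ p q, ‖fderiv ℝ (Phi φ) p - fderiv ℝ (Phi φ) q‖ ≤ Lam * ‖p - q‖ := fun p q => by
    rw [← toDual_gradient, ← toDual_gradient, ← map_sub, LinearIsometryEquiv.norm_map]
    exact h.lipschitz p q
  have := norm_taylorRem_le h.differentiable hK h.nonneg a (b - a)
  rw [taylorRem, add_sub_cancel, ← inner_gradient_left] at this
  have := (le_abs_self _).trans this
  linarith

/-! ### The mobility matrix -/

theorem IsAnisotropy.contDiffOn_wvec (hφ : IsAnisotropy φ) :
    ContDiffOn ℝ (3 : ℕ) (wvec φ) {0}ᶜ := by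
  have hn : ContDiffOn ℝ (3 : ℕ) (fun p : E d => ‖p‖) {0}ᶜ :=
    contDiffOn_id.norm ℝ fun p hp => hp
  have hp : ContDiffOn ℝ (3 : ℕ) φ {0}ᶜ := hφ.contDiffOn.of_le (by norm_num)
  exact ((hn.div hp fun p h => (hφ.pos p h).ne').smul hφ.contDiffOn_gradient).sub
    ((hn.inv fun p h => norm_ne_zero_iff.mpr h).smul contDiffOn_id)

theorem contDiffOn_tens {n : ℕ} {f g : E d → E d} {s : Set (E d)} (hf : ContDiffOn ℝ n f s)
    (hg : ContDiffOn ℝ n g s) : ContDiffOn ℝ n (fun p => tens (f p) (g p)) s :=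
  ((innerSL ℝ).contDiff.comp_contDiffOn hg).smulRight hf

theorem contDiffOn_Hmat (hφ : IsAnisotropy φ) (hmob : IsMobility mob) :
    ContDiffOn ℝ (3 : ℕ) (Hmat φ mob) {0}ᶜ := by
  have hn : ContDiffOn ℝ (3 : ℕ) (fun p : E d => ‖p‖) {0}ᶜ :=
    contDiffOn_id.norm ℝ fun p hp => hp
  have ht : ContDiffOn ℝ (3 : ℕ) (fun p : E d => ‖p‖⁻¹ • p) {0}ᶜ :=
    (hn.inv fun p h => norm_ne_zero_iff.mpr h).smul contDiffOn_id
  have hp : ContDiffOn ℝ (3 : ℕ) φ {0}ᶜ := hφ.contDiffOn.of_le (by norm_num)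
  have hm : ContDiffOn ℝ (3 : ℕ) mob {0}ᶜ := by exact_mod_cast hmob.contDiffOn
  have hw := hφ.contDiffOn_wvec
  have hw2 : ContDiffOn ℝ (3 : ℕ) (fun p => ‖wvec φ p‖ ^ 2) {0}ᶜ := hw.norm_sq ℝ
  exact ((hm.mul hn).mul hp).smul (contDiffOn_const.add
    (((contDiffOn_const.add hw2).inv fun p _ => by positivity).smul
      ((contDiffOn_tens hw (ht.sub hw)).sub
        (contDiffOn_tens ht (hw.add (hw2.smul ht))))))

theorem inner_wvec_self (hφ : IsAnisotropy φ) {p : E d} (hp : p ≠ 0) :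
    inner ℝ (wvec φ p) p = 0 := by
  have h0 : ‖p‖ ≠ 0 := norm_ne_zero_iff.mpr hp
  rw [wvec, inner_sub_left, inner_smul_left, inner_smul_left, hφ.inner_gradient_self hp,
    real_inner_self_eq_norm_sq]
  have := (hφ.pos p hp).ne'
  simp only [conj_trivial]
  field_simp
  ring

/-- The skew part of the bracket contributes nothing to the quadratic form. With `a = t · z` and `b
= w · z` there remains `|z|² - (b² + |w|² a²) / (1 + |w|²)`. Since `w` is orthogonal to `t`,
Cauchy-Schwarz for `z - a t` gives `b² ≤ |w|² (|z|² - a²)`. -/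
theorem le_inner_Hmat (hφ : IsAnisotropy φ) (hmob : IsMobility mob) {p : E d} (hp : p ≠ 0)
    (z : E d) : mob p * ‖p‖ * φ p / (1 + ‖wvec φ p‖ ^ 2) * ‖z‖ ^ 2 ≤
      inner ℝ (Hmat φ mob p z) z := by
  have h0 : 0 < ‖p‖ := norm_pos_iff.mpr hp
  have hα : 0 < mob p * ‖p‖ * φ p := mul_pos (mul_pos (hmob.pos p hp) h0) (hφ.pos p hp)
  set w := wvec φ p with hw
  set t := ‖p‖⁻¹ • p with ht
  have ht1 : ‖t‖ = 1 := by simp [ht, norm_smul, h0.ne']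
  have hwt : inner ℝ w t = 0 := by rw [ht, inner_smul_right, hw, inner_wvec_self hφ hp, mul_zero]
  set a := inner ℝ t z with ha
  set b := inner ℝ w z with hb
  have hbound : b ^ 2 ≤ ‖w‖ ^ 2 * (‖z‖ ^ 2 - a ^ 2) := by
    have e1 : inner ℝ w (z - a • t) = b := by
      rw [inner_sub_right, inner_smul_right, hwt, mul_zero, sub_zero]
    have e2 : ‖z - a • t‖ ^ 2 = ‖z‖ ^ 2 - a ^ 2 := by
      rw [norm_sub_sq_real, inner_smul_right, real_inner_comm, ← ha, norm_smul, ht1, mul_one,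
        Real.norm_eq_abs, sq_abs]
      ring
    have := abs_real_inner_le_norm w (z - a • t)
    rw [e1] at this
    rw [← e2, ← mul_pow]
    exact sq_le_sq' (by linarith [neg_abs_le b]) ((le_abs_self b).trans this)
  have e : inner ℝ (Hmat φ mob p z) z = mob p * ‖p‖ * φ p *
      (‖z‖ ^ 2 + (1 + ‖w‖ ^ 2)⁻¹ * ((a - b) * b - (b + ‖w‖ ^ 2 * a) * a)) := by
    simp only [Hmat, ← hw, ← ht, tens, smul_apply,
      add_apply, sub_apply, ContinuousLinearMap.id_apply,
      ContinuousLinearMap.smulRight_apply, innerSL_apply_apply, inner_add_left, inner_sub_left,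
      inner_smul_left, conj_trivial, real_inner_self_eq_norm_sq, ← ha, ← hb]
  rw [e, div_mul_eq_mul_div, mul_div_assoc]
  gcongr
  rw [div_le_iff₀ (by positivity)]
  have : (‖z‖ ^ 2 + (1 + ‖w‖ ^ 2)⁻¹ * ((a - b) * b - (b + ‖w‖ ^ 2 * a) * a)) * (1 + ‖w‖ ^ 2)
      = ‖z‖ ^ 2 * (1 + ‖w‖ ^ 2) + ((a - b) * b - (b + ‖w‖ ^ 2 * a) * a) := by
    field_simp
  rw [this]
  linarith

theorem exists_coercive_Hmat (hφ : IsAnisotropy φ) (hmob : IsMobility mob) {a b : ℝ} (ha : 0 < a) :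
    ∃ kap > 0, ∀ p : E d, a ≤ ‖p‖ → ‖p‖ ≤ b → ∀ z,
      kap * ‖z‖ ^ 2 ≤ inner ℝ (Hmat φ mob p z) z := by
  have hK : IsCompact {p : E d | a ≤ ‖p‖ ∧ ‖p‖ ≤ b} := by
    refine (isCompact_closedBall (0 : E d) b).of_isClosed_subset ?_ fun p hp => by simpa using hp.2
    exact (isClosed_le continuous_const continuous_norm).inter
      (isClosed_le continuous_norm continuous_const)
  have hsub : {p : E d | a ≤ ‖p‖ ∧ ‖p‖ ≤ b} ⊆ {0}ᶜ := fun p hp h => by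
    rw [mem_singleton_iff] at h
    have := hp.1
    simp [h] at this
    linarith
  obtain ⟨kap, hk0, hk⟩ := hK.exists_forall_le' (a := (0 : ℝ))
    (f := fun p => mob p * ‖p‖ * φ p / (1 + ‖wvec φ p‖ ^ 2))
    (((((hmob.contDiffOn.continuousOn.mono hsub).mul continuous_norm.continuousOn).mul
      hφ.continuous.continuousOn).div
      (continuousOn_const.add ((hφ.contDiffOn_wvec.continuousOn.mono hsub).norm.pow 2))
      fun p _ => (by positivity : 1 + ‖wvec φ p‖ ^ 2 ≠ 0)))
    (fun p hp => by
      have h0 : p ≠ 0 := hsub hp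
      have := hmob.pos p h0
      have := hφ.pos p h0
      have := norm_pos_iff.mpr h0
      positivity)
  refine ⟨kap, hk0, fun p h1 h2 z => ?_⟩
  refine le_trans ?_ (le_inner_Hmat hφ hmob (hsub ⟨h1, h2⟩) z)
  have := hk p ⟨h1, h2⟩
  gcongr

end Anisotropy

/-! ### Weak derivatives in one variable -/

section WeakDeriv

variable {B : Type*} [NormedAddCommGroup B] [NormedSpace ℝ B] [CompleteSpace B] {a b : ℝ}

/-- Fubini on the triangle `s ≤ t`; the primitive of a merely integrable `v` never has to be
differentiated. -/
theorem integral_deriv_smul_primitive (hab : a ≤ b) {v : ℝ → B}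
    (hv : IntegrableOn v (Ioc a b)) {ψ : ℝ → ℝ} (hψ : ContDiff ℝ 1 ψ) (hψb : ψ b = 0) :
    ∫ t in a..b, deriv ψ t • (∫ s in a..t, v s) = -∫ s in a..b, ψ s • v s := by
  set μ : Measure ℝ := volume.restrict (Ioc a b) with hμ
  have hψ' : Continuous (deriv ψ) := hψ.continuous_deriv (by norm_num)
  set F : ℝ → ℝ → B := fun t s => {z : ℝ × ℝ | z.2 ≤ z.1}.indicator
    (fun z => deriv ψ z.1 • v z.2) (t, s) with hF
  have hint : Integrable (Function.uncurry F) (μ.prod μ) := by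
    have h1 : Integrable (fun z : ℝ × ℝ => deriv ψ z.1 • v z.2) (μ.prod μ) :=
      Integrable.smul_prod (hψ'.integrableOn_Ioc) hv
    exact h1.indicator (measurableSet_le measurable_snd measurable_fst)
  have hswap := integral_integral_swap hint
  have hL : ∀ t ∈ Ioc a b, ∫ s, F t s ∂μ = deriv ψ t • (∫ s in a..t, v s) := by
    intro t ht
    have e : ∀ s, F t s = (Iic t).indicator (fun s => deriv ψ t • v s) s := fun s => by
      simp [hF, indicator]
    simp_rw [e]
    rw [integral_indicator measurableSet_Iic, hμ, Measure.restrict_restrict measurableSet_Iic,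
      integral_smul, intervalIntegral.integral_of_le ht.1.le]
    congr 3
    ext s
    simp only [mem_inter_iff, mem_Iic, mem_Ioc]
    exact ⟨fun h => ⟨h.2.1, h.1⟩, fun h => ⟨h.2, h.1, h.2.trans ht.2⟩⟩
  have hR : ∀ s ∈ Ioc a b, ∫ t, F t s ∂μ = -(ψ s • v s) := by
    intro s hs
    have e : ∀ t, F t s = (Ici s).indicator (fun t => deriv ψ t • v s) t := fun t => by
      simp [hF, indicator]
    simp_rw [e]
    have e2 : Ici s ∩ Ioc a b = Icc s b := by
      ext t
      simp only [mem_inter_iff, mem_Ici, mem_Ioc, mem_Icc]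
      exact ⟨fun h => ⟨h.1, h.2.2⟩, fun h => ⟨h.1, hs.1.trans_le h.1, h.2⟩⟩
    rw [integral_indicator measurableSet_Ici, hμ, Measure.restrict_restrict measurableSet_Ici, e2,
      integral_Icc_eq_integral_Ioc, integral_smul_const, ← intervalIntegral.integral_of_le hs.2,
      intervalIntegral.integral_deriv_eq_sub
        (fun t _ => (hψ.differentiable (by norm_num)) t) (hψ'.intervalIntegrable _ _), hψb,
      zero_sub, neg_smul]
  rw [intervalIntegral.integral_of_le hab, intervalIntegral.integral_of_le hab,
    ← integral_neg, ← setIntegral_congr_fun measurableSet_Ioc hL,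
    ← setIntegral_congr_fun measurableSet_Ioc hR]
  exact hswap

/-- The lemma of du Bois-Reymond. -/
theorem exists_ae_eq_const_of_weakDeriv_zero (hab : a < b) {f : ℝ → B}
    (hf : IntegrableOn f (Ioc a b))
    (h : ∀ ψ : ℝ → ℝ, ContDiff ℝ ∞ ψ → tsupport ψ ⊆ Ioo a b → ∫ t in a..b, deriv ψ t • f t = 0) :
    ∃ c, ∀ᵐ t ∂volume.restrict (Ioo a b), f t = c := by
  have hint : ∀ g : ℝ → ℝ, Continuous g → IntegrableOn (fun t => g t • f t) (Ioc a b) := by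
    intro g hg
    obtain ⟨K, hK⟩ := isCompact_Icc.exists_bound_of_continuousOn (hg.continuousOn (s := Icc a b))
    exact hf.bdd_smul K hg.aestronglyMeasurable
      ((ae_restrict_mem measurableSet_Ioc).mono fun t ht => hK t (Ioc_subset_Icc_self ht))
  obtain ⟨χ, hχs, hχ, hχc, hχi⟩ : ∃ χ : ℝ → ℝ, tsupport χ ⊆ Ioo a b ∧ ContDiff ℝ ∞ χ ∧
      HasCompactSupport χ ∧ ∫ t in a..b, χ t = 1 := by
    let β : ContDiffBump ((a + b) / 2) := ⟨(b - a) / 8, (b - a) / 4, by linarith, by linarith⟩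
    have hs : tsupport (β.normed volume) ⊆ Ioo a b := by
      rw [β.tsupport_normed_eq, Real.closedBall_eq_Icc]
      intro t ht
      have h4 : β.rOut = (b - a) / 4 := rfl
      rw [h4] at ht
      exact ⟨by linarith [ht.1], by linarith [ht.2]⟩
    refine ⟨β.normed volume, hs, β.contDiff_normed, β.hasCompactSupport_normed, ?_⟩
    rw [intervalIntegral.integral_of_le hab.le, setIntegral_eq_integral_of_forall_compl_eq_zero,
      β.integral_normed]
    intro t ht
    by_contra h0
    exact ht (Ioo_subset_Ioc_self (hs (subset_tsupport _ h0)))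
  set c := ∫ t in a..b, χ t • f t with hc
  refine ⟨c, ?_⟩
  have hfl : LocallyIntegrableOn (fun t => f t - c) (Ioo a b) :=
    ((hf.mono_set Ioo_subset_Ioc_self).sub
      (integrableOn_const (by simp))).locallyIntegrableOn
  have key := isOpen_Ioo.ae_eq_zero_of_integral_contDiff_smul_eq_zero (U := Ioo a b) hfl ?_
  · rw [ae_restrict_iff' measurableSet_Ioo]
    filter_upwards [key] with t ht hmem
    exact sub_eq_zero.mp (ht hmem)
  · intro g hg hgc hgs
    -- Subtracting `I • χ` from `g` makes the mean vanish, so the primitive `ψ` of the difference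
    -- `k` has compact support in `(a, b)` and is an admissible test function.
    set I := ∫ t in a..b, g t with hI
    set k : ℝ → ℝ := fun t => g t - I * χ t with hk
    have hks : ContDiff ℝ ∞ k := hg.sub (contDiff_const.mul hχ)
    set ψ : ℝ → ℝ := fun t => ∫ s in a..t, k s with hψ
    have hψd : ∀ t, HasDerivAt ψ (k t) t := fun t =>
      hks.continuous.integral_hasStrictDerivAt a t |>.hasDerivAt
    have hψ' : deriv ψ = k := funext fun t => (hψd t).deriv
    have hψs : ContDiff ℝ ∞ ψ := by
      rw [contDiff_infty_iff_deriv]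
      exact ⟨fun t => (hψd t).differentiableAt, hψ' ▸ hks⟩
    have hkI : ∫ t in a..b, k t = 0 := by
      have e := intervalIntegral.integral_sub (hg.continuous.intervalIntegrable a b)
        ((hχ.continuous.intervalIntegrable a b).const_mul I) (μ := volume)
      rw [intervalIntegral.integral_const_mul, hχi, ← hI, mul_one, sub_self] at e
      exact e
    have hsupp : tsupport ψ ⊆ Ioo a b := by
      set S := tsupport g ∪ tsupport χ with hS
      have hSc : IsCompact S := IsCompact.union hgc hχc
      have hSs : S ⊆ Ioo a b := union_subset hgs hχs
      have hk0 : ∀ t, t ∉ S → k t = 0 := fun t ht => by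
        have h1 : g t = 0 := image_eq_zero_of_notMem_tsupport fun h => ht (Or.inl h)
        have h2 : χ t = 0 := image_eq_zero_of_notMem_tsupport fun h => ht (Or.inr h)
        simp [hk, h1, h2]
      have hSne : S.Nonempty := by
        by_contra hne
        rw [not_nonempty_iff_eq_empty] at hne
        have : ∀ t, χ t = 0 := fun t =>
          image_eq_zero_of_notMem_tsupport fun h => by
            have : t ∈ S := Or.inr h
            simp [hne] at this
        simp [this] at hχi
      obtain ⟨a', ha'S, ha'⟩ := hSc.exists_isLeast hSne
      obtain ⟨b', hb'S, hb'⟩ := hSc.exists_isGreatest hSne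
      refine (closure_minimal ?_ isClosed_Icc).trans
        (Icc_subset_Ioo (hSs ha'S).1 (hSs hb'S).2)
      intro t ht
      by_contra hnot
      apply ht
      rw [mem_Icc, not_and_or, not_le, not_le] at hnot
      have hzero : ∀ x y : ℝ, (∀ s ∈ uIcc x y, k s = 0) → ∫ s in x..y, k s = 0 := fun x y hxy => by
        rw [intervalIntegral.integral_congr (g := fun _ => (0 : ℝ)) hxy]
        simp
      rcases hnot with hlt | hgt
      · refine hzero a t fun s hs => hk0 s fun hsS => ?_
        have h1 := ha' hsS
        have h2 := hs.2
        have h3 := (hSs ha'S).1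
        rcases le_total a t with hle | hle
        · rw [sup_eq_right.mpr hle] at h2; linarith
        · rw [sup_eq_left.mpr hle] at h2; linarith
      · have e : ψ t = (∫ s in a..b, k s) - ∫ s in t..b, k s := by
          rw [eq_sub_iff_add_eq]
          exact intervalIntegral.integral_add_adjacent_intervals
            (hks.continuous.intervalIntegrable _ _) (hks.continuous.intervalIntegrable _ _)
        rw [e, hkI, zero_sub, neg_eq_zero]
        refine hzero t b fun s hs => hk0 s fun hsS => ?_
        have h1 := hb' hsS
        have h2 := hs.1
        have h3 := (hSs hb'S).2
        rcases le_total b t with hle | hle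
        · rw [inf_eq_right.mpr hle] at h2; linarith
        · rw [inf_eq_left.mpr hle] at h2; linarith
    have h0 := h ψ hψs hsupp
    have hgint := hint g hg.continuous
    have hχint := hint χ hχ.continuous
    rw [hψ', intervalIntegral.integral_of_le hab.le] at h0
    simp only [hk, sub_smul, mul_smul] at h0
    have hsub := integral_sub hgint (hχint.smul I)
    simp only [Pi.smul_apply] at hsub
    rw [hsub, integral_smul,
      ← intervalIntegral.integral_of_le hab.le, ← intervalIntegral.integral_of_le hab.le, ← hc,
      hI, ← intervalIntegral.integral_smul_const] at h0
    have hzero : ∀ t ∉ Ioc a b, g t • (f t - c) = 0 := fun t ht => by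
      rw [image_eq_zero_of_notMem_tsupport fun h => ht (Ioo_subset_Ioc_self (hgs h)), zero_smul]
    rw [← setIntegral_eq_integral_of_forall_compl_eq_zero hzero]
    simp only [smul_sub]
    have hcont : Continuous fun t => g t • c := hg.continuous.smul continuous_const
    rw [integral_sub hgint hcont.integrableOn_Ioc, ← intervalIntegral.integral_of_le hab.le, ← intervalIntegral.integral_of_le hab.le]
    exact h0

/-- The difference of `f` and the primitive of `v` has weak derivative zero, so it is constant by du
Bois-Reymond. -/
theorem exists_ae_eq_const_add_primitive (hab : a < b) {f v : ℝ → B}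
    (hf : IntegrableOn f (Ioc a b)) (hv : IntegrableOn v (Ioc a b))
    (h : ∀ ψ : ℝ → ℝ, ContDiff ℝ ∞ ψ → tsupport ψ ⊆ Ioo a b →
      ∫ t in a..b, deriv ψ t • f t = -∫ t in a..b, ψ t • v t) :
    ∃ c, ∀ᵐ t ∂volume.restrict (Ioo a b), f t = c + ∫ s in a..t, v s := by
  have hv' : IntervalIntegrable v volume a b := (intervalIntegrable_iff_integrableOn_Ioc_of_le
    hab.le).mpr hv
  have hW : ContinuousOn (fun t => ∫ s in a..t, v s) (Icc a b) := by
    have := intervalIntegral.continuousOn_primitive_interval (a := a) (b := b) (f := v)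
      (μ := volume) (by rw [uIcc_of_le hab.le]; exact (integrableOn_Icc_iff_integrableOn_Ioc).mpr hv)
    rwa [uIcc_of_le hab.le] at this
  have hWi : IntegrableOn (fun t => ∫ s in a..t, v s) (Ioc a b) :=
    (hW.integrableOn_compact isCompact_Icc).mono_set Ioc_subset_Icc_self
  obtain ⟨c, hc⟩ := exists_ae_eq_const_of_weakDeriv_zero hab (hf.sub hWi) (by
    intro ψ hψ hs
    have hψb : ψ b = 0 := image_eq_zero_of_notMem_tsupport fun h => by
      have := (hs h).2
      exact lt_irrefl _ this
    have hψ' : Continuous (deriv ψ) := hψ.continuous_deriv (by simp)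
    have hint : ∀ k : ℝ → B, IntegrableOn k (Ioc a b) →
        IntegrableOn (fun t => deriv ψ t • k t) (Ioc a b) := by
      intro k hk
      obtain ⟨K, hK⟩ := isCompact_Icc.exists_bound_of_continuousOn
        (hψ'.continuousOn (s := Icc a b))
      exact hk.bdd_smul K hψ'.aestronglyMeasurable
        ((ae_restrict_mem measurableSet_Ioc).mono fun t ht => hK t (Ioc_subset_Icc_self ht))
    have h1 := integral_deriv_smul_primitive hab.le hv (hψ.of_le (by simp)) hψb
    have h2 := h ψ hψ hs
    rw [← h1] at h2
    simp only [Pi.sub_apply, smul_sub]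
    rw [intervalIntegral.integral_of_le hab.le] at h2 ⊢
    rw [intervalIntegral.integral_of_le hab.le] at h2
    rw [integral_sub (hint f hf) (hint _ hWi), h2, sub_self])
  refine ⟨c, ?_⟩
  filter_upwards [hc] with t ht
  rw [Pi.sub_apply] at ht
  exact sub_eq_iff_eq_add.mp ht

end WeakDeriv

/-- Links the two kinds of test functions: `IsWeakDeriv` tests with periodic functions, du
Bois-Reymond with functions supported inside `(0, 1)`. At the integers smoothness holds because `ψ`
vanishes near both end points. -/
theorem exists_periodic_extension {ψ : ℝ → ℝ} (hψ : ContDiff ℝ ∞ ψ) (hs : tsupport ψ ⊆ Ioo 0 1) :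
    ContDiff ℝ ∞ (fun ρ => ψ (Int.fract ρ)) := by
  have h0 : ∀ᶠ ρ in nhds (0 : ℝ), ψ ρ = 0 :=
    notMem_tsupport_iff_eventuallyEq.mp fun h => lt_irrefl _ (hs h).1
  have h1 : ∀ᶠ ρ in nhds (1 : ℝ), ψ ρ = 0 :=
    notMem_tsupport_iff_eventuallyEq.mp fun h => lt_irrefl _ (hs h).2
  rw [contDiff_iff_contDiffAt]
  intro ρ
  by_cases hρ : Int.fract ρ = 0
  · have : (fun ρ => ψ (Int.fract ρ)) =ᶠ[nhds ρ] fun _ => 0 := by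
      have hc : Filter.Tendsto (fun σ => σ - (⌊ρ⌋ : ℝ)) (nhds ρ) (nhds 0) := by
        have : Filter.Tendsto (fun σ => σ - (⌊ρ⌋ : ℝ)) (nhds ρ) (nhds (ρ - ⌊ρ⌋)) :=
          (continuous_id.sub continuous_const).tendsto ρ
        rwa [show ρ - (⌊ρ⌋ : ℝ) = 0 from hρ] at this
      have hc1 : Filter.Tendsto (fun σ => σ - (⌊ρ⌋ : ℝ) + 1) (nhds ρ) (nhds 1) := by
        simpa using hc.add_const 1
      filter_upwards [hc.eventually h0, hc1.eventually h1,
        hc.eventually (Ioo_mem_nhds (show (-1 : ℝ) < 0 by norm_num) one_pos)] with σ e0 e1 hσ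
      rcases lt_or_ge (σ - ⌊ρ⌋) 0 with hneg | hpos
      · have : Int.fract σ = σ - ⌊ρ⌋ + 1 := by
          rw [Int.fract_eq_iff]
          exact ⟨by linarith [hσ.1], by linarith, ⌊ρ⌋ - 1, by push_cast; ring⟩
        rw [this, e1]
      · have : Int.fract σ = σ - ⌊ρ⌋ := by
          rw [Int.fract_eq_iff]
          exact ⟨hpos, hσ.2, ⌊ρ⌋, by ring⟩
        rw [this, e0]
    exact contDiffAt_const.congr_of_eventuallyEq this
  · have : (fun ρ => ψ (Int.fract ρ)) =ᶠ[nhds ρ] fun σ => ψ (σ - ⌊ρ⌋) := by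
      have hlt : (⌊ρ⌋ : ℝ) < ρ :=
        lt_of_le_of_ne (Int.floor_le ρ) fun h => hρ (by rw [Int.fract, h, sub_self])
      filter_upwards [Ioo_mem_nhds hlt (Int.lt_floor_add_one ρ)] with σ hσ
      have : Int.fract σ = σ - ⌊ρ⌋ := by
        rw [Int.fract_eq_iff]
        exact ⟨by linarith [hσ.1], by linarith [hσ.2], ⌊ρ⌋, by ring⟩
      rw [this]
    exact (hψ.comp (contDiff_id.sub contDiff_const)).contDiffAt.congr_of_eventuallyEq this

theorem IsWeakDeriv.exists_ae_eq {F : Type*} [NormedAddCommGroup F] [NormedSpace ℝ F]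
    [CompleteSpace F] {u v : ℝ → F} (hu : Integrable u muI) (hv : Integrable v muI)
    (h : IsWeakDeriv u v) :
    ∃ c, ∀ᵐ ρ ∂muI, u ρ = c + ∫ s in (0 : ℝ)..ρ, v s := by
  have := exists_ae_eq_const_add_primitive one_pos hu hv (by
    intro ψ hψ hs
    have h1 := h _ (exists_periodic_extension hψ hs) (fun ρ => by
      simp [Int.fract_add_one])
    have e : ∀ ρ ∈ Ioo (0 : ℝ) 1, Int.fract ρ = ρ := fun ρ hρ =>
      Int.fract_eq_self.mpr ⟨hρ.1.le, hρ.2⟩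
    have e1 : EqOn (fun ρ => ψ (Int.fract ρ) • v ρ) (fun ρ => ψ ρ • v ρ) (Ioo 0 1) :=
      fun ρ hρ => by simp only [e ρ hρ]
    have e2 : EqOn (fun ρ => deriv (fun ρ => ψ (Int.fract ρ)) ρ • u ρ)
        (fun ρ => deriv ψ ρ • u ρ) (Ioo 0 1) := fun ρ hρ => by
      have : (fun ρ => ψ (Int.fract ρ)) =ᶠ[nhds ρ] ψ := by
        filter_upwards [isOpen_Ioo.mem_nhds hρ] with σ hσ
        rw [e σ hσ]
      simp only [this.deriv_eq]
    rw [intervalIntegral.integral_of_le zero_le_one, intervalIntegral.integral_of_le zero_le_one,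
      integral_Ioc_eq_integral_Ioo, integral_Ioc_eq_integral_Ioo] at h1 ⊢
    rwa [setIntegral_congr_fun measurableSet_Ioo e1,
      setIntegral_congr_fun measurableSet_Ioo e2] at h1)
  rwa [Measure.restrict_congr_set Ioo_ae_eq_Ioc] at this

/-! ### Pointwise regularity of the curve -/

/-- The continuous function `max f K` equals `K` almost everywhere, hence everywhere on the
interval. -/
theorem le_on_Icc_of_ae_le {f : ℝ → ℝ} (hf : ContinuousOn f (Icc 0 1)) {K : ℝ}
    (h : ∀ᵐ ρ ∂muI, f ρ ≤ K) : ∀ ρ ∈ Icc (0 : ℝ) 1, f ρ ≤ K := by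
  have h1 : (fun ρ => max (f ρ) K) =ᵐ[volume.restrict (Icc 0 1)] fun _ => K := by
    rw [← Measure.restrict_congr_set Ioc_ae_eq_Icc]
    filter_upwards [h] with ρ hρ using max_eq_right hρ
  have h2 := Measure.eqOn_Icc_of_ae_eq volume zero_ne_one h1
    (hf.sup continuousOn_const) continuousOn_const
  intro ρ hρ
  have := h2 hρ
  exact max_eq_right_iff.mp this

theorem ae_norm_le_of_Lp_top {F : Type*} [NormedAddCommGroup F] (u : Lp F ∞ muI) :
    ∀ᵐ ρ ∂muI, ‖u ρ‖ ≤ ‖u‖ := by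
  have h := ae_le_eLpNormEssSup (f := u) (μ := muI)
  filter_upwards [h] with ρ hρ
  rw [← eLpNorm_exponent_top] at hρ
  have := ENNReal.toReal_mono (Lp.eLpNorm_ne_top u) hρ
  simpa [Lp.norm_def] using this

theorem integrable_Lp_top {F : Type*} [NormedAddCommGroup F] (u : Lp F ∞ muI) :
    Integrable u muI := (Lp.memLp u).integrable (by simp)

theorem continuousOn_primitive {F : Type*} [NormedAddCommGroup F] [NormedSpace ℝ F]
    {v : ℝ → F} (hv : Integrable v muI) :
    ContinuousOn (fun ρ => ∫ s in (0 : ℝ)..ρ, v s) (Icc 0 1) := by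
  have := intervalIntegral.continuousOn_primitive_interval (a := 0) (b := 1) (f := v)
      (μ := volume) (by
        rw [uIcc_of_le zero_le_one]; exact (integrableOn_Icc_iff_integrableOn_Ioc).mpr hv)
  rwa [uIcc_of_le zero_le_one] at this

/-- A differentiable representative of an element of `W^{2,∞}` is of class `C^{1,1}`. -/
theorem Sobolev.pointwise_bounds {d : ℕ} (u : W2inf d) {y : ℝ → E d} (hy : u.1 0 =ᵐ[muI] y)
    (hd : ∀ ρ, DifferentiableAt ℝ y ρ) :
    (∀ ρ ∈ Icc (0 : ℝ) 1, ‖y ρ‖ ≤ ‖u‖) ∧ (∀ ρ ∈ Icc (0 : ℝ) 1, ‖deriv y ρ‖ ≤ ‖u‖) ∧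
      ∀ ρ ∈ Icc (0 : ℝ) 1, ∀ σ ∈ Icc (0 : ℝ) 1, ‖deriv y ρ - deriv y σ‖ ≤ ‖u‖ * |ρ - σ| := by
  have hcomp : ∀ i, ∀ᵐ ρ ∂muI, ‖u.1 i ρ‖ ≤ ‖u‖ := fun i => by
    filter_upwards [ae_norm_le_of_Lp_top (u.1 i)] with ρ hρ
    exact hρ.trans (norm_le_pi_norm u.1 i)
  obtain ⟨c1, h1⟩ := IsWeakDeriv.exists_ae_eq (integrable_Lp_top _) (integrable_Lp_top _)
    (u.2 1)
  obtain ⟨c0, h0⟩ := IsWeakDeriv.exists_ae_eq (integrable_Lp_top _) (integrable_Lp_top _)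
    (u.2 0)
  -- `g` is the continuous representative of the weak derivative. Since `y` is differentiable
  -- everywhere, its classical derivative agrees with `g` at every point of `[0, 1]`, end points
  -- included.
  set g : ℝ → E d := fun ρ => c1 + ∫ s in (0 : ℝ)..ρ, u.1 2 s with hg
  have hgc : ContinuousOn g (Icc 0 1) :=
    continuousOn_const.add (continuousOn_primitive (integrable_Lp_top (u.1 2)))
  have h1' : u.1 1 =ᵐ[muI] g := h1
  have hprim : ∀ ρ ∈ Icc (0 : ℝ) 1, ∫ s in (0 : ℝ)..ρ, u.1 1 s = ∫ s in (0 : ℝ)..ρ, g s := by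
    intro ρ hρ
    rw [intervalIntegral.integral_of_le hρ.1, intervalIntegral.integral_of_le hρ.1]
    exact integral_congr_ae (ae_restrict_of_ae_restrict_of_subset (Ioc_subset_Ioc_right hρ.2) h1')
  have hyc : Continuous y := continuous_iff_continuousAt.mpr fun ρ => (hd ρ).continuousAt
  have hyeq : ∀ ρ ∈ Icc (0 : ℝ) 1, y ρ = c0 + ∫ s in (0 : ℝ)..ρ, g s := by
    have hae : y =ᵐ[volume.restrict (Icc 0 1)] fun ρ => c0 + ∫ s in (0 : ℝ)..ρ, g s := by
      rw [← Measure.restrict_congr_set Ioc_ae_eq_Icc]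
      filter_upwards [hy, h0, ae_restrict_mem measurableSet_Ioc] with ρ e1 e2 hρ
      rw [← e1, ← hprim ρ (Ioc_subset_Icc_self hρ)]
      exact e2
    exact Measure.eqOn_Icc_of_ae_eq volume zero_ne_one hae hyc.continuousOn
      (continuousOn_const.add (continuousOn_primitive
        ((hgc.integrableOn_compact isCompact_Icc).mono_set Ioc_subset_Icc_self)))
  have hdg : ∀ ρ ∈ Icc (0 : ℝ) 1, deriv y ρ = g ρ := by
    intro ρ hρ
    have hint : IntervalIntegrable g volume 0 ρ :=
      (hgc.mono (by rw [uIcc_of_le hρ.1]; exact Icc_subset_Icc_right hρ.2)).intervalIntegrable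
    have : Fact (ρ ∈ Icc (0 : ℝ) 1) := ⟨hρ⟩
    have e1 : HasDerivWithinAt (fun ρ => c0 + ∫ s in (0 : ℝ)..ρ, g s) (g ρ) (Icc 0 1) ρ := by
      refine HasDerivWithinAt.const_add c0 ?_
      exact intervalIntegral.integral_hasDerivWithinAt_right hint
        (hgc.stronglyMeasurableAtFilter_nhdsWithin measurableSet_Icc ρ) (hgc ρ hρ)
    have e2 : HasDerivWithinAt y (g ρ) (Icc 0 1) ρ := e1.congr hyeq (hyeq ρ hρ)
    exact (uniqueDiffOn_Icc zero_lt_one ρ hρ).eq_deriv _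
      (hd ρ).hasDerivAt.hasDerivWithinAt e2
  refine ⟨le_on_Icc_of_ae_le hyc.norm.continuousOn ?_, ?_, ?_⟩
  · filter_upwards [hy, hcomp 0] with ρ e1 e2
    rwa [← e1]
  · have := le_on_Icc_of_ae_le hgc.norm (K := ‖u‖) (by
      filter_upwards [h1', hcomp 1] with ρ e1 e2
      rwa [← e1])
    intro ρ hρ
    rw [hdg ρ hρ]
    exact this ρ hρ
  · intro ρ hρ σ hσ
    rw [hdg ρ hρ, hdg σ hσ]
    have hii : ∀ τ ∈ Icc (0 : ℝ) 1, IntervalIntegrable (u.1 2) volume 0 τ := fun τ hτ => by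
      rw [intervalIntegrable_iff_integrableOn_Ioc_of_le hτ.1]
      exact IntegrableOn.mono_set (integrable_Lp_top (u.1 2)) (Ioc_subset_Ioc_right hτ.2)
    have : g ρ - g σ = ∫ s in σ..ρ, u.1 2 s := by
      rw [hg]
      simp only [add_sub_add_left_eq_sub]
      exact intervalIntegral.integral_interval_sub_left (hii ρ hρ) (hii σ hσ)
    rw [this]
    refine intervalIntegral.norm_integral_le_of_norm_le_const_ae ?_
    have h2 := hcomp 2
    rw [ae_restrict_iff' measurableSet_Ioc] at h2
    filter_upwards [h2] with s hs hmem
    refine hs ⟨?_, ?_⟩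
    · exact (le_min hσ.1 hρ.1).trans_lt hmem.1
    · exact hmem.2.trans (max_le hσ.2 hρ.2)

theorem MemLinfTime.integrableOn {B : Type*} [NormedAddCommGroup B] {T : ℝ} {f : ℝ → B}
    (hf : MemLinfTime T f) : IntegrableOn f (Ioc 0 T) := by
  rw [integrableOn_Ioc_iff_integrableOn_Ioo]
  exact MemLp.integrable (by simp) hf

/-- Time regularity of a function with values in a Banach space: it is a.e. equal to a primitive of
its weak derivative. -/
theorem IsWeakTimeDeriv.exists_lipschitz {B : Type*} [NormedAddCommGroup B] [NormedSpace ℝ B]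
    [CompleteSpace B] {T : ℝ} (hT : 0 < T) {u v : ℝ → B} (hu : MemLinfTime T u)
    (hv : MemLinfTime T v) (h : IsWeakTimeDeriv T u v) :
    ∃ (w : ℝ → B) (L : ℝ), 0 ≤ L ∧ (∀ᵐ t ∂volume.restrict (Ioo 0 T), u t = w t) ∧
      (∀ s ∈ Icc 0 T, ∀ t ∈ Icc 0 T, w t - w s = ∫ τ in s..t, v τ) ∧
      ∀ s ∈ Icc 0 T, ∀ t ∈ Icc 0 T, ‖w t - w s‖ ≤ L * |t - s| := by
  obtain ⟨c, hc⟩ := exists_ae_eq_const_add_primitive hT hu.integrableOn hv.integrableOn h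
  have hii : ∀ τ ∈ Icc (0 : ℝ) T, IntervalIntegrable v volume 0 τ := fun τ hτ => by
    rw [intervalIntegrable_iff_integrableOn_Ioc_of_le hτ.1]
    exact hv.integrableOn.mono_set (Ioc_subset_Ioc_right hτ.2)
  have hdiff : ∀ s ∈ Icc 0 T, ∀ t ∈ Icc 0 T,
      (c + ∫ τ in (0 : ℝ)..t, v τ) - (c + ∫ τ in (0 : ℝ)..s, v τ) = ∫ τ in s..t, v τ := by
    intro s hs t ht
    rw [add_sub_add_left_eq_sub]
    exact intervalIntegral.integral_interval_sub_left (hii t ht) (hii s hs)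
  refine ⟨fun t => c + ∫ τ in (0 : ℝ)..t, v τ,
    (eLpNorm v ∞ (volume.restrict (Ioo 0 T))).toReal, ENNReal.toReal_nonneg, hc, hdiff, ?_⟩
  intro s hs t ht
  rw [hdiff s hs t ht]
  refine intervalIntegral.norm_integral_le_of_norm_le_const_ae ?_
  have h1 := ae_le_eLpNormEssSup (f := v) (μ := volume.restrict (Ioo 0 T))
  rw [Measure.restrict_congr_set Ioo_ae_eq_Ioc, ae_restrict_iff' measurableSet_Ioc] at h1
  filter_upwards [h1] with τ hτ hmem
  have h2 := hτ ⟨(le_min hs.1 ht.1).trans_lt hmem.1, hmem.2.trans (max_le hs.2 ht.2)⟩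
  have hv2 := hv.2.ne
  rw [Measure.restrict_congr_set Ioo_ae_eq_Ioc, eLpNorm_exponent_top] at *
  have := ENNReal.toReal_mono hv2 h2
  simpa using this

theorem exists_seq_tendsto_of_ae {T : ℝ} (hT : 0 < T) {P : ℝ → Prop}
    (hP : ∀ᵐ t ∂volume.restrict (Ioo 0 T), P t) {t : ℝ} (ht : t ∈ Icc 0 T) :
    ∃ s : ℕ → ℝ, (∀ n, s n ∈ Ioo 0 T ∧ P (s n)) ∧ Filter.Tendsto s Filter.atTop (nhds t) := by
  rw [ae_restrict_iff' measurableSet_Ioo] at hP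
  have hd := Measure.dense_of_ae hP
  have h1 : Ioo 0 T ⊆ closure (Ioo 0 T ∩ {t | t ∈ Ioo 0 T → P t}) :=
    hd.open_subset_closure_inter isOpen_Ioo
  have h2 : t ∈ closure (Ioo 0 T ∩ {t | t ∈ Ioo 0 T → P t}) := by
    have := closure_minimal h1 isClosed_closure
    rw [closure_Ioo hT.ne] at this
    exact this ht
  obtain ⟨s, hs, hlim⟩ := mem_closure_iff_seq_limit.mp h2
  exact ⟨s, fun n => ⟨(hs n).1, (hs n).2 (hs n).1⟩, hlim⟩

/-- Pointwise regularity of a time dependent closed curve. -/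
structure CurveRegularity {d : ℕ} (T : ℝ) (x : ℝ → ℝ → E d) (L : ℝ) : Prop where
  nonneg : 0 ≤ L
  periodic : ∀ t ∈ Icc 0 T, Function.Periodic (x t) 1
  differentiable : ∀ t ∈ Icc 0 T, ∀ ρ, DifferentiableAt ℝ (x t) ρ
  deriv_lip : ∀ t ∈ Icc 0 T, ∀ ρ ∈ Icc (0 : ℝ) 1, ∀ σ ∈ Icc (0 : ℝ) 1,
    ‖deriv (x t) ρ - deriv (x t) σ‖ ≤ L * |ρ - σ|
  time_lip : ∀ s ∈ Icc 0 T, ∀ t ∈ Icc 0 T, ∀ ρ ∈ Icc (0 : ℝ) 1, ‖x t ρ - x s ρ‖ ≤ L * |t - s|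
  time_deriv_lip : ∀ s ∈ Icc 0 T, ∀ t ∈ Icc 0 T, ∀ ρ ∈ Icc (0 : ℝ) 1,
    ‖deriv (x t) ρ - deriv (x s) ρ‖ ≤ L * |t - s|
  mixed_lip : ∀ s ∈ Icc 0 T, ∀ t ∈ Icc 0 T, ∀ ρ ∈ Icc (0 : ℝ) 1, ∀ σ ∈ Icc (0 : ℝ) 1,
    ‖(deriv (x t) ρ - deriv (x s) ρ) - (deriv (x t) σ - deriv (x s) σ)‖ ≤ L * |t - s| * |ρ - σ|
  velocity : ∀ t ∈ Icc 0 T, ∃ v : ℝ → E d, AEStronglyMeasurable v muI ∧ ∀ᵐ ρ ∂muI,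
    derivWithin (fun s => x s ρ) (Icc 0 T) t = v ρ ∧
      ∀ s ∈ Icc 0 T, ‖x s ρ - x t ρ - (s - t) • v ρ‖ ≤ L * (s - t) ^ 2

theorem derivWithin_eq_of_quadratic {F : Type*} [NormedAddCommGroup F] [NormedSpace ℝ F] {T : ℝ}
    (hT : 0 < T) {f : ℝ → F} {t : ℝ} (ht : t ∈ Icc 0 T) {v : F} {L : ℝ}
    (h : ∀ s ∈ Icc 0 T, ‖f s - f t - (s - t) • v‖ ≤ L * (s - t) ^ 2) :
    derivWithin f (Icc 0 T) t = v := by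
  have hO : (fun s => f s - f t - (s - t) • v) =O[nhdsWithin t (Icc 0 T)]
      fun s => ‖s - t‖ ^ 2 := by
    refine Asymptotics.IsBigO.of_bound L ?_
    filter_upwards [self_mem_nhdsWithin] with s hs
    have := h s hs
    rwa [norm_pow, norm_norm, Real.norm_eq_abs, sq_abs]
  have h1 := (hO.hasFDerivWithinAt ht (by norm_num)).hasDerivWithinAt
  have h2 : HasDerivWithinAt (fun s => (s - t) • v) v (Icc 0 T) t := by
    simpa using (((hasDerivAt_id t).sub_const t).smul_const v).hasDerivWithinAt
  have h3 := (h1.add h2).add_const (f t)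
  have h4 : HasDerivWithinAt f v (Icc 0 T) t := by
    simpa [Pi.add_def] using h3
  exact h4.derivWithin (uniqueDiffOn_Icc hT t ht)

/-- `W` is the Lipschitz representative of `x` in time with values in `W^{2,∞}`; the spatial bounds
for `W t - W s` give the Lipschitz estimates, including the mixed one. `Z` is the Lipschitz
representative of `x_t` with values in `L^∞`; integrating `Z τ - Z t` in time gives the quadratic
expansion, which also identifies the pointwise time derivative. -/
theorem HasRegularity.exists_curveRegularity {d : ℕ} {T : ℝ} (hT : 0 < T) {x : ℝ → ℝ → E d}
    (h : HasRegularity T x) (hd : ∀ t ∈ Icc 0 T, ∀ ρ, DifferentiableAt ℝ (x t) ρ) :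
    ∃ L, CurveRegularity T x L := by
  obtain ⟨U, V, A, hUx, hU, hV, hUV, hA, hVA⟩ := h.sobolev
  obtain ⟨W, L₁, hL₁, hUW, hWV, hWL⟩ := hUV.exists_lipschitz hT hU hV
  let P : W2inf d →L[ℝ] Lp (E d) ∞ muI :=
    (ContinuousLinearMap.proj 0).comp (Submodule.subtypeL _)
  have hP : ∀ u : W2inf d, P u = u.1 0 := fun u => rfl
  have hV0 : MemLinfTime T (fun t => (V t).1 0) := by
    exact hV.continuousLinearMap_comp P
  obtain ⟨Z, L₂, hL₂, hVZ, -, hZL⟩ := hVA.exists_lipschitz hT hV0 hA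
  have hxc : ∀ ρ, ContinuousOn (fun t => x t ρ) (Icc 0 T) := fun ρ =>
    h.continuousOn.comp (continuousOn_id.prodMk continuousOn_const) fun t ht => ⟨ht, mem_univ _⟩
  -- the curve is represented by `W` at all times
  have hWx : ∀ t ∈ Icc 0 T, (W t).1 0 =ᵐ[muI] x t := by
    intro t ht
    obtain ⟨s, hs, hlim⟩ := exists_seq_tendsto_of_ae hT
      (P := fun t => (W t).1 0 =ᵐ[muI] x t) (by
        filter_upwards [hUx, hUW] with t h1 h2
        rwa [← h2]) ht
    have hsI : ∀ n, s n ∈ Icc 0 T := fun n => Ioo_subset_Icc_self (hs n).1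
    have hae : ∀ n, ∀ᵐ ρ ∂muI, ‖x (s n) ρ - (W t).1 0 ρ‖ ≤ L₁ * |s n - t| := by
      intro n
      filter_upwards [(hs n).2, ae_norm_le_of_Lp_top ((W (s n)).1 0 - (W t).1 0),
        Lp.coeFn_sub ((W (s n)).1 0) ((W t).1 0)] with ρ e1 e2 e3
      rw [e3, Pi.sub_apply, e1] at e2
      exact (e2.trans (norm_le_pi_norm (W (s n) - W t).1 0)).trans (hWL t ht (s n) (hsI n))
    filter_upwards [ae_all_iff.mpr hae] with ρ hρ
    have l1 : Filter.Tendsto (fun n => x (s n) ρ) Filter.atTop (nhds (x t ρ)) :=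
      ((hxc ρ t ht).tendsto).comp (tendsto_nhdsWithin_iff.mpr
        ⟨hlim, Filter.Eventually.of_forall hsI⟩)
    have l2 : Filter.Tendsto (fun n => L₁ * |s n - t|) Filter.atTop (nhds 0) := by
      have : Filter.Tendsto (fun n => L₁ * |s n - t|) Filter.atTop (nhds (L₁ * |t - t|)) :=
        ((hlim.sub_const t).abs).const_mul L₁
      simpa using this
    have l3 : Filter.Tendsto (fun n => x (s n) ρ) Filter.atTop (nhds ((W t).1 0 ρ)) :=
      tendsto_iff_norm_sub_tendsto_zero.mpr (squeeze_zero (fun n => norm_nonneg _) hρ l2)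
    exact tendsto_nhds_unique l3 l1
  have hWdiff : ∀ s ∈ Icc 0 T, ∀ t ∈ Icc 0 T,
      (W t - W s).1 0 =ᵐ[muI] fun ρ => x t ρ - x s ρ := by
    intro s hs t ht
    filter_upwards [hWx s hs, hWx t ht, Lp.coeFn_sub ((W t).1 0) ((W s).1 0)] with ρ e1 e2 e3
    change ((W t).1 0 - (W s).1 0 : Lp (E d) ∞ muI) ρ = _
    rw [e3, Pi.sub_apply, e1, e2]
  have hderiv : ∀ s ∈ Icc 0 T, ∀ t ∈ Icc 0 T, ∀ ρ,
      deriv (fun ρ => x t ρ - x s ρ) ρ = deriv (x t) ρ - deriv (x s) ρ :=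
    fun s hs t ht ρ => deriv_fun_sub (hd t ht ρ) (hd s hs ρ)
  have hpb := fun s (hs : s ∈ Icc 0 T) t (ht : t ∈ Icc 0 T) =>
    Sobolev.pointwise_bounds (W t - W s) (hWdiff s hs t ht)
      (fun ρ => (hd t ht ρ).sub (hd s hs ρ))
  have hZx : ∀ t ∈ Icc 0 T, ∀ᵐ ρ ∂muI, ∀ s ∈ Icc 0 T,
      ‖x s ρ - x t ρ - (s - t) • Z t ρ‖ ≤ L₂ * (s - t) ^ 2 := by
    intro t ht
    have hs1 : ∀ s ∈ Icc 0 T, ∀ᵐ ρ ∂muI, ‖x s ρ - x t ρ - (s - t) • Z t ρ‖ ≤ L₂ * (s - t) ^ 2 := by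
      intro s hs
      have hVi : IntervalIntegrable V volume t s := by
        refine (intervalIntegrable_iff.mpr (hV.integrableOn.mono_set ?_))
        exact Ioc_subset_Ioc (le_min ht.1 hs.1) (max_le ht.2 hs.2)
      have e1 : (W s).1 0 - (W t).1 0 = ∫ τ in t..s, (V τ).1 0 := by
        have := congrArg P (hWV t ht s hs)
        rw [← P.intervalIntegral_comp_comm hVi, map_sub] at this
        exact this
      have hVi0 : IntervalIntegrable (fun τ => (V τ).1 0) volume t s :=
        ⟨P.integrable_comp hVi.1, P.integrable_comp hVi.2⟩
      have e2 : (W s).1 0 - (W t).1 0 - (s - t) • Z t = ∫ τ in t..s, ((V τ).1 0 - Z t) := by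
        rw [e1, intervalIntegral.integral_sub hVi0 intervalIntegrable_const,
          intervalIntegral.integral_const]
      have e3 : ‖(W s).1 0 - (W t).1 0 - (s - t) • Z t‖ ≤ L₂ * (s - t) ^ 2 := by
        rw [e2, ← sq_abs, sq, ← mul_assoc]
        refine intervalIntegral.norm_integral_le_of_norm_le_const_ae ?_
        rw [Measure.restrict_congr_set Ioo_ae_eq_Ioc, ae_restrict_iff' measurableSet_Ioc] at hVZ
        filter_upwards [hVZ] with τ hτ hmem
        have hτT : τ ∈ Ioc 0 T := ⟨(le_min ht.1 hs.1).trans_lt hmem.1,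
          hmem.2.trans (max_le ht.2 hs.2)⟩
        rw [hτ hτT]
        refine (hZL t ht τ (Ioc_subset_Icc_self hτT)).trans ?_
        refine mul_le_mul_of_nonneg_left ?_ hL₂
        exact abs_sub_left_of_mem_uIcc (uIoc_subset_uIcc hmem)
      filter_upwards [hWx s hs, hWx t ht,
        ae_norm_le_of_Lp_top ((W s).1 0 - (W t).1 0 - (s - t) • Z t),
        Lp.coeFn_sub ((W s).1 0 - (W t).1 0) ((s - t) • Z t),
        Lp.coeFn_sub ((W s).1 0) ((W t).1 0), Lp.coeFn_smul (s - t) (Z t)] with ρ a1 a2 a3 a4 a5 a6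
      rw [a4, Pi.sub_apply, a5, Pi.sub_apply, a6, Pi.smul_apply, a1, a2] at a3
      exact a3.trans e3
    -- The null set in `hs1` depends on `s`. Only countably many rational times are used, and
    -- continuity in time extends the bound to all of `[0, T]`.
    have hq : ∀ᵐ ρ ∂muI, ∀ q : ℚ, (q : ℝ) ∈ Icc 0 T →
        ‖x q ρ - x t ρ - ((q : ℝ) - t) • Z t ρ‖ ≤ L₂ * (q - t) ^ 2 := by
      rw [ae_all_iff]
      intro q
      by_cases hqT : (q : ℝ) ∈ Icc 0 T
      · filter_upwards [hs1 q hqT] with ρ hρ _ using hρ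
      · exact Filter.Eventually.of_forall fun ρ h => absurd h hqT
    filter_upwards [hq] with ρ hρ s hs
    have hcl : s ∈ closure (Ioo 0 T ∩ range ((↑) : ℚ → ℝ)) := by
      have := closure_minimal (Rat.denseRange_cast (𝕜 := ℝ).open_subset_closure_inter
        (isOpen_Ioo (a := 0) (b := T))) isClosed_closure
      rw [closure_Ioo hT.ne] at this
      exact this hs
    obtain ⟨r, hr, hlim⟩ := mem_closure_iff_seq_limit.mp hcl
    have hrI : ∀ n, r n ∈ Icc 0 T := fun n => Ioo_subset_Icc_self (hr n).1
    have l1 : Filter.Tendsto (fun n => x (r n) ρ) Filter.atTop (nhds (x s ρ)) :=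
      ((hxc ρ s hs).tendsto).comp (tendsto_nhdsWithin_iff.mpr
        ⟨hlim, Filter.Eventually.of_forall hrI⟩)
    refine le_of_tendsto_of_tendsto (((l1.sub_const _).sub
      ((hlim.sub_const t).smul_const _)).norm) (((hlim.sub_const t).pow 2).const_mul L₂)
      (Filter.Eventually.of_forall fun n => ?_)
    obtain ⟨q, hq⟩ := (hr n).2
    have := hρ q (hq ▸ hrI n)
    rw [hq] at this
    exact this
  obtain ⟨L₃, hL₃, hWbound⟩ : ∃ L₃, 0 ≤ L₃ ∧ ∀ t ∈ Icc 0 T, ‖W t‖ ≤ L₃ := by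
    refine ⟨‖W 0‖ + L₁ * T, by positivity, fun t ht => ?_⟩
    have h1 := hWL 0 (left_mem_Icc.mpr hT.le) t ht
    have h2 : ‖W t‖ ≤ ‖W 0‖ + ‖W t - W 0‖ := by
      simpa using norm_add_le (W 0) (W t - W 0)
    rw [sub_zero, abs_of_nonneg ht.1] at h1
    have : L₁ * t ≤ L₁ * T := by gcongr; exact ht.2
    linarith
  refine ⟨L₁ + L₂ + L₃, by positivity, h.periodic, hd, ?_, ?_, ?_, ?_, ?_⟩
  · intro t ht ρ hρ σ hσ
    refine ((Sobolev.pointwise_bounds (W t) (hWx t ht) (hd t ht)).2.2 ρ hρ σ hσ).trans ?_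
    gcongr
    linarith [hWbound t ht]
  · intro s hs t ht ρ hρ
    refine ((hpb s hs t ht).1 ρ hρ).trans ((hWL s hs t ht).trans ?_)
    gcongr
    linarith
  · intro s hs t ht ρ hρ
    rw [← hderiv s hs t ht]
    refine ((hpb s hs t ht).2.1 ρ hρ).trans ((hWL s hs t ht).trans ?_)
    gcongr
    linarith
  · intro s hs t ht ρ hρ σ hσ
    rw [← hderiv s hs t ht, ← hderiv s hs t ht]
    refine ((hpb s hs t ht).2.2 ρ hρ σ hσ).trans ?_
    gcongr
    refine (hWL s hs t ht).trans ?_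
    gcongr
    linarith
  · intro t ht
    refine ⟨Z t, (Lp.memLp (Z t)).1, ?_⟩
    filter_upwards [hZx t ht] with ρ hρ
    have : ∀ s ∈ Icc 0 T, ‖x s ρ - x t ρ - (s - t) • Z t ρ‖ ≤ (L₁ + L₂ + L₃) * (s - t) ^ 2 := by
      intro s hs
      refine (hρ s hs).trans ?_
      gcongr
      linarith
    exact ⟨derivWithin_eq_of_quadratic hT ht this, this⟩

/-! ### Meshes -/

namespace Mesh

variable {J : ℕ} (Q : Mesh J)

/-- Left end point of a subinterval. -/
abbrev lt (j : Fin J) : ℝ := Q.q j.castSucc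

/-- Right end point of a subinterval. -/
abbrev rt (j : Fin J) : ℝ := Q.q j.succ

theorem lt_lt_rt (j : Fin J) : Q.lt j < Q.rt j := Q.strictMono Fin.castSucc_lt_succ

theorem len_pos (j : Fin J) : 0 < Q.len j := sub_pos.mpr (Q.lt_lt_rt j)

theorem len_le_size (j : Fin J) : Q.len j ≤ Q.size := le_ciSup (finite_range Q.len).bddAbove j

theorem q_mem (k : Fin (J + 1)) : Q.q k ∈ Icc (0 : ℝ) 1 := by
  constructor
  · rw [← Q.first]; exact Q.strictMono.monotone (Fin.zero_le k)
  · rw [← Q.last]; exact Q.strictMono.monotone (Fin.le_last k)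

theorem Icc_subset (j : Fin J) : Icc (Q.lt j) (Q.rt j) ⊆ Icc 0 1 :=
  Icc_subset_Icc (Q.q_mem _).1 (Q.q_mem _).2

theorem exists_mem_Ioc {ρ : ℝ} (hρ : ρ ∈ Ioc (0 : ℝ) 1) : ∃ j, ρ ∈ Ioc (Q.lt j) (Q.rt j) := by
  have key : ∀ k : Fin (J + 1), ρ ≤ Q.q k → ∃ j, ρ ∈ Ioc (Q.lt j) (Q.rt j) := by
    intro k
    induction k using Fin.induction with
    | zero => intro h; rw [Q.first] at h; exact absurd hρ.1 (not_lt.mpr h)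
    | succ i ih =>
      intro h
      by_cases hi : ρ ≤ Q.q i.castSucc
      · exact ih hi
      · exact ⟨i, not_le.mp hi, h⟩
  exact key (Fin.last J) (by rw [Q.last]; exact hρ.2)

theorem exists_index (R : Mesh J) : Nonempty (Fin J) :=
  ⟨(R.exists_mem_Ioc (ρ := 1) (by simp)).choose⟩

theorem size_pos : 0 < Q.size :=
  let ⟨j⟩ := Q.exists_index
  (Q.len_pos j).trans_le (Q.len_le_size j)

theorem ae_exists_mem_Ioo : ∀ᵐ ρ ∂muI, ∃ j, ρ ∈ Ioo (Q.lt j) (Q.rt j) := by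
  have h : ∀ᵐ ρ ∂muI, ρ ∉ range Q.q :=
    ae_restrict_of_ae (measure_eq_zero_iff_ae_notMem.mp ((finite_range Q.q).measure_zero volume))
  filter_upwards [h, ae_restrict_mem measurableSet_Ioc] with ρ h1 h2
  obtain ⟨j, hj⟩ := Q.exists_mem_Ioc h2
  exact ⟨j, hj.1, lt_of_le_of_ne hj.2 fun h => h1 ⟨_, h.symm⟩⟩

theorem intervalIntegrable {F : Type*} [NormedAddCommGroup F] {f : ℝ → F} (hf : Integrable f muI)
    (j : Fin J) : IntervalIntegrable f volume (Q.lt j) (Q.rt j) := by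
  rw [intervalIntegrable_iff_integrableOn_Ioc_of_le (Q.lt_lt_rt j).le]
  exact IntegrableOn.mono_set hf (Ioc_subset_Ioc (Q.q_mem _).1 (Q.q_mem _).2)

theorem integral_eq_sum {F : Type*} [NormedAddCommGroup F] [NormedSpace ℝ F] {f : ℝ → F}
    (hf : Integrable f muI) : ∫ ρ, f ρ ∂muI = ∑ j, ∫ ρ in Q.lt j..Q.rt j, f ρ := by
  -- The nodes as a sequence over `ℕ`; the value `1` past the last index is never used.
  set a : ℕ → ℝ := fun k => if h : k < J + 1 then Q.q ⟨k, h⟩ else 1 with ha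
  have e1 : ∀ j : Fin J, a j = Q.lt j := fun j => by
    simp only [ha]
    rw [dif_pos (by omega)]
    rfl
  have e2 : ∀ j : Fin J, a (j + 1) = Q.rt j := fun j => by
    simp only [ha]
    rw [dif_pos (by omega)]
    rfl
  have e3 : a 0 = 0 := by
    simp only [ha]
    rw [dif_pos (by omega)]
    exact Q.first
  have e4 : a J = 1 := by
    simp only [ha]
    rw [dif_pos (by omega)]
    exact Q.last
  have h := intervalIntegral.sum_integral_adjacent_intervals (f := f) (μ := volume) (a := a)
    (n := J) (fun k hk => by
      have := Q.intervalIntegrable hf ⟨k, hk⟩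
      rwa [← e1, ← e2] at this)
  rw [e3, e4, intervalIntegral.integral_of_le zero_le_one, Finset.sum_range] at h
  rw [← h]
  exact Finset.sum_congr rfl fun j _ => by rw [e1, e2]

/-- An integral vanishes if the integrand has on every subinterval a primitive that vanishes at the
end points. -/
theorem integral_eq_zero_of_elementwise {f : ℝ → ℝ} (hf : Bdd f)
    (h : ∀ j, ∃ g : ℝ → ℝ, ContinuousOn g (Icc (Q.lt j) (Q.rt j)) ∧ g (Q.lt j) = 0 ∧
      g (Q.rt j) = 0 ∧ ∀ ρ ∈ Ioo (Q.lt j) (Q.rt j), HasDerivAt g (f ρ) ρ) :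
    ∫ ρ, f ρ ∂muI = 0 := by
  rw [Q.integral_eq_sum hf.integrable]
  refine Finset.sum_eq_zero fun j _ => ?_
  obtain ⟨g, hc, h0, h1, hd⟩ := h j
  rw [intervalIntegral.integral_eq_sub_of_hasDerivAt_of_le (Q.lt_lt_rt j).le hc hd
    (Q.intervalIntegrable hf.integrable j), h0, h1, sub_zero]

variable {d : ℕ}

/-- The slope of the chord of `χ` over a subinterval. -/
def slope (χ : ℝ → E d) (j : Fin J) : E d := (Q.len j)⁻¹ • (χ (Q.rt j) - χ (Q.lt j))

theorem len_smul_slope (χ : ℝ → E d) (j : Fin J) :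
    Q.len j • Q.slope χ j = χ (Q.rt j) - χ (Q.lt j) := by
  rw [slope, smul_smul, mul_inv_cancel₀ (Q.len_pos j).ne', one_smul]

end Mesh

/-! ### Finite element functions -/

section FE

variable {d J : ℕ} {Q : Mesh J} {χ η : ℝ → E d}

theorem IsFE.eq_on (h : IsFE Q χ) (j : Fin J) {ρ : ℝ} (hρ : ρ ∈ Icc (Q.lt j) (Q.rt j)) :
    χ ρ = χ (Q.lt j) + (ρ - Q.lt j) • Q.slope χ j := by
  obtain ⟨a, b, hab⟩ := h.affine j
  have hl := hab (Q.lt j) (left_mem_Icc.mpr (Q.lt_lt_rt j).le)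
  have hr := hab (Q.rt j) (right_mem_Icc.mpr (Q.lt_lt_rt j).le)
  have hs : Q.slope χ j = b := by
    rw [Mesh.slope, hl, hr, add_sub_add_left_eq_sub, ← sub_smul, smul_smul]
    rw [show Q.rt j - Q.lt j = Q.len j from rfl, inv_mul_cancel₀ (Q.len_pos j).ne', one_smul]
  rw [hab ρ hρ, hl, hs, sub_smul]
  abel

theorem IsFE.hasDerivAt (h : IsFE Q χ) (j : Fin J) {ρ : ℝ} (hρ : ρ ∈ Ioo (Q.lt j) (Q.rt j)) :
    HasDerivAt χ (Q.slope χ j) ρ := by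
  have h1 : HasDerivAt (fun ρ => χ (Q.lt j) + (ρ - Q.lt j) • Q.slope χ j) (Q.slope χ j) ρ := by
    simpa using (((hasDerivAt_id ρ).sub_const (Q.lt j)).smul_const (Q.slope χ j)).const_add
      (χ (Q.lt j))
  refine h1.congr_of_eventuallyEq ?_
  filter_upwards [isOpen_Ioo.mem_nhds hρ] with σ hσ
  exact h.eq_on j (Ioo_subset_Icc_self hσ)

theorem IsFE.deriv_eq (h : IsFE Q χ) (j : Fin J) {ρ : ℝ} (hρ : ρ ∈ Ioo (Q.lt j) (Q.rt j)) :
    deriv χ ρ = Q.slope χ j := (h.hasDerivAt j hρ).deriv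

theorem IsFE.ae_differentiableAt (h : IsFE Q χ) : ∀ᵐ ρ ∂muI, DifferentiableAt ℝ χ ρ := by
  filter_upwards [Q.ae_exists_mem_Ioo] with ρ ⟨j, hj⟩
  exact (h.hasDerivAt j hj).differentiableAt

theorem IsFE.bdd (h : IsFE Q χ) : Bdd χ := .of_continuous h.continuous

theorem IsFE.bdd_deriv (h : IsFE Q χ) : Bdd (deriv χ) := by
  refine .of_bound (stronglyMeasurable_deriv χ).aestronglyMeasurable
    (K := ∑ j, ‖Q.slope χ j‖) ?_
  filter_upwards [Q.ae_exists_mem_Ioo] with ρ ⟨j, hj⟩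
  rw [h.deriv_eq j hj]
  exact Finset.single_le_sum (f := fun j => ‖Q.slope χ j‖) (fun _ _ => norm_nonneg _)
    (Finset.mem_univ j)

theorem IsFE.add (h : IsFE Q χ) (h' : IsFE Q η) : IsFE Q (χ + η) where
  continuous := h.continuous.add h'.continuous
  periodic := h.periodic.add h'.periodic
  affine j := by
    obtain ⟨a, b, hab⟩ := h.affine j
    obtain ⟨a', b', hab'⟩ := h'.affine j
    exact ⟨a + a', b + b', fun ρ hρ => by
      rw [Pi.add_apply, hab ρ hρ, hab' ρ hρ, smul_add]; abel⟩

theorem IsFE.smul (h : IsFE Q χ) (r : ℝ) : IsFE Q (r • χ) where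
  continuous := h.continuous.const_smul r
  periodic := h.periodic.smul r
  affine j := by
    obtain ⟨a, b, hab⟩ := h.affine j
    exact ⟨r • a, r • b, fun ρ hρ => by
      rw [Pi.smul_apply, hab ρ hρ, smul_add, smul_comm r ρ b]⟩

theorem IsFE.zero : IsFE Q (0 : ℝ → E d) where
  continuous := continuous_zero
  periodic ρ := rfl
  affine j := ⟨0, 0, fun ρ _ => by simp⟩

theorem IsFE.sub (h : IsFE Q χ) (h' : IsFE Q η) : IsFE Q (χ - η) := by
  have := h.add (h'.smul (-1))
  rwa [neg_one_smul, ← sub_eq_add_neg] at this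

theorem IsFE.ae_deriv_add (h : IsFE Q χ) (h' : IsFE Q η) :
    ∀ᵐ ρ ∂muI, deriv (χ + η) ρ = deriv χ ρ + deriv η ρ := by
  filter_upwards [h.ae_differentiableAt, h'.ae_differentiableAt] with ρ e1 e2
  exact deriv_add e1 e2

theorem IsFE.ae_deriv_sub (h : IsFE Q χ) (h' : IsFE Q η) :
    ∀ᵐ ρ ∂muI, deriv (χ - η) ρ = deriv χ ρ - deriv η ρ := by
  filter_upwards [h.ae_differentiableAt, h'.ae_differentiableAt] with ρ e1 e2
  exact deriv_sub e1 e2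

theorem IsFE.deriv_smul (χ : ℝ → E d) (r : ℝ) (ρ : ℝ) : deriv (r • χ) ρ = r • deriv χ ρ :=
  deriv_const_smul_field r χ

theorem eq_of_periodic {F : Type*} {f g : ℝ → F} (hf : Function.Periodic f 1)
    (hg : Function.Periodic g 1) (h : ∀ ρ ∈ Ioc (0 : ℝ) 1, f ρ = g ρ) : f = g := by
  ext ρ
  obtain ⟨σ, hσ, e1, e2⟩ : ∃ σ ∈ Ioc (0 : ℝ) 1, f ρ = f σ ∧ g ρ = g σ := by
    refine ⟨toIocMod one_pos 0 ρ, ?_, ?_, ?_⟩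
    · simpa using toIocMod_mem_Ioc (one_pos : (0 : ℝ) < 1) 0 ρ
    · rw [toIocMod, hf.sub_zsmul_eq]
    · rw [toIocMod, hg.sub_zsmul_eq]
  rw [e1, e2, h σ hσ]

theorem IsFE.eq_of_nodes (h : IsFE Q χ) (h' : IsFE Q η) (hn : ∀ k, χ (Q.q k) = η (Q.q k)) :
    χ = η := by
  refine eq_of_periodic h.periodic h'.periodic fun ρ hρ => ?_
  obtain ⟨j, hj⟩ := Q.exists_mem_Ioc hρ
  rw [h.eq_on j (Ioc_subset_Icc_self hj), h'.eq_on j (Ioc_subset_Icc_self hj), Mesh.slope,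
    Mesh.slope, hn, hn]

theorem IsFE.len_mul_slope_sq_le (h : IsFE Q χ) (j : Fin J) :
    Q.len j * ‖Q.slope χ j‖ ^ 2 ≤ ∫ ρ, ‖deriv χ ρ‖ ^ 2 ∂muI := by
  rw [Q.integral_eq_sum h.bdd_deriv.norm_sq.integrable]
  have e : ∫ ρ in Q.lt j..Q.rt j, ‖deriv χ ρ‖ ^ 2 = Q.len j * ‖Q.slope χ j‖ ^ 2 := by
    rw [intervalIntegral.integral_of_le (Q.lt_lt_rt j).le, integral_Ioc_eq_integral_Ioo,
      setIntegral_congr_fun (g := fun _ => ‖Q.slope χ j‖ ^ 2) measurableSet_Ioo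
        (fun ρ hρ => by simp only [h.deriv_eq j hρ])]
    rw [setIntegral_const, smul_eq_mul, measureReal_def, Real.volume_Ioo,
      ENNReal.toReal_ofReal (sub_nonneg.mpr (Q.lt_lt_rt j).le)]
    rfl
  rw [← e]
  exact Finset.single_le_sum (f := fun j => ∫ ρ in Q.lt j..Q.rt j, ‖deriv χ ρ‖ ^ 2)
    (fun i _ => intervalIntegral.integral_nonneg (Q.lt_lt_rt i).le fun _ _ => by positivity)
    (Finset.mem_univ j)

/-- The inverse inequality between `W^{1,∞}` and `H^1`. -/
theorem IsFE.ae_norm_deriv_sq_le (h : IsFE Q χ) {c : ℝ} (hc : ∀ j, Q.size ≤ c * Q.len j) :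
    ∀ᵐ ρ ∂muI, Q.size * ‖deriv χ ρ‖ ^ 2 ≤ c * ∫ ρ, ‖deriv χ ρ‖ ^ 2 ∂muI := by
  filter_upwards [Q.ae_exists_mem_Ioo] with ρ ⟨j, hj⟩
  have hc0 : 0 ≤ c := by
    have h1 := Q.size_pos.trans_le (hc j)
    exact (pos_of_mul_pos_left h1 (Q.len_pos j).le).le
  rw [h.deriv_eq j hj]
  calc Q.size * ‖Q.slope χ j‖ ^ 2 ≤ (c * Q.len j) * ‖Q.slope χ j‖ ^ 2 := by gcongr; exact hc j
    _ = c * (Q.len j * ‖Q.slope χ j‖ ^ 2) := by ring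
    _ ≤ _ := by gcongr; exact h.len_mul_slope_sq_le j

/-! ### The finite element space -/

/-- The finite element space. -/
def FESpace (d : ℕ) {J : ℕ} (Q : Mesh J) : Submodule ℝ (ℝ → E d) where
  carrier := {χ | IsFE Q χ}
  add_mem' h h' := h.add h'
  zero_mem' := IsFE.zero
  smul_mem' r _ h := h.smul r

instance : FiniteDimensional ℝ (FESpace d Q) := by
  let N : FESpace d Q →ₗ[ℝ] (Fin (J + 1) → E d) :=
    { toFun := fun χ k => χ.1 (Q.q k)
      map_add' := fun _ _ => rfl
      map_smul' := fun _ _ => rfl }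
  refine Module.Finite.of_injective N fun χ η h => Subtype.ext ?_
  exact IsFE.eq_of_nodes χ.2 η.2 fun k => congrFun h k

theorem continuous_eq_zero_of_integral {F : Type*} [NormedAddCommGroup F] {f : ℝ → F}
    (hf : Continuous f) (h : ∫ ρ, ‖f ρ‖ ^ 2 ∂muI = 0) : ∀ ρ ∈ Ioc (0 : ℝ) 1, f ρ = 0 := by
  have hc : Continuous fun ρ => ‖f ρ‖ ^ 2 := hf.norm.pow 2
  have h1 := (integral_eq_zero_iff_of_nonneg (fun ρ => by positivity)
    (Bdd.of_continuous hc).integrable).mp h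
  have h2 : ∀ᵐ ρ ∂muI, ‖f ρ‖ ^ 2 ≤ 0 := by
    filter_upwards [h1] with ρ hρ
    exact le_of_eq hρ
  intro ρ hρ
  have h3 := le_on_Icc_of_ae_le hc.continuousOn h2 ρ (Ioc_subset_Icc_self hρ)
  have : ‖f ρ‖ ^ 2 = 0 := le_antisymm h3 (by positivity)
  simpa using this

/-- The `H^1` inner product on the finite element space. -/
abbrev h1Core (d : ℕ) {J : ℕ} (Q : Mesh J) : InnerProductSpace.Core ℝ (FESpace d Q) where
  inner u v := (∫ ρ, inner ℝ (u.1 ρ) (v.1 ρ) ∂muI) +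
    ∫ ρ, inner ℝ (deriv u.1 ρ) (deriv v.1 ρ) ∂muI
  conj_inner_symm u v := by
    simp only [conj_trivial]
    congr 1 <;> exact integral_congr_ae (Filter.Eventually.of_forall fun ρ => real_inner_comm _ _)
  re_inner_nonneg u := by
    simp only [real_inner_self_eq_norm_sq]
    exact add_nonneg (integral_nonneg fun _ => by positivity) (integral_nonneg fun _ => by positivity)
  add_left u v w := by
    have hu : IsFE Q u.1 := u.2
    have hv : IsFE Q v.1 := v.2
    have hw : IsFE Q w.1 := w.2
    have e1 : ∫ ρ, inner ℝ ((u + v : FESpace d Q).1 ρ) (w.1 ρ) ∂muI =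
        (∫ ρ, inner ℝ (u.1 ρ) (w.1 ρ) ∂muI) + ∫ ρ, inner ℝ (v.1 ρ) (w.1 ρ) ∂muI := by
      rw [← integral_add (hu.bdd.inner hw.bdd).integrable (hv.bdd.inner hw.bdd).integrable]
      exact integral_congr_ae (Filter.Eventually.of_forall fun ρ => inner_add_left _ _ _)
    have e2 : ∫ ρ, inner ℝ (deriv (u + v : FESpace d Q).1 ρ) (deriv w.1 ρ) ∂muI =
        (∫ ρ, inner ℝ (deriv u.1 ρ) (deriv w.1 ρ) ∂muI) +
          ∫ ρ, inner ℝ (deriv v.1 ρ) (deriv w.1 ρ) ∂muI := by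
      rw [← integral_add (hu.bdd_deriv.inner hw.bdd_deriv).integrable
        (hv.bdd_deriv.inner hw.bdd_deriv).integrable]
      refine integral_congr_ae ?_
      filter_upwards [hu.ae_deriv_add hv] with ρ hρ
      change inner ℝ (deriv (u.1 + v.1) ρ) _ = _
      rw [hρ, inner_add_left]
    rw [e1, e2]
    ring
  smul_left u v r := by
    have e1 : ∫ ρ, inner ℝ ((r • u : FESpace d Q).1 ρ) (v.1 ρ) ∂muI =
        r * ∫ ρ, inner ℝ (u.1 ρ) (v.1 ρ) ∂muI := by
      rw [← integral_const_mul]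
      exact integral_congr_ae (Filter.Eventually.of_forall fun ρ => real_inner_smul_left _ _ _)
    have e2 : ∫ ρ, inner ℝ (deriv (r • u : FESpace d Q).1 ρ) (deriv v.1 ρ) ∂muI =
        r * ∫ ρ, inner ℝ (deriv u.1 ρ) (deriv v.1 ρ) ∂muI := by
      rw [← integral_const_mul]
      refine integral_congr_ae (Filter.Eventually.of_forall fun ρ => ?_)
      change inner ℝ (deriv (r • u.1) ρ) _ = _
      rw [IsFE.deriv_smul, real_inner_smul_left]
    rw [e1, e2]
    simp only [conj_trivial]
    ring
  definite u h := by
    have hu : IsFE Q u.1 := u.2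
    simp only [real_inner_self_eq_norm_sq] at h
    have n1 : 0 ≤ ∫ ρ, ‖u.1 ρ‖ ^ 2 ∂muI := integral_nonneg fun _ => by positivity
    have n2 : 0 ≤ ∫ ρ, ‖deriv u.1 ρ‖ ^ 2 ∂muI := integral_nonneg fun _ => by positivity
    have h0 := continuous_eq_zero_of_integral hu.continuous (by linarith)
    exact Subtype.ext (eq_of_periodic hu.periodic (fun _ => rfl) h0)

theorem h1Core_inner_self (u : FESpace d Q) : (h1Core d Q).inner u u =
    (∫ ρ, ‖u.1 ρ‖ ^ 2 ∂muI) + ∫ ρ, ‖deriv u.1 ρ‖ ^ 2 ∂muI := by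
  change (∫ ρ, inner ℝ (u.1 ρ) (u.1 ρ) ∂muI) + ∫ ρ, inner ℝ (deriv u.1 ρ) (deriv u.1 ρ) ∂muI = _
  simp only [real_inner_self_eq_norm_sq]

/-- Finite element functions belong to `H^1`. -/
theorem IsFE.exists_H1 (h : IsFE Q χ) :
    ∃ η : H1 d, η.1 0 =ᵐ[muI] χ ∧ η.1 1 =ᵐ[muI] deriv χ := by
  have m0 : MemLp χ 2 muI := MemLp.mono_exponent h.bdd (by simp)
  have m1 : MemLp (deriv χ) 2 muI := MemLp.mono_exponent h.bdd_deriv (by simp)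
  refine ⟨⟨![m0.toLp χ, m1.toLp (deriv χ)], fun i ψ hψ hper => ?_⟩, m0.coeFn_toLp, m1.coeFn_toLp⟩
  obtain rfl : i = 0 := Subsingleton.elim _ _
  rw [intervalIntegral.integral_of_le zero_le_one, intervalIntegral.integral_of_le zero_le_one]
  have e0 : ∫ ρ, deriv ψ ρ • (m0.toLp χ) ρ ∂muI = ∫ ρ, deriv ψ ρ • χ ρ ∂muI :=
    integral_congr_ae (by filter_upwards [m0.coeFn_toLp] with ρ hρ; rw [hρ])
  have e1 : ∫ ρ, ψ ρ • (m1.toLp (deriv χ)) ρ ∂muI = ∫ ρ, ψ ρ • deriv χ ρ ∂muI :=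
    integral_congr_ae (by filter_upwards [m1.coeFn_toLp] with ρ hρ; rw [hρ])
  change ∫ ρ, deriv ψ ρ • (m0.toLp χ) ρ ∂muI = -∫ ρ, ψ ρ • (m1.toLp (deriv χ)) ρ ∂muI
  rw [e0, e1]
  have b0 : Bdd (fun ρ => deriv ψ ρ • χ ρ) :=
    (Bdd.of_continuous (hψ.continuous_deriv (by simp))).smul h.bdd
  have b1 : Bdd (fun ρ => ψ ρ • deriv χ ρ) := (Bdd.of_continuous hψ.continuous).smul h.bdd_deriv
  rw [eq_neg_iff_add_eq_zero, ← integral_add b0.integrable b1.integrable]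
  have hint : IntervalIntegrable (fun ρ => deriv ψ ρ • χ ρ + ψ ρ • deriv χ ρ) volume 0 1 := by
    rw [intervalIntegrable_iff_integrableOn_Ioc_of_le zero_le_one]
    exact (b0.add b1).integrable
  -- The product is continuous and differentiable off the finitely many nodes, so the fundamental
  -- theorem applies; the boundary values cancel by periodicity.
  have key := MeasureTheory.integral_eq_of_hasDerivAt_off_countable_of_le (fun ρ => ψ ρ • χ ρ)
    (fun ρ => deriv ψ ρ • χ ρ + ψ ρ • deriv χ ρ) zero_le_one (s := range Q.q)
    (finite_range Q.q).countable (hψ.continuous.smul h.continuous).continuousOn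
    (fun ρ hρ => by
      obtain ⟨j, hj⟩ := Q.exists_mem_Ioc (Ioo_subset_Ioc_self hρ.1)
      have hj' : ρ ∈ Ioo (Q.lt j) (Q.rt j) :=
        ⟨hj.1, lt_of_le_of_ne hj.2 fun h => hρ.2 ⟨_, h.symm⟩⟩
      have d1 := h.hasDerivAt j hj'
      have d2 : HasDerivAt ψ (deriv ψ ρ) ρ :=
        ((hψ.differentiable (by simp)) ρ).hasDerivAt
      rw [d1.deriv]
      rw [add_comm]
      exact d2.smul d1) hint
  rw [intervalIntegral.integral_of_le zero_le_one] at key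
  rw [key]
  have p1 := hper 0
  have p2 := h.periodic 0
  rw [zero_add] at p1 p2
  rw [p1, p2, sub_self]

/-! ### Interpolation -/

/-- Continuous piecewise affine function on `[0, 1]` with given values at the nodes. -/
def Mesh.interpAux (Q : Mesh J) (f : ℝ → E d) (σ : ℝ) : E d :=
  f 0 + ∑ j, max 0 (min 1 ((σ - Q.lt j) / Q.len j)) • (f (Q.rt j) - f (Q.lt j))

/-- The nodal interpolant of a periodic function. -/
def Mesh.interp (Q : Mesh J) (f : ℝ → E d) (ρ : ℝ) : E d := Q.interpAux f (Int.fract ρ)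

/-- On one element every other summand has its clamp fixed at `0` or at `1`, so only the summand of
that element varies. -/
theorem Mesh.interpAux_sub (Q : Mesh J) (f : ℝ → E d) (k : Fin J) {σ : ℝ}
    (hσ : σ ∈ Icc (Q.lt k) (Q.rt k)) :
    Q.interpAux f σ - Q.interpAux f (Q.lt k) = (σ - Q.lt k) • Q.slope f k := by
  rw [interpAux, interpAux, add_sub_add_left_eq_sub, ← Finset.sum_sub_distrib,
    Finset.sum_eq_single k]
  · have hl := Q.len_pos k
    have h1 : (σ - Q.lt k) / Q.len k ≤ 1 := by
      rw [div_le_one hl]; exact sub_le_sub_right hσ.2 _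
    have h0 : 0 ≤ (σ - Q.lt k) / Q.len k := div_nonneg (sub_nonneg.mpr hσ.1) hl.le
    rw [min_eq_right h1, max_eq_right h0, sub_self, zero_div, min_eq_right zero_le_one, max_self,
      zero_smul, sub_zero, slope, smul_smul, div_eq_mul_inv]
  · intro j _ hjk
    have hl := Q.len_pos j
    rw [← sub_smul]
    rcases lt_or_gt_of_ne hjk with hlt | hgt
    · have hle : Q.rt j ≤ Q.lt k := Q.strictMono.monotone (by
        rw [Fin.le_def]; simpa using hlt)
      have h1 : ∀ τ, Q.lt k ≤ τ → 1 ≤ (τ - Q.lt j) / Q.len j := fun τ hτ => by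
        rw [one_le_div hl]; exact sub_le_sub_right (hle.trans hτ) _
      rw [min_eq_left (h1 σ hσ.1), min_eq_left (h1 _ le_rfl), sub_self, zero_smul]
    · have hle : Q.rt k ≤ Q.lt j := Q.strictMono.monotone (by
        rw [Fin.le_def]; simpa using hgt)
      have h1 : ∀ τ, τ ≤ Q.rt k → (τ - Q.lt j) / Q.len j ≤ 0 := fun τ hτ =>
        div_nonpos_of_nonpos_of_nonneg (sub_nonpos.mpr (hτ.trans hle)) hl.le
      rw [max_eq_left ((min_le_right _ _).trans (h1 σ hσ.2)),
        max_eq_left ((min_le_right _ _).trans (h1 _ (Q.lt_lt_rt k).le)), sub_self, zero_smul]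
  · simp

theorem Mesh.interpAux_node (Q : Mesh J) (f : ℝ → E d) (k : Fin (J + 1)) :
    Q.interpAux f (Q.q k) = f (Q.q k) := by
  induction k using Fin.induction with
  | zero =>
    rw [Q.first, interpAux, Finset.sum_eq_zero, add_zero]
    intro j _
    have : (0 - Q.lt j) / Q.len j ≤ 0 :=
      div_nonpos_of_nonpos_of_nonneg (sub_nonpos.mpr (Q.q_mem _).1) (Q.len_pos j).le
    rw [max_eq_left ((min_le_right _ _).trans this), zero_smul]
  | succ i ih =>
    have := Q.interpAux_sub f i (right_mem_Icc.mpr (Q.lt_lt_rt i).le)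
    rw [show Q.rt i - Q.lt i = Q.len i from rfl, len_smul_slope, sub_eq_iff_eq_add, ih] at this
    rw [this]
    abel

theorem Mesh.continuous_interpAux (Q : Mesh J) (f : ℝ → E d) : Continuous (Q.interpAux f) := by
  unfold interpAux
  fun_prop

theorem Mesh.interp_eq (Q : Mesh J) {f : ℝ → E d} (hf : Function.Periodic f 1) {ρ : ℝ}
    (hρ : ρ ∈ Icc (0 : ℝ) 1) : Q.interp f ρ = Q.interpAux f ρ := by
  rcases eq_or_lt_of_le hρ.2 with h1 | h1
  · have e0 := Q.interpAux_node f 0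
    have e1 := Q.interpAux_node f (Fin.last J)
    rw [Q.first] at e0
    rw [Q.last] at e1
    have := hf 0
    rw [zero_add] at this
    rw [h1, interp, Int.fract_one, e0, e1, this]
  · rw [interp, Int.fract_eq_self.mpr ⟨hρ.1, h1⟩]

theorem Mesh.interp_node (Q : Mesh J) {f : ℝ → E d} (hf : Function.Periodic f 1)
    (k : Fin (J + 1)) : Q.interp f (Q.q k) = f (Q.q k) := by
  rw [Q.interp_eq hf (Q.q_mem k), Q.interpAux_node]

theorem Mesh.isFE_interp (Q : Mesh J) {f : ℝ → E d} (hf : Function.Periodic f 1) :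
    IsFE Q (Q.interp f) where
  continuous := by
    -- Continuity across the integers amounts to equal values at `0` and `1`, which periodicity of
    -- `f` supplies.
    refine (Q.continuous_interpAux f).continuousOn.comp_fract'' ?_
    have e0 := Q.interpAux_node f 0
    have e1 := Q.interpAux_node f (Fin.last J)
    rw [Q.first] at e0
    rw [Q.last] at e1
    have := hf 0
    rw [zero_add] at this
    rw [e0, e1, this]
  periodic ρ := by simp [interp, Int.fract_add_one]
  affine j := by
    refine ⟨Q.interpAux f (Q.lt j) - Q.lt j • Q.slope f j, Q.slope f j, fun ρ hρ => ?_⟩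
    rw [Q.interp_eq hf (Q.Icc_subset j hρ)]
    have := Q.interpAux_sub f j hρ
    rw [sub_eq_iff_eq_add] at this
    rw [this, sub_smul]
    abel

/-- Error of the slope of the chord. -/
theorem Mesh.norm_deriv_sub_slope_le (Q : Mesh J) {f : ℝ → E d} {K : ℝ} (hK : 0 ≤ K)
    (hd : ∀ ρ, DifferentiableAt ℝ f ρ) (hl : ∀ ρ ∈ Icc (0 : ℝ) 1, ∀ σ ∈ Icc (0 : ℝ) 1,
      ‖deriv f ρ - deriv f σ‖ ≤ K * |ρ - σ|) (j : Fin J) {ρ : ℝ}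
    (hρ : ρ ∈ Icc (Q.lt j) (Q.rt j)) : ‖deriv f ρ - Q.slope f j‖ ≤ K * Q.len j := by
  -- Subtracting the linear function with slope `f'(ρ)` leaves an increment over the element of `len
  -- • (slope - f'(ρ))`, while its derivative is at most `K * len` there.
  have h1 : ∀ σ ∈ Icc (Q.lt j) (Q.rt j), HasDerivWithinAt (fun σ => f σ - σ • deriv f ρ)
      (deriv f σ - deriv f ρ) (Icc (Q.lt j) (Q.rt j)) σ := fun σ _ => by
    have := (hasDerivAt_id σ).smul_const (deriv f ρ)
    simp only [one_smul, id] at this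
    exact ((hd σ).hasDerivAt.sub this).hasDerivWithinAt
  have h2 : ∀ σ ∈ Icc (Q.lt j) (Q.rt j), ‖deriv f σ - deriv f ρ‖ ≤ K * Q.len j := by
    intro σ hσ
    refine (hl σ (Q.Icc_subset j hσ) ρ (Q.Icc_subset j hρ)).trans ?_
    gcongr
    rw [abs_le, Mesh.len]
    constructor <;> linarith [hσ.1, hσ.2, hρ.1, hρ.2]
  have h3 := (convex_Icc (Q.lt j) (Q.rt j)).norm_image_sub_le_of_norm_hasDerivWithin_le h1 h2
    (left_mem_Icc.mpr (Q.lt_lt_rt j).le) (right_mem_Icc.mpr (Q.lt_lt_rt j).le)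
  have e : (f (Q.rt j) - Q.rt j • deriv f ρ) - (f (Q.lt j) - Q.lt j • deriv f ρ) =
      Q.len j • (Q.slope f j - deriv f ρ) := by
    rw [smul_sub, len_smul_slope, Mesh.len, sub_smul]
    abel
  rw [e, norm_smul, Real.norm_of_nonneg (Q.len_pos j).le,
    show Q.rt j - Q.lt j = Q.len j from rfl, Real.norm_of_nonneg (Q.len_pos j).le,
    mul_comm (Q.len j)] at h3
  rw [norm_sub_rev]
  exact le_of_mul_le_mul_right h3 (Q.len_pos j)

/-- Error of linear interpolation. -/
theorem IsFE.norm_sub_le (h : IsFE Q χ) {f : ℝ → E d} (hn : ∀ k, χ (Q.q k) = f (Q.q k)) {K : ℝ}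
    (hK : 0 ≤ K) (hd : ∀ ρ, DifferentiableAt ℝ f ρ)
    (hl : ∀ ρ ∈ Icc (0 : ℝ) 1, ∀ σ ∈ Icc (0 : ℝ) 1, ‖deriv f ρ - deriv f σ‖ ≤ K * |ρ - σ|)
    (j : Fin J) {ρ : ℝ} (hρ : ρ ∈ Icc (Q.lt j) (Q.rt j)) : ‖f ρ - χ ρ‖ ≤ K * Q.len j ^ 2 := by
  have hs : Q.slope χ j = Q.slope f j := by rw [Mesh.slope, Mesh.slope, hn, hn]
  have h1 : ∀ σ ∈ Icc (Q.lt j) (Q.rt j), HasDerivWithinAt (fun σ => f σ - σ • Q.slope f j)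
      (deriv f σ - Q.slope f j) (Icc (Q.lt j) (Q.rt j)) σ := fun σ _ => by
    have := (hasDerivAt_id σ).smul_const (Q.slope f j)
    simp only [one_smul, id] at this
    exact ((hd σ).hasDerivAt.sub this).hasDerivWithinAt
  have h2 := (convex_Icc (Q.lt j) (Q.rt j)).norm_image_sub_le_of_norm_hasDerivWithin_le h1
    (fun σ hσ => Q.norm_deriv_sub_slope_le hK hd hl j hσ)
    (left_mem_Icc.mpr (Q.lt_lt_rt j).le) hρ
  have e : (f ρ - ρ • Q.slope f j) - (f (Q.lt j) - Q.lt j • Q.slope f j) = f ρ - χ ρ := by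
    rw [h.eq_on j hρ, hn, hs, sub_smul]
    abel
  rw [e] at h2
  refine h2.trans ?_
  rw [sq, ← mul_assoc]
  have := Q.len_pos j
  gcongr
  rw [Real.norm_of_nonneg (sub_nonneg.mpr hρ.1), Mesh.len]
  exact sub_le_sub_right hρ.2 _

end FE

/-! ### Consistency -/

section Consistency

theorem Bdd.comp_lipschitz {F F' : Type*} [NormedAddCommGroup F] [NormedAddCommGroup F']
    {f : F → F'} {K : ℝ} (hf : ∀ p q, ‖f p - f q‖ ≤ K * ‖p - q‖) {g : ℝ → F} (hg : Bdd g) :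
    Bdd (fun ρ => f (g ρ)) := by
  have hK : LipschitzWith (Real.toNNReal K) f := LipschitzWith.of_dist_le_mul fun p q => by
    rw [dist_eq_norm, dist_eq_norm]
    exact (hf p q).trans (by gcongr; exact Real.le_coe_toNNReal K)
  obtain ⟨B, hB0, hB⟩ := hg.exists_bound
  refine .of_bound (hK.continuous.comp_aestronglyMeasurable hg.1)
    (K := ‖f 0‖ + (Real.toNNReal K) * B) ?_
  filter_upwards [hB] with ρ hρ
  have h1 := hK.dist_le_mul (g ρ) 0
  rw [dist_eq_norm, dist_zero_right] at h1
  have h2 : ‖f (g ρ)‖ ≤ ‖f 0‖ + ‖f (g ρ) - f 0‖ := by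
    simpa using norm_add_le (f 0) (f (g ρ) - f 0)
  refine h2.trans ?_
  gcongr
  exact h1.trans (by gcongr)

section TaylorBound

variable {G F : Type*} [NormedAddCommGroup G] [NormedSpace ℝ G] [NormedAddCommGroup F]
  [NormedSpace ℝ F] {f : G → F} {K : ℝ}

theorem TaylorBound.bdd_comp (h : TaylorBound f K) {g : ℝ → G} (hg : Bdd g) :
    Bdd (fun ρ => f (g ρ)) := .comp_lipschitz h.lipschitz hg

theorem TaylorBound.bdd_fderiv_comp (h : TaylorBound f K) {g : ℝ → G} (hg : Bdd g) :
    Bdd (fun ρ => fderiv ℝ f (g ρ)) := .comp_lipschitz h.fderiv_lipschitz hg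

theorem TaylorBound.bdd_rem (h : TaylorBound f K) {g k : ℝ → G} (hg : Bdd g) (hk : Bdd k) :
    Bdd (fun ρ => taylorRem f (g ρ) (k ρ)) :=
  ((h.bdd_comp (hg.add hk)).sub (h.bdd_comp hg)).sub ((h.bdd_fderiv_comp hg).clm_apply hk)

theorem TaylorBound.mono (h : TaylorBound f K) {K' : ℝ} (hK : K ≤ K') : TaylorBound f K' where
  differentiable := h.differentiable
  nonneg := h.nonneg.trans hK
  norm_le p := (h.norm_le p).trans hK
  fderiv_le p := (h.fderiv_le p).trans hK
  lipschitz p q := (h.lipschitz p q).trans (by gcongr)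
  fderiv_lipschitz p q := (h.fderiv_lipschitz p q).trans (by gcongr)
  rem_le p ξ := (h.rem_le p ξ).trans (by gcongr)
  rem_sub_le p ξ ξ' := (h.rem_sub_le p ξ ξ').trans (by gcongr)
  rem_base_sub_le p p' ξ := (h.rem_base_sub_le p p' ξ).trans (by gcongr)

end TaylorBound

variable {d : ℕ}

/-- The part of the consistency error that is tested with `η_ρ`. -/
def consF (Ψ : E d → E d) (Hh : E d → E d →L[ℝ] E d) (x y v : ℝ → E d) (ρ : ℝ) : E d :=
  fderiv ℝ Hh (deriv y ρ) (x ρ - y ρ) (v ρ) - taylorRem Ψ (deriv y ρ) (deriv x ρ - deriv y ρ)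

/-- The part of the consistency error that is tested with `η`. -/
def consR (Hh : E d → E d →L[ℝ] E d) (x y₀ y v w : ℝ → E d) (ρ : ℝ) : E d :=
  (Hh (deriv y₀ ρ) - Hh (deriv y ρ)) (v ρ) + Hh (deriv x ρ) (v ρ - w ρ) -
    taylorRem Hh (deriv y ρ) (deriv x ρ - deriv y ρ) (v ρ) +
    fderiv ℝ Hh (deriv y ρ) (x ρ - y ρ) (deriv v ρ)

variable {J : ℕ} {Q : Mesh J} {Ψ : E d → E d} {Hh : E d → E d →L[ℝ] E d} {K : ℝ}
  {x y₀ y v w η : ℝ → E d}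

theorem bdd_consF (hΨ : TaylorBound Ψ K) (hH : TaylorBound Hh K) (hx : Bdd x)
    (hx' : Bdd (deriv x)) (hy : IsFE Q y) (hv : IsFE Q v) : Bdd (consF Ψ Hh x y v) :=
  (((hH.bdd_fderiv_comp hy.bdd_deriv).clm_apply (hx.sub hy.bdd)).clm_apply hv.bdd).sub
    (hΨ.bdd_rem hy.bdd_deriv (hx'.sub hy.bdd_deriv))

theorem bdd_consR (hH : TaylorBound Hh K) (hx : Bdd x)
    (hx' : Bdd (deriv x)) (hy₀ : IsFE Q y₀) (hy : IsFE Q y) (hv : IsFE Q v) (hw : Bdd w) :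
    Bdd (consR Hh x y₀ y v w) :=
  (((((hH.bdd_comp hy₀.bdd_deriv).sub (hH.bdd_comp hy.bdd_deriv)).clm_apply hv.bdd).add
    ((hH.bdd_comp hx').clm_apply (hv.bdd.sub hw))).sub
    ((hH.bdd_rem hy.bdd_deriv (hx'.sub hy.bdd_deriv)).clm_apply hv.bdd)).add
    (((hH.bdd_fderiv_comp hy.bdd_deriv).clm_apply (hx.sub hy.bdd)).clm_apply hv.bdd_deriv)

/-- Orthogonality of the derivative of the interpolation error to piecewise constants. -/
theorem integral_interp_error_eq_zero (hΨ : TaylorBound Ψ K) (hxd : ∀ ρ, DifferentiableAt ℝ x ρ)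
    (hx' : Bdd (deriv x)) (hy : IsFE Q y) (hn : ∀ k, y (Q.q k) = x (Q.q k)) (hη : IsFE Q η) :
    ∫ ρ, inner ℝ (fderiv ℝ Ψ (deriv y ρ) (deriv x ρ - deriv y ρ)) (deriv η ρ) ∂muI = 0 := by
  refine Q.integral_eq_zero_of_elementwise (((hΨ.bdd_fderiv_comp hy.bdd_deriv).clm_apply
    (hx'.sub hy.bdd_deriv)).inner hη.bdd_deriv) fun j => ?_
  have hxc : Continuous x := continuous_iff_continuousAt.mpr fun ρ => (hxd ρ).continuousAt
  refine ⟨fun ρ => inner ℝ (fderiv ℝ Ψ (Q.slope y j) (x ρ - y ρ)) (Q.slope η j), ?_, ?_, ?_, ?_⟩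
  · exact ((((fderiv ℝ Ψ (Q.slope y j)).continuous.comp (hxc.sub hy.continuous)).inner
      continuous_const)).continuousOn
  · simp only [hn, sub_self, map_zero, inner_zero_left]
  · simp only [hn, sub_self, map_zero, inner_zero_left]
  · intro ρ hρ
    rw [hy.deriv_eq j hρ, hη.deriv_eq j hρ]
    have h1 := (fderiv ℝ Ψ (Q.slope y j)).hasFDerivAt.comp_hasDerivAt ρ
      ((hxd ρ).hasDerivAt.sub (hy.hasDerivAt j hρ))
    simpa [Function.comp_def] using h1.inner ℝ (hasDerivAt_const ρ (Q.slope η j))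

/-- Removes the first order part of `H(x_ρ) - H(y_ρ)`. As `y_ρ` is constant on an element, the
integrand is there the derivative of `DH(y_ρ)(x - y) v · η`, which vanishes at the nodes. The factor
`(x - y)_ρ = O(h)` is thus traded for `x - y = O(h²)`, at the price of one term with `η_ρ`, which
goes into `consF`. -/
theorem integral_interp_error_parts (hH : TaylorBound Hh K) (hxd : ∀ ρ, DifferentiableAt ℝ x ρ)
    (hx' : Bdd (deriv x)) (hy : IsFE Q y) (hn : ∀ k, y (Q.q k) = x (Q.q k)) (hv : IsFE Q v)
    (hη : IsFE Q η) :
    ∫ ρ, (inner ℝ (fderiv ℝ Hh (deriv y ρ) (deriv x ρ - deriv y ρ) (v ρ)) (η ρ) +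
      inner ℝ (fderiv ℝ Hh (deriv y ρ) (x ρ - y ρ) (deriv v ρ)) (η ρ) +
      inner ℝ (fderiv ℝ Hh (deriv y ρ) (x ρ - y ρ) (v ρ)) (deriv η ρ)) ∂muI = 0 := by
  have hxc : Continuous x := continuous_iff_continuousAt.mpr fun ρ => (hxd ρ).continuousAt
  have hx : Bdd x := .of_continuous hxc
  have hD := hH.bdd_fderiv_comp hy.bdd_deriv
  refine Q.integral_eq_zero_of_elementwise
    (((((hD.clm_apply (hx'.sub hy.bdd_deriv)).clm_apply hv.bdd).inner hη.bdd).add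
    (((hD.clm_apply (hx.sub hy.bdd)).clm_apply hv.bdd_deriv).inner hη.bdd)).add
    (((hD.clm_apply (hx.sub hy.bdd)).clm_apply hv.bdd).inner hη.bdd_deriv)) fun j => ?_
  refine ⟨fun ρ => inner ℝ (fderiv ℝ Hh (Q.slope y j) (x ρ - y ρ) (v ρ)) (η ρ), ?_, ?_, ?_, ?_⟩
  · exact ((((fderiv ℝ Hh (Q.slope y j)).continuous.comp (hxc.sub hy.continuous)).clm_apply
      hv.continuous).inner hη.continuous).continuousOn
  · simp only [hn, sub_self, map_zero, zero_apply, inner_zero_left]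
  · simp only [hn, sub_self, map_zero, zero_apply, inner_zero_left]
  · intro ρ hρ
    rw [hy.deriv_eq j hρ, hη.deriv_eq j hρ, hv.deriv_eq j hρ]
    have h1 := (fderiv ℝ Hh (Q.slope y j)).hasFDerivAt.comp_hasDerivAt ρ
      ((hxd ρ).hasDerivAt.sub (hy.hasDerivAt j hρ))
    have h2 := (h1.clm_apply (hv.hasDerivAt j hρ)).inner ℝ (hη.hasDerivAt j hρ)
    simp only [Function.comp_def] at h2
    refine h2.congr_deriv ?_
    rw [inner_add_left]
    simp only [Pi.sub_apply]
    ring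

/-- The interpolant of a solution solves the discrete equation up to the consistency error. -/
theorem consistency (hΨ : TaylorBound Ψ K) (hH : TaylorBound Hh K)
    (hxd : ∀ ρ, DifferentiableAt ℝ x ρ) (hx' : Bdd (deriv x)) (hy₀ : IsFE Q y₀) (hy : IsFE Q y)
    (hn : ∀ k, y (Q.q k) = x (Q.q k)) (hv : IsFE Q v) (hw : Bdd w) (hη : IsFE Q η)
    (hsol : (∫ ρ, inner ℝ (Hh (deriv x ρ) (w ρ)) (η ρ) ∂muI) +
      ∫ ρ, inner ℝ (Ψ (deriv x ρ)) (deriv η ρ) ∂muI = 0) :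
    (∫ ρ, inner ℝ (Hh (deriv y₀ ρ) (v ρ)) (η ρ) ∂muI) +
      ∫ ρ, inner ℝ (Ψ (deriv y ρ)) (deriv η ρ) ∂muI =
    (∫ ρ, inner ℝ (consR Hh x y₀ y v w ρ) (η ρ) ∂muI) +
      ∫ ρ, inner ℝ (consF Ψ Hh x y v ρ) (deriv η ρ) ∂muI := by
  have hxc : Continuous x := continuous_iff_continuousAt.mpr fun ρ => (hxd ρ).continuousAt
  have hx : Bdd x := .of_continuous hxc
  have hD := hH.bdd_fderiv_comp hy.bdd_deriv
  have o1 := integral_interp_error_eq_zero hΨ hxd hx' hy hn hη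
  have o2 := integral_interp_error_parts hH hxd hx' hy hn hv hη
  have b1 := ((hH.bdd_comp hx').clm_apply hw).inner hη.bdd
  have b2 := (hΨ.bdd_comp hx').inner hη.bdd_deriv
  have b3 := ((hH.bdd_comp hy₀.bdd_deriv).clm_apply hv.bdd).inner hη.bdd
  have b4 := (hΨ.bdd_comp hy.bdd_deriv).inner hη.bdd_deriv
  have b5 := (bdd_consR hH hx hx' hy₀ hy hv hw).inner hη.bdd
  have b6 := (bdd_consF hΨ hH hx hx' hy hv).inner hη.bdd_deriv
  have b7 := ((hΨ.bdd_fderiv_comp hy.bdd_deriv).clm_apply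
    (hx'.sub hy.bdd_deriv)).inner hη.bdd_deriv
  have b8 := ((((hD.clm_apply (hx'.sub hy.bdd_deriv)).clm_apply hv.bdd).inner hη.bdd).add
    (((hD.clm_apply (hx.sub hy.bdd)).clm_apply hv.bdd_deriv).inner hη.bdd)).add
    (((hD.clm_apply (hx.sub hy.bdd)).clm_apply hv.bdd).inner hη.bdd_deriv)
  -- A pointwise identity. The second group on the left has zero integral by `o1` and `o2`; adding
  -- it cancels the linear Taylor terms, so that only remainders and `x - y` itself stay on the
  -- right.
  have key : ∀ ρ, (inner ℝ (Hh (deriv y₀ ρ) (v ρ)) (η ρ) + inner ℝ (Ψ (deriv y ρ)) (deriv η ρ)) +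
      (inner ℝ (fderiv ℝ Ψ (deriv y ρ) (deriv x ρ - deriv y ρ)) (deriv η ρ) +
      (inner ℝ (fderiv ℝ Hh (deriv y ρ) (deriv x ρ - deriv y ρ) (v ρ)) (η ρ) +
      inner ℝ (fderiv ℝ Hh (deriv y ρ) (x ρ - y ρ) (deriv v ρ)) (η ρ) +
      inner ℝ (fderiv ℝ Hh (deriv y ρ) (x ρ - y ρ) (v ρ)) (deriv η ρ))) =
      (inner ℝ (Hh (deriv x ρ) (w ρ)) (η ρ) + inner ℝ (Ψ (deriv x ρ)) (deriv η ρ)) +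
      (inner ℝ (consR Hh x y₀ y v w ρ) (η ρ) + inner ℝ (consF Ψ Hh x y v ρ) (deriv η ρ)) := by
    intro ρ
    simp only [consR, consF, taylorRem, add_sub_cancel, sub_apply, map_sub, inner_add_left,
      inner_sub_left]
    ring
  have hint := integral_congr_ae (μ := muI) (Filter.Eventually.of_forall key)
  rw [integral_add (b3.add b4).integrable (b7.add b8).integrable,
    integral_add b3.integrable b4.integrable, integral_add b7.integrable b8.integrable, o1, o2,
    integral_add (b1.add b2).integrable (b5.add b6).integrable,
    integral_add b1.integrable b2.integrable, hsol,
    integral_add b5.integrable b6.integrable] at hint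
  linarith

theorem norm_clm_apply₂_le {F G H : Type*} [NormedAddCommGroup F] [NormedSpace ℝ F]
    [NormedAddCommGroup G] [NormedSpace ℝ G] [NormedAddCommGroup H] [NormedSpace ℝ H]
    (A : F →L[ℝ] G →L[ℝ] H) {a : F} {b : G} {α β γ : ℝ} (hA : ‖A‖ ≤ α) (ha : ‖a‖ ≤ β)
    (hb : ‖b‖ ≤ γ) : ‖A a b‖ ≤ α * β * γ := by
  have h0 : 0 ≤ α := le_trans (norm_nonneg A) hA
  have h1 : 0 ≤ β := (norm_nonneg _).trans ha
  refine ((A a).le_opNorm b).trans ?_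
  gcongr
  exact (A.le_opNorm a).trans (by gcongr)

theorem norm_clm_apply_le {F G : Type*} [NormedAddCommGroup F] [NormedSpace ℝ F]
    [NormedAddCommGroup G] [NormedSpace ℝ G] (A : F →L[ℝ] G) {a : F} {α β : ℝ} (hA : ‖A‖ ≤ α)
    (ha : ‖a‖ ≤ β) : ‖A a‖ ≤ α * β := by
  have h0 : 0 ≤ α := le_trans (norm_nonneg A) hA
  exact (A.le_opNorm a).trans (by gcongr)

theorem norm_consF_le (hΨ : TaylorBound Ψ K) (hH : TaylorBound Hh K) {L h : ℝ} {ρ : ℝ}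
    (hz : ‖x ρ - y ρ‖ ≤ L * h ^ 2) (hξ : ‖deriv x ρ - deriv y ρ‖ ≤ L * h) (hv : ‖v ρ‖ ≤ L) :
    ‖consF Ψ Hh x y v ρ‖ ≤ 2 * K * L ^ 2 * h ^ 2 := by
  have hK := hΨ.nonneg
  have h1 := norm_clm_apply₂_le (fderiv ℝ Hh (deriv y ρ)) (hH.fderiv_le _) hz hv
  have h2 := hΨ.rem_le (deriv y ρ) (deriv x ρ - deriv y ρ)
  have h3 : ‖deriv x ρ - deriv y ρ‖ ^ 2 ≤ (L * h) ^ 2 := by gcongr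
  have h4 := mul_le_mul_of_nonneg_left h3 hK
  refine (norm_sub_le _ _).trans ?_
  calc _ ≤ K * (L * h ^ 2) * L + K * (L * h) ^ 2 := add_le_add h1 (h2.trans h4)
    _ = _ := by ring

/-- The extra factor `τ` is what makes summation by parts in time affordable. Changing one
ingredient at a time gives five differences, contributing `K` times `L³`, `L²`, `2 L²`, `L³` and `2
L²`. -/
theorem norm_consF_sub_le (hΨ : TaylorBound Ψ K) (hH : TaylorBound Hh K) {L h τ : ℝ}
    {x' y' v' : ℝ → E d} {ρ : ℝ} (hL : 0 ≤ L) (hh : 0 ≤ h) (hτ : 0 ≤ τ)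
    (hz : ‖x ρ - y ρ‖ ≤ L * h ^ 2) (hz' : ‖x' ρ - y' ρ‖ ≤ L * h ^ 2)
    (hξ : ‖deriv x ρ - deriv y ρ‖ ≤ L * h) (hξ' : ‖deriv x' ρ - deriv y' ρ‖ ≤ L * h)
    (hv : ‖v ρ‖ ≤ L) (hvd : ‖v ρ - v' ρ‖ ≤ 2 * L * τ)
    (hp : ‖deriv y ρ - deriv y' ρ‖ ≤ L * τ)
    (hzd : ‖(x ρ - y ρ) - (x' ρ - y' ρ)‖ ≤ L * τ * h ^ 2)
    (hξd : ‖(deriv x ρ - deriv y ρ) - (deriv x' ρ - deriv y' ρ)‖ ≤ L * τ * h) :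
    ‖consF Ψ Hh x y v ρ - consF Ψ Hh x' y' v' ρ‖ ≤ K * (2 * L ^ 3 + 5 * L ^ 2) * h ^ 2 * τ := by
  have hK := hΨ.nonneg
  set D := fderiv ℝ Hh (deriv y ρ)
  set D' := fderiv ℝ Hh (deriv y' ρ)
  have hDd : ‖D - D'‖ ≤ K * (L * τ) := (hH.fderiv_lipschitz _ _).trans (by gcongr)
  have a1 := norm_clm_apply₂_le (D - D') hDd hz hv
  have a2 := norm_clm_apply₂_le D' (hH.fderiv_le _) hzd hv
  have a3 := norm_clm_apply₂_le D' (hH.fderiv_le _) hz' hvd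
  have a4 := hΨ.rem_base_sub_le (deriv y ρ) (deriv y' ρ) (deriv x ρ - deriv y ρ)
  have a5 := hΨ.rem_sub_le (deriv y' ρ) (deriv x ρ - deriv y ρ) (deriv x' ρ - deriv y' ρ)
  have a4' : K * ‖deriv y ρ - deriv y' ρ‖ * ‖deriv x ρ - deriv y ρ‖ ^ 2 ≤
      K * (L * τ) * (L * h) ^ 2 := by gcongr
  have a5' : K * ‖(deriv x ρ - deriv y ρ) - (deriv x' ρ - deriv y' ρ)‖ *
      (‖deriv x ρ - deriv y ρ‖ + ‖deriv x' ρ - deriv y' ρ‖) ≤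
      K * (L * τ * h) * (L * h + L * h) := by gcongr
  have e : consF Ψ Hh x y v ρ - consF Ψ Hh x' y' v' ρ =
      (D - D') (x ρ - y ρ) (v ρ) + D' ((x ρ - y ρ) - (x' ρ - y' ρ)) (v ρ) +
      D' (x' ρ - y' ρ) (v ρ - v' ρ) -
      (taylorRem Ψ (deriv y ρ) (deriv x ρ - deriv y ρ) -
        taylorRem Ψ (deriv y' ρ) (deriv x ρ - deriv y ρ)) -
      (taylorRem Ψ (deriv y' ρ) (deriv x ρ - deriv y ρ) -
        taylorRem Ψ (deriv y' ρ) (deriv x' ρ - deriv y' ρ)) := by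
    simp only [consF, D, D', sub_apply, map_sub]
    abel
  rw [e]
  refine (norm_sub_le_of_le (norm_sub_le_of_le (norm_add_le_of_le (norm_add_le_of_le a1 a2) a3) (a4.trans a4'))
    (a5.trans a5')).trans (le_of_eq ?_)
  ring

theorem norm_consR_le (hH : TaylorBound Hh K) {L h τ : ℝ} {ρ : ℝ} (hL : 0 ≤ L) (hτ : 0 ≤ τ)
    (hz : ‖x ρ - y ρ‖ ≤ L * h ^ 2) (hξ : ‖deriv x ρ - deriv y ρ‖ ≤ L * h) (hv : ‖v ρ‖ ≤ L)
    (hv' : ‖deriv v ρ‖ ≤ L) (hp : ‖deriv y₀ ρ - deriv y ρ‖ ≤ L * τ)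
    (hw : ‖v ρ - w ρ‖ ≤ L * (h ^ 2 + τ)) :
    ‖consR Hh x y₀ y v w ρ‖ ≤ K * (L + 2 * L ^ 2 + L ^ 3) * (h ^ 2 + τ) := by
  have hK := hH.nonneg
  have a1 := norm_clm_apply_le (Hh (deriv y₀ ρ) - Hh (deriv y ρ))
    ((hH.lipschitz _ _).trans (mul_le_mul_of_nonneg_left hp hK)) hv
  have a2 := norm_clm_apply_le (Hh (deriv x ρ)) (hH.norm_le _) hw
  have a3 := norm_clm_apply_le (taylorRem Hh (deriv y ρ) (deriv x ρ - deriv y ρ))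
    ((hH.rem_le _ _).trans (mul_le_mul_of_nonneg_left (pow_le_pow_left₀ (norm_nonneg _) hξ 2) hK))
    hv
  have a4 := norm_clm_apply₂_le (fderiv ℝ Hh (deriv y ρ)) (hH.fderiv_le _) hz hv'
  refine (norm_add_le_of_le (norm_sub_le_of_le (norm_add_le_of_le a1 a2) a3) a4).trans ?_
  have e : K * (L + 2 * L ^ 2 + L ^ 3) * (h ^ 2 + τ) -
      (K * (L * τ) * L + K * (L * (h ^ 2 + τ)) + K * (L * h) ^ 2 * L + K * (L * h ^ 2) * L) =
      K * (L ^ 2 * h ^ 2 + L ^ 2 * τ + L ^ 3 * τ) := by ring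
  have : 0 ≤ K * (L ^ 2 * h ^ 2 + L ^ 2 * τ + L ^ 3 * τ) := by positivity
  linarith

end Consistency

/-! ### The interpolated solution solves a perturbed scheme -/

section Interpolated

variable {d J : ℕ} {Q : Mesh J} {χ f : ℝ → E d}

theorem IsFE.norm_le_of_nodes (h : IsFE Q χ) {B : ℝ} (hB : ∀ k, ‖χ (Q.q k)‖ ≤ B) {ρ : ℝ}
    (hρ : ρ ∈ Ioc (0 : ℝ) 1) : ‖χ ρ‖ ≤ B := by
  obtain ⟨j, hj⟩ := Q.exists_mem_Ioc hρ
  have hl := Q.len_pos j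
  set θ := (ρ - Q.lt j) / Q.len j with hθ
  have h0 : 0 ≤ θ := div_nonneg (sub_nonneg.mpr hj.1.le) hl.le
  have h1 : θ ≤ 1 := (div_le_one hl).mpr (sub_le_sub_right hj.2 _)
  have e : χ ρ = (1 - θ) • χ (Q.lt j) + θ • χ (Q.rt j) := by
    rw [h.eq_on j (Ioc_subset_Icc_self hj), Mesh.slope, smul_smul, ← div_eq_mul_inv, ← hθ,
      sub_smul, one_smul, smul_sub]
    abel
  rw [e]
  refine (norm_add_le _ _).trans ?_
  rw [norm_smul, norm_smul, Real.norm_of_nonneg h0, Real.norm_of_nonneg (sub_nonneg.mpr h1)]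
  calc _ ≤ (1 - θ) * B + θ * B := by
        gcongr
        · exact hB _
        · exact hB _
    _ = B := by ring

theorem IsFE.ae_norm_le_of_nodes (h : IsFE Q χ) {B : ℝ} (hB : ∀ k, ‖χ (Q.q k)‖ ≤ B) :
    ∀ᵐ ρ ∂muI, ‖χ ρ‖ ≤ B :=
  (ae_restrict_mem measurableSet_Ioc).mono fun _ hρ => h.norm_le_of_nodes hB hρ

theorem Mesh.norm_slope_le (Q : Mesh J) {B : ℝ} (hd : ∀ ρ, DifferentiableAt ℝ f ρ)
    (hB : ∀ ρ ∈ Icc (0 : ℝ) 1, ‖deriv f ρ‖ ≤ B) (j : Fin J) : ‖Q.slope f j‖ ≤ B := by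
  have hl := Q.len_pos j
  have h1 := (convex_Icc (Q.lt j) (Q.rt j)).norm_image_sub_le_of_norm_deriv_le
    (fun σ _ => hd σ) (fun σ hσ => hB σ (Q.Icc_subset j hσ))
    (left_mem_Icc.mpr (Q.lt_lt_rt j).le) (right_mem_Icc.mpr (Q.lt_lt_rt j).le)
  rw [← Q.len_smul_slope, norm_smul, Real.norm_of_nonneg hl.le,
    show Q.rt j - Q.lt j = Q.len j from rfl, Real.norm_of_nonneg hl.le, mul_comm] at h1
  exact le_of_mul_le_mul_right h1 hl

theorem IsFE.ae_norm_deriv_le (h : IsFE Q χ) (hn : ∀ k, χ (Q.q k) = f (Q.q k)) {B : ℝ}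
    (hd : ∀ ρ, DifferentiableAt ℝ f ρ) (hB : ∀ ρ ∈ Icc (0 : ℝ) 1, ‖deriv f ρ‖ ≤ B) :
    ∀ᵐ ρ ∂muI, ‖deriv χ ρ‖ ≤ B := by
  filter_upwards [Q.ae_exists_mem_Ioo] with ρ ⟨j, hj⟩
  rw [h.deriv_eq j hj, show Q.slope χ j = Q.slope f j by rw [Mesh.slope, Mesh.slope, hn, hn]]
  exact Q.norm_slope_le hd hB j

theorem IsFE.ae_interp_error (h : IsFE Q χ) (hn : ∀ k, χ (Q.q k) = f (Q.q k)) {K : ℝ}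
    (hK : 0 ≤ K) (hd : ∀ ρ, DifferentiableAt ℝ f ρ)
    (hl : ∀ ρ ∈ Icc (0 : ℝ) 1, ∀ σ ∈ Icc (0 : ℝ) 1, ‖deriv f ρ - deriv f σ‖ ≤ K * |ρ - σ|) :
    ∀ᵐ ρ ∂muI, ‖f ρ - χ ρ‖ ≤ K * Q.size ^ 2 ∧ ‖deriv f ρ - deriv χ ρ‖ ≤ K * Q.size := by
  filter_upwards [Q.ae_exists_mem_Ioo] with ρ ⟨j, hj⟩
  have hle := Q.len_le_size j
  have hl0 := Q.len_pos j
  have hs : Q.slope χ j = Q.slope f j := by rw [Mesh.slope, Mesh.slope, hn, hn]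
  constructor
  · exact (h.norm_sub_le hn hK hd hl j (Ioo_subset_Icc_self hj)).trans (by gcongr)
  · rw [h.deriv_eq j hj, hs]
    exact (Q.norm_deriv_sub_slope_le hK hd hl j (Ioo_subset_Icc_self hj)).trans (by gcongr)

/-- Approximate solutions of the fully discrete scheme. -/
structure ApproxScheme (φ : E d → ℝ) (Hh : E d → E d →L[ℝ] E d) (Q : Mesh J) (M : ℕ)
    (Δ L C a b : ℝ) (y v R F : ℕ → ℝ → E d) : Prop where
  fe : ∀ m ≤ M, IsFE Q (y m)
  range : ∀ m ≤ M, ∀ᵐ ρ ∂muI, a ≤ ‖deriv (y m) ρ‖ ∧ ‖deriv (y m) ρ‖ ≤ b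
  step : ∀ m < M, ∀ᵐ ρ ∂muI, ‖deriv (y (m + 1)) ρ - deriv (y m) ρ‖ ≤ L * Δ
  v_eq : ∀ m < M, v m = Δ⁻¹ • (y (m + 1) - y m)
  v_le : ∀ m < M, ∀ᵐ ρ ∂muI, ‖v m ρ‖ ≤ L
  bddR : ∀ m < M, Bdd (R m)
  bddF : ∀ m < M, Bdd (F m)
  R_le : ∀ m < M, ∀ᵐ ρ ∂muI, ‖R m ρ‖ ≤ C * (Q.size ^ 2 + Δ)
  F_le : ∀ m < M, ∀ᵐ ρ ∂muI, ‖F m ρ‖ ≤ C * Q.size ^ 2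
  -- Truncated subtraction sets `F (0 - 1) = F 0`, so for `m = 0` the difference is zero.
  F_step : ∀ m < M, ∀ᵐ ρ ∂muI, ‖F m ρ - F (m - 1) ρ‖ ≤ C * Q.size ^ 2 * Δ
  eqn : ∀ m < M, ∀ η, IsFE Q η →
    (∫ ρ, inner ℝ (Hh (deriv (y m) ρ) (v m ρ)) (η ρ) ∂muI) +
      ∫ ρ, inner ℝ (gradient (Phi φ) (deriv (y (m + 1)) ρ)) (deriv η ρ) ∂muI =
    (∫ ρ, inner ℝ (R m ρ) (η ρ) ∂muI) + ∫ ρ, inner ℝ (F m ρ) (deriv η ρ) ∂muI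

/-- The standing assumptions of the error analysis, with explicit constants. -/
structure Setup (φ mob : E d → ℝ) (T : ℝ) (x : ℝ → ℝ → E d) (c₀ C₀ L K lam Lam kap : ℝ)
    (P : E d → ℝ) (Ψ : E d → E d) (Hh : E d → E d →L[ℝ] E d) : Prop where
  T_pos : 0 < T
  c₀_pos : 0 < c₀
  c₀_le : c₀ ≤ C₀
  L_pos : 0 < L
  K_pos : 0 < K
  convex : ConvexBounds φ lam Lam
  curve : CurveRegularity T x L
  bounds : ∀ t ∈ Icc 0 T, ∀ ρ, c₀ ≤ ‖deriv (x t) ρ‖ ∧ ‖deriv (x t) ρ‖ ≤ C₀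
  sol : IsWeakSolution φ mob T x
  P_taylor : TaylorBound P K
  Ψ_taylor : TaylorBound Ψ K
  H_taylor : TaylorBound Hh K
  P_eq : ∀ p, c₀ / 8 ≤ ‖p‖ → ‖p‖ ≤ 2 * C₀ → P p = Phi φ p
  P_fderiv : ∀ p, c₀ / 8 < ‖p‖ → ‖p‖ < 2 * C₀ → fderiv ℝ P p = fderiv ℝ (Phi φ) p
  Ψ_eq : ∀ p, c₀ / 8 ≤ ‖p‖ → ‖p‖ ≤ 2 * C₀ → Ψ p = gradient (Phi φ) p
  Ψ_fderiv : ∀ p, c₀ / 8 < ‖p‖ → ‖p‖ < 2 * C₀ → fderiv ℝ Ψ p = hess (Phi φ) p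
  H_eq : ∀ p, c₀ / 8 ≤ ‖p‖ → ‖p‖ ≤ 2 * C₀ → Hh p = Hmat φ mob p
  kap_pos : 0 < kap
  coercive : ∀ p, c₀ / 8 ≤ ‖p‖ → ‖p‖ ≤ 2 * C₀ → ∀ z, kap * ‖z‖ ^ 2 ≤ inner ℝ (Hmat φ mob p z) z

theorem fderiv_eq_of_eq_on_annulus {F : Type*} [NormedAddCommGroup F] [NormedSpace ℝ F]
    {f g : E d → F} {a b : ℝ} (h : ∀ p, a ≤ ‖p‖ → ‖p‖ ≤ b → g p = f p) {p : E d}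
    (ha : a < ‖p‖) (hb : ‖p‖ < b) : fderiv ℝ g p = fderiv ℝ f p := by
  refine Filter.EventuallyEq.fderiv_eq ?_
  have h1 : ∀ᶠ q : E d in nhds p, a < ‖q‖ := continuous_norm.continuousAt.eventually_const_lt ha
  have h2 : ∀ᶠ q : E d in nhds p, ‖q‖ < b := continuous_norm.continuousAt.eventually_lt_const hb
  filter_upwards [h1, h2] with q q1 q2
  exact h q q1.le q2.le

theorem exists_setup {φ mob : E d → ℝ} (hφ : IsAnisotropy φ) (hmob : IsMobility mob) {T : ℝ}
    (hT : 0 < T) {x : ℝ → ℝ → E d} (hreg : HasRegularity T x) {c₀ C₀ : ℝ} (hc₀ : 0 < c₀)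
    (hx : ∀ t ∈ Icc 0 T, ∀ ρ : ℝ, c₀ ≤ ‖deriv (x t) ρ‖ ∧ ‖deriv (x t) ρ‖ ≤ C₀)
    (hsol : IsWeakSolution φ mob T x) :
    ∃ L K lam Lam kap P Ψ Hh, Setup φ mob T x c₀ C₀ L K lam Lam kap P Ψ Hh := by
  have hle : c₀ ≤ C₀ := (hx 0 (left_mem_Icc.mpr hT.le) 0).1.trans
    (hx 0 (left_mem_Icc.mpr hT.le) 0).2
  have ha : 0 < c₀ / 8 := by positivity
  have hab : c₀ / 8 < 2 * C₀ := by linarith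
  -- `deriv` is zero where the derivative does not exist, so the lower bound `c₀` forces
  -- differentiability at every point.
  obtain ⟨L₀, hL⟩ := hreg.exists_curveRegularity hT (fun t ht ρ =>
    differentiableAt_of_deriv_ne_zero fun h => by
      have := (hx t ht ρ).1
      rw [h, norm_zero] at this
      linarith)
  obtain ⟨lam, Lam, hconv⟩ := hφ.exists_convexBounds
  obtain ⟨P, hP, hPs, hPe⟩ := exists_truncation hφ.contDiffOn_Phi ha hab
  obtain ⟨Ψ, hΨ, hΨs, hΨe⟩ := exists_truncation hφ.contDiffOn_gradient_Phi ha hab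
  obtain ⟨Hh, hH, hHs, hHe⟩ := exists_truncation (contDiffOn_Hmat hφ hmob) ha hab
  obtain ⟨K₁, hK₁⟩ := exists_taylorBound (hP.of_le (by norm_cast)) hPs
  obtain ⟨K₂, hK₂⟩ := exists_taylorBound (by exact_mod_cast hΨ) hΨs
  obtain ⟨K₃, hK₃⟩ := exists_taylorBound (by exact_mod_cast hH) hHs
  obtain ⟨kap, hk0, hk⟩ := exists_coercive_Hmat (b := 2 * C₀) hφ hmob ha
  have n1 := hK₁.nonneg
  have n2 := hK₂.nonneg
  have n3 := hK₃.nonneg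
  have n4 := hL.nonneg
  -- Adding one makes both constants positive.
  refine ⟨L₀ + 1, K₁ + K₂ + K₃ + 1, lam, Lam, kap, P, Ψ, Hh, ?_⟩
  have hLl : L₀ ≤ L₀ + 1 := by linarith
  have hcurve : CurveRegularity T x (L₀ + 1) :=
    { nonneg := by positivity
      periodic := hL.periodic
      differentiable := hL.differentiable
      deriv_lip := fun t ht ρ hρ σ hσ => (hL.deriv_lip t ht ρ hρ σ hσ).trans (by gcongr)
      time_lip := fun s hs t ht ρ hρ => (hL.time_lip s hs t ht ρ hρ).trans (by gcongr)
      time_deriv_lip := fun s hs t ht ρ hρ =>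
        (hL.time_deriv_lip s hs t ht ρ hρ).trans (by gcongr)
      mixed_lip := fun s hs t ht ρ hρ σ hσ =>
        (hL.mixed_lip s hs t ht ρ hρ σ hσ).trans (by gcongr)
      velocity := fun t ht => by
        obtain ⟨v, hv, hae⟩ := hL.velocity t ht
        refine ⟨v, hv, ?_⟩
        filter_upwards [hae] with ρ hρ
        exact ⟨hρ.1, fun s hs => (hρ.2 s hs).trans (by gcongr)⟩ }
  exact
    { T_pos := hT
      c₀_pos := hc₀
      c₀_le := hle
      L_pos := by positivity
      K_pos := by positivity
      convex := hconv
      curve := hcurve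
      bounds := hx
      sol := hsol
      P_taylor := hK₁.mono (by linarith)
      Ψ_taylor := hK₂.mono (by linarith)
      H_taylor := hK₃.mono (by linarith)
      P_eq := hPe
      P_fderiv := fun p => fderiv_eq_of_eq_on_annulus hPe
      Ψ_eq := hΨe
      Ψ_fderiv := fun p => fderiv_eq_of_eq_on_annulus hΨe
      H_eq := hHe
      kap_pos := hk0
      coercive := hk }

/-! ### Interpolation of the exact curve in space and differencing in time -/

variable {φ mob : E d → ℝ} {T : ℝ} {x : ℝ → ℝ → E d} {c₀ C₀ L K lam Lam kap : ℝ}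
    {P : E d → ℝ} {Ψ : E d → E d} {Hh : E d → E d →L[ℝ] E d}

theorem Setup.bdd_deriv (S : Setup φ mob T x c₀ C₀ L K lam Lam kap P Ψ Hh) {t : ℝ}
    (ht : t ∈ Icc 0 T) : Bdd (deriv (x t)) :=
  .of_bound (stronglyMeasurable_deriv _).aestronglyMeasurable
    (Filter.Eventually.of_forall fun ρ => (S.bounds t ht ρ).2)

theorem CurveRegularity.isFE_interp (h : CurveRegularity T x L) (Q : Mesh J) {t : ℝ}
    (ht : t ∈ Icc 0 T) : IsFE Q (Q.interp (x t)) := Q.isFE_interp (h.periodic t ht)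

theorem CurveRegularity.interp_node (h : CurveRegularity T x L) (Q : Mesh J) {t : ℝ}
    (ht : t ∈ Icc 0 T) (k : Fin (J + 1)) : Q.interp (x t) (Q.q k) = x t (Q.q k) :=
  Q.interp_node (h.periodic t ht) k

theorem CurveRegularity.ae_interp_error (h : CurveRegularity T x L) (Q : Mesh J) {t : ℝ}
    (ht : t ∈ Icc 0 T) : ∀ᵐ ρ ∂muI, ‖x t ρ - Q.interp (x t) ρ‖ ≤ L * Q.size ^ 2 ∧
      ‖deriv (x t) ρ - deriv (Q.interp (x t)) ρ‖ ≤ L * Q.size :=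
  (h.isFE_interp Q ht).ae_interp_error (h.interp_node Q ht) h.nonneg (h.differentiable t ht)
    (h.deriv_lip t ht)

/-- Interpolation is linear, so this is the interpolation error of the single curve `x t - x s`,
whose derivative has Lipschitz constant `L |t - s|` by the mixed bound. -/
theorem CurveRegularity.ae_interp_error_sub (h : CurveRegularity T x L) (Q : Mesh J) {s t : ℝ}
    (hs : s ∈ Icc 0 T) (ht : t ∈ Icc 0 T) : ∀ᵐ ρ ∂muI,
      ‖(x t ρ - Q.interp (x t) ρ) - (x s ρ - Q.interp (x s) ρ)‖ ≤ L * |t - s| * Q.size ^ 2 ∧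
      ‖(deriv (x t) ρ - deriv (Q.interp (x t)) ρ) - (deriv (x s) ρ - deriv (Q.interp (x s)) ρ)‖ ≤
        L * |t - s| * Q.size ∧
      ‖deriv (Q.interp (x t)) ρ - deriv (Q.interp (x s)) ρ‖ ≤ L * |t - s| := by
  have ft := h.isFE_interp Q ht
  have fs := h.isFE_interp Q hs
  have hd : ∀ ρ, DifferentiableAt ℝ (x t - x s) ρ := fun ρ =>
    (h.differentiable t ht ρ).sub (h.differentiable s hs ρ)
  have hde : ∀ ρ, deriv (x t - x s) ρ = deriv (x t) ρ - deriv (x s) ρ := fun ρ =>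
    deriv_sub (h.differentiable t ht ρ) (h.differentiable s hs ρ)
  have hn : ∀ k, (Q.interp (x t) - Q.interp (x s)) (Q.q k) = (x t - x s) (Q.q k) := fun k => by
    rw [Pi.sub_apply, Pi.sub_apply, h.interp_node Q ht, h.interp_node Q hs]
  have e1 := (ft.sub fs).ae_interp_error hn (K := L * |t - s|)
    (mul_nonneg h.nonneg (abs_nonneg _)) hd (fun ρ hρ σ hσ => by
      rw [hde, hde]; exact h.mixed_lip s hs t ht ρ hρ σ hσ)
  have e2 := (ft.sub fs).ae_norm_deriv_le hn (B := L * |t - s|) hd (fun ρ hρ => by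
    rw [hde]; exact h.time_deriv_lip s hs t ht ρ hρ)
  filter_upwards [e1, e2, ft.ae_deriv_sub fs] with ρ a1 a2 a3
  rw [a3] at a2
  rw [a3, hde, Pi.sub_apply, Pi.sub_apply] at a1
  exact ⟨by rw [sub_sub_sub_comm]; exact a1.1, by rw [sub_sub_sub_comm]; exact a1.2, a2⟩

theorem Setup.ae_range (S : Setup φ mob T x c₀ C₀ L K lam Lam kap P Ψ Hh) (Q : Mesh J)
    (hh : L * Q.size ≤ c₀ / 4) {t : ℝ} (ht : t ∈ Icc 0 T) :
    ∀ᵐ ρ ∂muI, 3 / 4 * c₀ ≤ ‖deriv (Q.interp (x t)) ρ‖ ∧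
      ‖deriv (Q.interp (x t)) ρ‖ ≤ 5 / 4 * C₀ := by
  filter_upwards [S.curve.ae_interp_error Q ht] with ρ hρ
  have h1 := S.bounds t ht ρ
  have h2 := abs_norm_sub_norm_le (deriv (x t) ρ) (deriv (Q.interp (x t)) ρ)
  have h3 := abs_le.mp (h2.trans (hρ.2.trans hh))
  have h4 := S.c₀_le
  exact ⟨by linarith [h3.2], by linarith [h3.1]⟩

/-- Difference quotients of the interpolated solution. -/
theorem CurveRegularity.ae_velocity (h : CurveRegularity T x L) (Q : Mesh J) {s t : ℝ}
    (hs : s ∈ Icc 0 T) (ht : t ∈ Icc 0 T) (hst : s < t) :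
    ∀ᵐ ρ ∂muI, ‖((t - s)⁻¹ • (Q.interp (x t) - Q.interp (x s))) ρ‖ ≤ L ∧
      ‖deriv ((t - s)⁻¹ • (Q.interp (x t) - Q.interp (x s))) ρ‖ ≤ L := by
  have hpos : 0 < t - s := sub_pos.mpr hst
  have ft := h.isFE_interp Q ht
  have fs := h.isFE_interp Q hs
  have e1 : ∀ᵐ ρ ∂muI, ‖(Q.interp (x t) - Q.interp (x s)) ρ‖ ≤ L * (t - s) :=
    (ft.sub fs).ae_norm_le_of_nodes fun k => by
      rw [Pi.sub_apply, h.interp_node Q ht, h.interp_node Q hs]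
      have := h.time_lip s hs t ht _ (Q.q_mem k)
      rwa [abs_of_pos hpos] at this
  filter_upwards [e1, h.ae_interp_error_sub Q hs ht, ft.ae_deriv_sub fs] with ρ a1 a2 a3
  have a4 := a2.2.2
  rw [abs_of_pos hpos] at a4
  rw [Pi.smul_apply, norm_smul, IsFE.deriv_smul, norm_smul, a3, norm_inv,
    Real.norm_of_nonneg hpos.le]
  constructor
  · rw [inv_mul_le_iff₀ hpos, mul_comm]; exact a1
  · rw [inv_mul_le_iff₀ hpos, mul_comm]; exact a4

theorem CurveRegularity.ae_velocity_error (h : CurveRegularity T x L) (Q : Mesh J) {s t : ℝ}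
    (hs : s ∈ Icc 0 T) (ht : t ∈ Icc 0 T) (hst : s < t) {w : ℝ → E d}
    (hw : ∀ᵐ ρ ∂muI, ∀ s ∈ Icc 0 T, ‖x s ρ - x t ρ - (s - t) • w ρ‖ ≤ L * (s - t) ^ 2) :
    ∀ᵐ ρ ∂muI, ‖((t - s)⁻¹ • (Q.interp (x t) - Q.interp (x s))) ρ - w ρ‖ ≤
      L * (Q.size ^ 2 + (t - s)) := by
  have hpos : 0 < t - s := sub_pos.mpr hst
  filter_upwards [hw, h.ae_interp_error_sub Q hs ht] with ρ a1 a2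
  have b1 := a1 s hs
  have b2 := a2.1
  rw [abs_of_pos hpos] at b2
  have e : ((t - s)⁻¹ • (Q.interp (x t) - Q.interp (x s))) ρ - w ρ =
      -((t - s)⁻¹ • (((x t ρ - Q.interp (x t) ρ) - (x s ρ - Q.interp (x s) ρ)) +
        (x s ρ - x t ρ - (s - t) • w ρ))) := by
    have hw' : w ρ = (t - s)⁻¹ • ((t - s) • w ρ) := by
      rw [smul_smul, inv_mul_cancel₀ hpos.ne', one_smul]
    conv_lhs => rw [hw']
    rw [Pi.smul_apply, ← smul_sub, ← smul_neg]
    congr 1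
    rw [← neg_sub t s, neg_smul, Pi.sub_apply]
    abel
  rw [e, norm_neg, norm_smul, norm_inv, Real.norm_of_nonneg hpos.le, inv_mul_le_iff₀ hpos]
  refine (norm_add_le_of_le b2 b1).trans (le_of_eq ?_)
  ring

/-- Expanding forward and backward about the middle time cancels the velocity and leaves two
quadratic remainders. By continuity the resulting bound holds at the nodes, and so for the
interpolants. -/
theorem CurveRegularity.ae_velocity_sub (h : CurveRegularity T x L) (Q : Mesh J) {t τ : ℝ}
    (hτ : 0 < τ) (hs : t - τ ∈ Icc 0 T) (ht : t ∈ Icc 0 T) (hr : t + τ ∈ Icc 0 T) :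
    ∀ᵐ ρ ∂muI, ‖(τ⁻¹ • (Q.interp (x (t + τ)) - Q.interp (x t))) ρ -
      (τ⁻¹ • (Q.interp (x t) - Q.interp (x (t - τ)))) ρ‖ ≤ 2 * L * τ := by
  have hc : ∀ s ∈ Icc 0 T, Continuous (x s) := fun s hs =>
    continuous_iff_continuousAt.mpr fun ρ => (h.differentiable s hs ρ).continuousAt
  have hx : ∀ ρ ∈ Icc (0 : ℝ) 1,
      ‖(x (t + τ) ρ - x t ρ) - (x t ρ - x (t - τ) ρ)‖ ≤ 2 * L * τ * τ := by
    refine le_on_Icc_of_ae_le (((hc _ hr).sub (hc _ ht)).sub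
      ((hc _ ht).sub (hc _ hs))).norm.continuousOn ?_
    obtain ⟨w, -, hw⟩ := h.velocity t ht
    filter_upwards [hw] with ρ hρ
    have b1 := hρ.2 _ hr
    have b2 := hρ.2 _ hs
    rw [add_sub_cancel_left] at b1
    rw [show t - τ - t = -τ by ring, neg_sq] at b2
    have e : (x (t + τ) ρ - x t ρ) - (x t ρ - x (t - τ) ρ) =
        (x (t + τ) ρ - x t ρ - τ • w ρ) + (x (t - τ) ρ - x t ρ - (-τ) • w ρ) := by
      rw [neg_smul]; abel
    simp only [Pi.sub_apply]
    rw [e]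
    refine (norm_add_le_of_le b1 b2).trans (le_of_eq ?_)
    ring
  have f1 := h.isFE_interp Q hr
  have f2 := h.isFE_interp Q ht
  have f3 := h.isFE_interp Q hs
  have hF := ((f1.sub f2).sub (f2.sub f3)).ae_norm_le_of_nodes (B := 2 * L * τ * τ) fun k => by
    simp only [Pi.sub_apply, h.interp_node Q hr, h.interp_node Q ht, h.interp_node Q hs]
    exact hx _ (Q.q_mem k)
  filter_upwards [hF] with ρ hρ
  rw [Pi.smul_apply, Pi.smul_apply, ← smul_sub, norm_smul, norm_inv, Real.norm_of_nonneg hτ.le,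
    inv_mul_le_iff₀ hτ, mul_comm τ]
  exact hρ

theorem Setup.weak_eq (S : Setup φ mob T x c₀ C₀ L K lam Lam kap P Ψ Hh) {t : ℝ}
    (ht : t ∈ Ioc 0 T) {w : ℝ → E d}
    (hw : ∀ᵐ ρ ∂muI, derivWithin (fun s => x s ρ) (Icc 0 T) t = w ρ) {η : ℝ → E d}
    (hη : IsFE Q η) : (∫ ρ, inner ℝ (Hh (deriv (x t) ρ) (w ρ)) (η ρ) ∂muI) +
      ∫ ρ, inner ℝ (Ψ (deriv (x t) ρ)) (deriv η ρ) ∂muI = 0 := by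
  have htI := Ioc_subset_Icc_self ht
  obtain ⟨ζ, h0, h1⟩ := hη.exists_H1
  have h := S.sol t ht ζ
  rw [intervalIntegral.integral_of_le zero_le_one, intervalIntegral.integral_of_le zero_le_one] at h
  have hb : ∀ ρ, c₀ / 8 ≤ ‖deriv (x t) ρ‖ ∧ ‖deriv (x t) ρ‖ ≤ 2 * C₀ := fun ρ => by
    have h1 := S.bounds t htI ρ
    have h2 := S.c₀_pos
    have h3 := S.c₀_le
    exact ⟨by linarith [h1.1], by linarith [h1.2]⟩
  rw [← h]
  congr 1
  · refine integral_congr_ae ?_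
    filter_upwards [h0, hw] with ρ e0 e1
    rw [e0, e1, S.H_eq _ (hb ρ).1 (hb ρ).2]
  · refine integral_congr_ae ?_
    filter_upwards [h1] with ρ e1
    rw [e1, S.Ψ_eq _ (hb ρ).1 (hb ρ).2]

/-- The equation of step `m` is read at the later time `(m + 1) * (T / M)`, which is positive, so
the weak problem is available there; the lag of the matrix, frozen at the earlier level, goes into
`R`. -/
theorem Setup.exists_approxScheme (S : Setup φ mob T x c₀ C₀ L K lam Lam kap P Ψ Hh) :
    ∃ C > 0, ∀ {J : ℕ} (Q : Mesh J), L * Q.size ≤ c₀ / 4 → ∀ (M : ℕ), 0 < M →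
      ∃ v R F, ApproxScheme φ Hh Q M (T / M) L C (3 / 4 * c₀) (5 / 4 * C₀)
        (fun m => Q.interp (x (m * (T / M)))) v R F := by
  have hL := S.L_pos
  have hK := S.K_pos
  -- The sum of the constants of `norm_consF_le`, `norm_consF_sub_le` and `norm_consR_le`.
  refine ⟨2 * K * L ^ 2 + K * (2 * L ^ 3 + 5 * L ^ 2) + K * (L + 2 * L ^ 2 + L ^ 3),
    by positivity, fun {J} Q hh M hM => ?_⟩
  set C := 2 * K * L ^ 2 + K * (2 * L ^ 3 + 5 * L ^ 2) + K * (L + 2 * L ^ 2 + L ^ 3) with hC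
  have hC1 : 2 * K * L ^ 2 ≤ C := by
    have h1 : 0 ≤ K * (2 * L ^ 3 + 5 * L ^ 2) := by positivity
    have h2 : 0 ≤ K * (L + 2 * L ^ 2 + L ^ 3) := by positivity
    linarith
  have hC2 : K * (2 * L ^ 3 + 5 * L ^ 2) ≤ C := by
    have h1 : 0 ≤ 2 * K * L ^ 2 := by positivity
    have h2 : 0 ≤ K * (L + 2 * L ^ 2 + L ^ 3) := by positivity
    linarith
  have hC3 : K * (L + 2 * L ^ 2 + L ^ 3) ≤ C := by
    have h1 : 0 ≤ 2 * K * L ^ 2 := by positivity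
    have h2 : 0 ≤ K * (2 * L ^ 3 + 5 * L ^ 2) := by positivity
    linarith
  have hh0 := Q.size_pos
  have hM0 : (0 : ℝ) < M := by exact_mod_cast hM
  set Δ := T / M with hΔ
  have hΔ0 : 0 < Δ := div_pos S.T_pos hM0
  have hMT : (M : ℝ) * Δ = T := by rw [hΔ]; field_simp
  have hmem : ∀ m : ℕ, m ≤ M → (m : ℝ) * Δ ∈ Icc 0 T := fun m hm => by
    refine ⟨by positivity, ?_⟩
    rw [← hMT]
    gcongr
  have hsucc : ∀ m : ℕ, ((m + 1 : ℕ) : ℝ) * Δ = m * Δ + Δ := fun m => by push_cast; ring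
  have hdt : ∀ m : ℕ, ((m + 1 : ℕ) : ℝ) * Δ - m * Δ = Δ := fun m => by rw [hsucc]; ring
  have hlt : ∀ m : ℕ, (m : ℝ) * Δ < ((m + 1 : ℕ) : ℝ) * Δ := fun m => by rw [hsucc]; linarith
  have hw : ∀ m : ℕ, ∃ w : ℝ → E d, m < M → AEStronglyMeasurable w muI ∧ ∀ᵐ ρ ∂muI,
      derivWithin (fun s => x s ρ) (Icc 0 T) (((m + 1 : ℕ) : ℝ) * Δ) = w ρ ∧
      ∀ s ∈ Icc 0 T, ‖x s ρ - x (((m + 1 : ℕ) : ℝ) * Δ) ρ - (s - ((m + 1 : ℕ) : ℝ) * Δ) • w ρ‖ ≤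
        L * (s - ((m + 1 : ℕ) : ℝ) * Δ) ^ 2 := by
    intro m
    by_cases hm : m < M
    · obtain ⟨w, hw⟩ := S.curve.velocity _ (hmem (m + 1) hm)
      exact ⟨w, fun _ => hw⟩
    · exact ⟨0, fun h => absurd h hm⟩
  choose w hw using hw
  set y : ℕ → ℝ → E d := fun m => Q.interp (x (m * Δ)) with hy
  set v : ℕ → ℝ → E d := fun m => Δ⁻¹ • (y (m + 1) - y m) with hv
  have hyfe : ∀ m ≤ M, IsFE Q (y m) := fun m hm => S.curve.isFE_interp Q (hmem m hm)
  have hvfe : ∀ m < M, IsFE Q (v m) := fun m hm =>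
    ((hyfe (m + 1) hm).sub (hyfe m hm.le)).smul _
  have hvel : ∀ m < M, ∀ᵐ ρ ∂muI, ‖v m ρ‖ ≤ L ∧ ‖deriv (v m) ρ‖ ≤ L := fun m hm => by
    have := S.curve.ae_velocity Q (hmem m hm.le) (hmem (m + 1) hm) (hlt m)
    rwa [hdt] at this
  have hverr : ∀ m < M, ∀ᵐ ρ ∂muI, ‖v m ρ - w m ρ‖ ≤ L * (Q.size ^ 2 + Δ) := fun m hm => by
    have := S.curve.ae_velocity_error Q (hmem m hm.le) (hmem (m + 1) hm) (hlt m)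
      (w := w m) (((hw m hm).2).mono fun ρ hρ => hρ.2)
    rwa [hdt] at this
  have hwb : ∀ m < M, Bdd (w m) := fun m hm => by
    refine .of_bound (hw m hm).1 (K := L + L * (Q.size ^ 2 + Δ)) ?_
    filter_upwards [hvel m hm, hverr m hm] with ρ h1 h2
    have := norm_sub_le_of_le h1.1 h2
    rwa [sub_sub_cancel] at this
  have hxb : ∀ m ≤ M, Bdd (x (m * Δ)) := fun m hm => .of_continuous
    (continuous_iff_continuousAt.mpr fun ρ => (S.curve.differentiable _ (hmem m hm) ρ).continuousAt)
  have hsub : ∀ m < M, ∀ᵐ ρ ∂muI,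
      ‖(x ((m + 1 : ℕ) * Δ) ρ - y (m + 1) ρ) - (x (m * Δ) ρ - y m ρ)‖ ≤ L * Δ * Q.size ^ 2 ∧
      ‖(deriv (x ((m + 1 : ℕ) * Δ)) ρ - deriv (y (m + 1)) ρ) -
        (deriv (x (m * Δ)) ρ - deriv (y m) ρ)‖ ≤ L * Δ * Q.size ∧
      ‖deriv (y (m + 1)) ρ - deriv (y m) ρ‖ ≤ L * Δ := fun m hm => by
    have := S.curve.ae_interp_error_sub Q (hmem m hm.le) (hmem (m + 1) hm)
    rwa [hdt, abs_of_pos hΔ0] at this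
  have herr : ∀ m ≤ M, ∀ᵐ ρ ∂muI, ‖x (m * Δ) ρ - y m ρ‖ ≤ L * Q.size ^ 2 ∧
      ‖deriv (x (m * Δ)) ρ - deriv (y m) ρ‖ ≤ L * Q.size := fun m hm =>
    S.curve.ae_interp_error Q (hmem m hm)
  set R : ℕ → ℝ → E d := fun m => consR Hh (x ((m + 1 : ℕ) * Δ)) (y m) (y (m + 1)) (v m) (w m)
    with hR
  set F : ℕ → ℝ → E d := fun m => consF Ψ Hh (x ((m + 1 : ℕ) * Δ)) (y (m + 1)) (v m) with hF
  refine ⟨v, R, F, ?_⟩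
  exact
    { fe := hyfe
      range := fun m hm => S.ae_range Q hh (hmem m hm)
      step := fun m hm => (hsub m hm).mono fun ρ hρ => hρ.2.2
      v_eq := fun m hm => rfl
      v_le := fun m hm => (hvel m hm).mono fun ρ hρ => hρ.1
      bddR := fun m hm => bdd_consR S.H_taylor (hxb _ hm) (S.bdd_deriv (hmem _ hm))
        (hyfe m hm.le) (hyfe _ hm) (hvfe m hm) (hwb m hm)
      bddF := fun m hm => bdd_consF S.Ψ_taylor S.H_taylor (hxb _ hm) (S.bdd_deriv (hmem _ hm))
        (hyfe _ hm) (hvfe m hm)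
      R_le := fun m hm => by
        filter_upwards [herr (m + 1) hm, hvel m hm, hverr m hm, hsub m hm] with ρ a1 a2 a3 a4
        refine (norm_consR_le S.H_taylor hL.le hΔ0.le a1.1 a1.2 a2.1 a2.2
          (by rw [norm_sub_rev]; exact a4.2.2) a3).trans ?_
        gcongr
      F_le := fun m hm => by
        filter_upwards [herr (m + 1) hm, hvel m hm] with ρ a1 a2
        refine (norm_consF_le S.Ψ_taylor S.H_taylor a1.1 a1.2 a2.1).trans ?_
        gcongr
      F_step := fun m hm => by
        rcases Nat.eq_zero_or_pos m with h0 | hpos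
        · subst h0
          refine Filter.Eventually.of_forall fun ρ => ?_
          rw [Nat.zero_sub, sub_self, norm_zero]
          positivity
        · obtain ⟨n, rfl⟩ : ∃ n, m = n + 1 := ⟨m - 1, by omega⟩
          have hn : n < M := by omega
          have hvs : ∀ᵐ ρ ∂muI, ‖v (n + 1) ρ - v n ρ‖ ≤ 2 * L * Δ := by
            have e1 : ((n + 1 : ℕ) : ℝ) * Δ - Δ = n * Δ := by rw [hsucc]; ring
            have e2 : ((n + 1 : ℕ) : ℝ) * Δ + Δ = ((n + 1 + 1 : ℕ) : ℝ) * Δ := (hsucc _).symm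
            have := S.curve.ae_velocity_sub Q (t := ((n + 1 : ℕ) : ℝ) * Δ) hΔ0
              (by rw [e1]; exact hmem n hn.le) (hmem _ hm.le)
              (by rw [e2]; exact hmem _ hm)
            rwa [e1, e2] at this
          filter_upwards [herr (n + 1 + 1) hm, herr (n + 1) hm.le, hvel (n + 1) hm, hvs,
            hsub (n + 1) hm] with ρ a1 a2 a3 a4 a5
          rw [Nat.add_sub_cancel]
          refine (norm_consF_sub_le S.Ψ_taylor S.H_taylor hL.le hh0.le hΔ0.le a1.1 a2.1 a1.2 a2.2
            a3.1 a4 a5.2.2 a5.1 a5.2.1).trans ?_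
          gcongr
      eqn := fun m hm η hη => by
        have ht : ((m + 1 : ℕ) : ℝ) * Δ ∈ Ioc 0 T := ⟨by positivity, (hmem _ hm).2⟩
        have hs := S.weak_eq ht (w := w m) (((hw m hm).2).mono fun ρ hρ => hρ.1) hη
        have hcons := consistency S.Ψ_taylor S.H_taylor
          (S.curve.differentiable _ (hmem (m + 1) hm)) (S.bdd_deriv (hmem _ hm)) (hyfe m hm.le)
          (hyfe (m + 1) hm) (S.curve.interp_node Q (hmem (m + 1) hm)) (hvfe m hm) (hwb m hm) hη hs
        rw [← hcons]
        congr 1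
        refine integral_congr_ae ?_
        filter_upwards [S.ae_range Q hh (hmem (m + 1) hm)] with ρ hρ
        have h2 := S.c₀_pos
        have h3 := S.c₀_le
        rw [S.Ψ_eq _ (by linarith [hρ.1]) (by linarith [hρ.2])] }

end Interpolated

/-! ### Stability -/

section Bregman

variable {d : ℕ} {φ : E d → ℝ} {lam Lam : ℝ}

/-- The Bregman distance of `p - q` to `p` for the function `Φ`. -/
def breg (φ : E d → ℝ) (p q : E d) : ℝ :=
  Phi φ (p - q) - Phi φ p + inner ℝ (gradient (Phi φ) p) q

theorem ConvexBounds.le_breg (h : ConvexBounds φ lam Lam) (p q : E d) :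
    lam / 2 * ‖q‖ ^ 2 ≤ breg φ p q := by
  have := h.lower p (p - q)
  rw [sub_sub_cancel_left, inner_neg_right, norm_neg] at this
  unfold breg
  linarith

theorem ConvexBounds.breg_le (h : ConvexBounds φ lam Lam) (p q : E d) :
    breg φ p q ≤ Lam * ‖q‖ ^ 2 := by
  have := h.upper p (p - q)
  rw [sub_sub_cancel_left, inner_neg_right, norm_neg] at this
  unfold breg
  linarith

/-- The tangent inequality for `Φ` at `p - q'`. With `p - q'` the new discrete slope, the right side
is the elliptic term tested with the increment of the error. -/
theorem ConvexBounds.breg_sub_le (h : ConvexBounds φ lam Lam) (p q q' : E d) :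
    breg φ p q' - breg φ p q ≤
      inner ℝ (gradient (Phi φ) p - gradient (Phi φ) (p - q')) (q' - q) := by
  have := h.lower (p - q') (p - q)
  rw [sub_sub_sub_cancel_left] at this
  have h0 : 0 ≤ lam / 2 * ‖q' - q‖ ^ 2 := mul_nonneg (by linarith [h.pos]) (by positivity)
  unfold breg
  rw [inner_sub_left, inner_sub_right (gradient (Phi φ) p)]
  linarith

theorem ConvexBounds.bdd_breg (h : ConvexBounds φ lam Lam) {p q : ℝ → E d} (hp : Bdd p)
    (hq : Bdd q) : Bdd (fun ρ => breg φ (p ρ) (q ρ)) := by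
  have hP : Continuous (Phi φ) := h.differentiable.continuous
  have hm : AEStronglyMeasurable (fun ρ => breg φ (p ρ) (q ρ)) muI :=
    ((hP.comp_aestronglyMeasurable (hp.sub hq).1).sub (hP.comp_aestronglyMeasurable hp.1)).add
      ((Bdd.comp_lipschitz h.lipschitz hp).inner hq).1
  obtain ⟨B, hB0, hB⟩ := hq.exists_bound
  refine .of_bound hm (K := Lam * B ^ 2) ?_
  filter_upwards [hB] with ρ hρ
  have h0 : 0 ≤ breg φ (p ρ) (q ρ) :=
    le_trans (mul_nonneg (by linarith [h.pos]) (by positivity)) (h.le_breg _ _)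
  have hL := h.nonneg
  rw [Real.norm_of_nonneg h0]
  exact (h.breg_le _ _).trans (by gcongr)

end Bregman

/-! ### Energy estimates for one time step -/

section Stability

variable {d J : ℕ} {Q : Mesh J} {φ mob : E d → ℝ} {T : ℝ} {x : ℝ → ℝ → E d}
  {c₀ C₀ L K lam Lam kap : ℝ} {P : E d → ℝ} {Ψ : E d → E d} {Hh : E d → E d →L[ℝ] E d}

/-- The bound `c₀ / 2` on `q` keeps `p - q` in the annulus, where `P` and `Φ` agree. Hence the
Bregman distance inherits the Taylor bounds of `P`, in particular the one for a change of base
point. -/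
theorem Setup.breg_eq (S : Setup φ mob T x c₀ C₀ L K lam Lam kap P Ψ Hh) {p q : E d}
    (hp : 3 / 4 * c₀ ≤ ‖p‖ ∧ ‖p‖ ≤ 5 / 4 * C₀) (hq : ‖q‖ ≤ c₀ / 2) :
    breg φ p q = taylorRem P p (-q) := by
  have h0 := S.c₀_pos
  have h1 := S.c₀_le
  have h2 := norm_sub_norm_le p q
  have h3 := norm_sub_le p q
  rw [taylorRem, S.P_fderiv p (by linarith [hp.1]) (by linarith [hp.2]),
    S.P_eq p (by linarith [hp.1]) (by linarith [hp.2]), ← sub_eq_add_neg,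
    S.P_eq (p - q) (by linarith [hp.1]) (by linarith [hp.2]), ← inner_gradient_left,
    inner_neg_right, sub_neg_eq_add, breg]

theorem Setup.breg_base_sub_le (S : Setup φ mob T x c₀ C₀ L K lam Lam kap P Ψ Hh) {p p' q : E d}
    (hp : 3 / 4 * c₀ ≤ ‖p‖ ∧ ‖p‖ ≤ 5 / 4 * C₀) (hp' : 3 / 4 * c₀ ≤ ‖p'‖ ∧ ‖p'‖ ≤ 5 / 4 * C₀)
    (hq : ‖q‖ ≤ c₀ / 2) : breg φ p' q - breg φ p q ≤ K * ‖p' - p‖ * ‖q‖ ^ 2 := by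
  rw [S.breg_eq hp hq, S.breg_eq hp' hq]
  have := S.P_taylor.rem_base_sub_le p' p (-q)
  rw [norm_neg] at this
  exact (le_abs_self _).trans this

theorem mul_le_add_sq_div_four {a b k : ℝ} (hk : 0 < k) : a * b ≤ k / 4 * b ^ 2 + k⁻¹ * a ^ 2 := by
  have h1 : 0 ≤ k⁻¹ * (k / 2 * b - a) ^ 2 := by positivity
  have h2 : k⁻¹ * (k / 2 * b - a) ^ 2 = k / 4 * b ^ 2 + k⁻¹ * a ^ 2 - a * b := by
    field_simp
    ring
  linarith

/-- The pointwise inequality behind the stability of one time step. -/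
theorem Setup.stability_pointwise (S : Setup φ mob T x c₀ C₀ L K lam Lam kap P Ψ Hh)
    {p p' r r' v g R : E d} {Δ B : ℝ} (hΔ : 0 < Δ)
    (hp : 3 / 4 * c₀ ≤ ‖p‖ ∧ ‖p‖ ≤ 5 / 4 * C₀) (hp' : 3 / 4 * c₀ ≤ ‖p'‖ ∧ ‖p'‖ ≤ 5 / 4 * C₀)
    (hpp : ‖p' - p‖ ≤ L * Δ) (hr : ‖p - r‖ ≤ c₀ / 4) (hv : ‖v‖ ≤ L) (hR : ‖R‖ ≤ B) :
    kap / (2 * Δ) * ‖g‖ ^ 2 + (breg φ p' (p' - r') - breg φ p (p - r)) -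
      Δ * (K * L + kap⁻¹ * (K * L) ^ 2) * ‖p - r‖ ^ 2 - Δ * (kap⁻¹ * B ^ 2) ≤
    inner ℝ (Hh p v - Hh r (v - Δ⁻¹ • g)) g +
      inner ℝ (gradient (Phi φ) p' - gradient (Phi φ) r') ((p' - r') - (p - r)) - inner ℝ R g := by
  have h0 := S.c₀_pos
  have h1 := S.c₀_le
  have hk := S.kap_pos
  have hK := S.K_pos
  have hrn : c₀ / 8 ≤ ‖r‖ ∧ ‖r‖ ≤ 2 * C₀ := by
    have := norm_sub_norm_le p r
    have := norm_sub_norm_le r p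
    rw [norm_sub_rev] at this
    constructor <;> linarith [hp.1, hp.2]
  have a1 : kap * ‖g‖ ^ 2 ≤ inner ℝ (Hh r g) g := by
    rw [S.H_eq r hrn.1 hrn.2]
    exact S.coercive r hrn.1 hrn.2 g
  have a2 : -inner ℝ ((Hh p - Hh r) v) g ≤ K * L * ‖p - r‖ * ‖g‖ := by
    have b1 := norm_clm_apply_le (Hh p - Hh r) (S.H_taylor.lipschitz p r) hv
    have b2 := (neg_le_abs _).trans (abs_real_inner_le_norm ((Hh p - Hh r) v) g)
    calc _ ≤ _ := b2
      _ ≤ K * ‖p - r‖ * L * ‖g‖ := by gcongr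
      _ = _ := by ring
  have a3 : inner ℝ R g ≤ B * ‖g‖ := (real_inner_le_norm _ _).trans (by gcongr)
  -- The increment of the Bregman distance is split: first the error changes at the fixed base point
  -- `p'`, then the base point moves from `p` to `p'` at the fixed error `p - r`.
  have a4 := S.convex.breg_sub_le p' (p - r) (p' - r')
  rw [sub_sub_cancel] at a4
  have a5 := S.breg_base_sub_le hp hp' (q := p - r) (by linarith)
  have a6 : K * ‖p' - p‖ * ‖p - r‖ ^ 2 ≤ K * (L * Δ) * ‖p - r‖ ^ 2 := by gcongr
  have hkΔ : 0 < kap / Δ := by positivity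
  -- Two applications of Young's inequality take a quarter of `kap / Δ * ‖g‖ ^ 2` each; half of it
  -- survives.
  have a7 := mul_le_add_sq_div_four (a := K * L * ‖p - r‖) (b := ‖g‖) hkΔ
  have a8 := mul_le_add_sq_div_four (a := B) (b := ‖g‖) hkΔ
  have e : inner ℝ (Hh p v - Hh r (v - Δ⁻¹ • g)) g =
      inner ℝ ((Hh p - Hh r) v) g + Δ⁻¹ * inner ℝ (Hh r g) g := by
    rw [← real_inner_smul_left, ← inner_add_left]
    congr 1
    simp only [map_sub, map_smul, sub_apply]
    abel
  have a9 : Δ⁻¹ * (kap * ‖g‖ ^ 2) ≤ Δ⁻¹ * inner ℝ (Hh r g) g := by gcongr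
  rw [inv_div] at a7 a8
  have e1 : Δ⁻¹ * (kap * ‖g‖ ^ 2) - 2 * (kap / Δ / 4 * ‖g‖ ^ 2) = kap / (2 * Δ) * ‖g‖ ^ 2 := by
    field_simp
    ring
  have e2 : Δ / kap * (K * L * ‖p - r‖) ^ 2 = Δ * (kap⁻¹ * (K * L) ^ 2) * ‖p - r‖ ^ 2 := by
    field_simp
  have e3 : Δ / kap * B ^ 2 = Δ * (kap⁻¹ * B ^ 2) := by field_simp
  rw [e, ← e1]
  rw [e2] at a7
  rw [e3] at a8
  linarith

variable {M : ℕ} {Δ C : ℝ} {y v R F : ℕ → ℝ → E d} {X X' : ℝ → E d} {m : ℕ}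

/-- The energy estimate for one time step of the scheme. -/
theorem ApproxScheme.energy_estimate (S : Setup φ mob T x c₀ C₀ L K lam Lam kap P Ψ Hh)
    (A : ApproxScheme φ Hh Q M Δ L C (3 / 4 * c₀) (5 / 4 * C₀) y v R F) (hΔ : 0 < Δ)
    (hm : m < M) (hX : IsFE Q X) (hX' : IsFE Q X')
    (hn : ∀ᵐ ρ ∂muI, ‖deriv (y m) ρ - deriv X ρ‖ ≤ c₀ / 4)
    (heq : ∀ η, IsFE Q η → (∫ ρ, inner ℝ (Hh (deriv X ρ) (Δ⁻¹ • (X' ρ - X ρ))) (η ρ) ∂muI) +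
      ∫ ρ, inner ℝ (gradient (Phi φ) (deriv X' ρ)) (deriv η ρ) ∂muI = 0) :
    kap / (2 * Δ) * (∫ ρ, ‖(y (m + 1) ρ - X' ρ) - (y m ρ - X ρ)‖ ^ 2 ∂muI) +
      ((∫ ρ, breg φ (deriv (y (m + 1)) ρ) (deriv (y (m + 1)) ρ - deriv X' ρ) ∂muI) -
        ∫ ρ, breg φ (deriv (y m) ρ) (deriv (y m) ρ - deriv X ρ) ∂muI) -
      Δ * (K * L + kap⁻¹ * (K * L) ^ 2) * (∫ ρ, ‖deriv (y m) ρ - deriv X ρ‖ ^ 2 ∂muI) -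
      Δ * (kap⁻¹ * (C * (Q.size ^ 2 + Δ)) ^ 2) ≤
    (∫ ρ, inner ℝ (F m ρ) (deriv (y (m + 1)) ρ - deriv X' ρ) ∂muI) -
      ∫ ρ, inner ℝ (F m ρ) (deriv (y m) ρ - deriv X ρ) ∂muI := by
  have hy := A.fe m hm.le
  have hy' := A.fe (m + 1) hm
  have he := hy.sub hX
  have he' := hy'.sub hX'
  have hg := he'.sub he
  have hvb : Bdd (v m) := by
    rw [A.v_eq m hm]
    exact ((hy'.sub hy).smul _).bdd
  have hXb : Bdd (fun ρ => Δ⁻¹ • (X' ρ - X ρ)) := (((hX'.sub hX).smul Δ⁻¹).bdd :)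
  set g : ℝ → E d := fun ρ => (y (m + 1) ρ - X' ρ) - (y m ρ - X ρ) with hgdef
  have hg' : IsFE Q g := hg
  set q : ℝ → E d := fun ρ => deriv (y m) ρ - deriv X ρ with hq
  set q' : ℝ → E d := fun ρ => deriv (y (m + 1)) ρ - deriv X' ρ with hq'
  have bq : Bdd q := hy.bdd_deriv.sub hX.bdd_deriv
  have bq' : Bdd q' := hy'.bdd_deriv.sub hX'.bdd_deriv
  have dg : ∀ᵐ ρ ∂muI, deriv g ρ = q' ρ - q ρ := by
    filter_upwards [he'.ae_deriv_sub he, hy.ae_deriv_sub hX, hy'.ae_deriv_sub hX'] with ρ d1 d2 d3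
    rw [hq, hq']
    simp only
    rw [← d2, ← d3, ← d1]
    rfl
  have b1 : Bdd (fun ρ => inner ℝ (Hh (deriv (y m) ρ) (v m ρ)) (g ρ)) :=
    ((S.H_taylor.bdd_comp hy.bdd_deriv).clm_apply hvb).inner hg'.bdd
  have b2 : Bdd (fun ρ => inner ℝ (gradient (Phi φ) (deriv (y (m + 1)) ρ)) (deriv g ρ)) :=
    (Bdd.comp_lipschitz S.convex.lipschitz hy'.bdd_deriv).inner hg'.bdd_deriv
  have b3 : Bdd (fun ρ => inner ℝ (Hh (deriv X ρ) (Δ⁻¹ • (X' ρ - X ρ))) (g ρ)) :=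
    ((S.H_taylor.bdd_comp hX.bdd_deriv).clm_apply hXb).inner hg'.bdd
  have b4 : Bdd (fun ρ => inner ℝ (gradient (Phi φ) (deriv X' ρ)) (deriv g ρ)) :=
    (Bdd.comp_lipschitz S.convex.lipschitz hX'.bdd_deriv).inner hg'.bdd_deriv
  have b5 : Bdd (fun ρ => inner ℝ (R m ρ) (g ρ)) := (A.bddR m hm).inner hg'.bdd
  have b6 : Bdd (fun ρ => inner ℝ (F m ρ) (q' ρ)) := (A.bddF m hm).inner bq'
  have b7 : Bdd (fun ρ => inner ℝ (F m ρ) (q ρ)) := (A.bddF m hm).inner bq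
  have b8 := S.convex.bdd_breg hy.bdd_deriv bq
  have b9 := S.convex.bdd_breg hy'.bdd_deriv bq'
  have b10 := hg'.bdd.norm_sq
  have b11 := bq.norm_sq
  set κ₁ := Δ * (K * L + kap⁻¹ * (K * L) ^ 2)
  set κ₂ := Δ * (kap⁻¹ * (C * (Q.size ^ 2 + Δ)) ^ 2)
  have key : ∀ᵐ ρ ∂muI, kap / (2 * Δ) * ‖g ρ‖ ^ 2 +
      (breg φ (deriv (y (m + 1)) ρ) (q' ρ) - breg φ (deriv (y m) ρ) (q ρ)) -
      κ₁ * ‖q ρ‖ ^ 2 - κ₂ ≤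
      (inner ℝ (Hh (deriv (y m) ρ) (v m ρ)) (g ρ) -
        inner ℝ (Hh (deriv X ρ) (Δ⁻¹ • (X' ρ - X ρ))) (g ρ)) +
      (inner ℝ (gradient (Phi φ) (deriv (y (m + 1)) ρ)) (deriv g ρ) -
        inner ℝ (gradient (Phi φ) (deriv X' ρ)) (deriv g ρ)) - inner ℝ (R m ρ) (g ρ) := by
    filter_upwards [A.range m hm.le, A.range (m + 1) hm, A.step m hm, A.v_le m hm, A.R_le m hm,
      hn, dg] with ρ r1 r2 r3 r4 r5 r6 r7
    have := S.stability_pointwise (g := g ρ) (r' := deriv X' ρ) hΔ r1 r2 r3 r6 r4 r5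
    refine this.trans (le_of_eq ?_)
    have ev : v m ρ - Δ⁻¹ • g ρ = Δ⁻¹ • (X' ρ - X ρ) := by
      rw [A.v_eq m hm, Pi.smul_apply, Pi.sub_apply, ← smul_sub]
      congr 1
      simp only [hgdef]
      abel
    rw [ev, r7, inner_sub_left, ← inner_sub_left (gradient (Phi φ) (deriv (y (m + 1)) ρ))]
  have hint := integral_mono_bdd
    ((((Bdd.const (kap / (2 * Δ))).mul b10).add (b9.sub b8)).sub ((Bdd.const κ₁).mul b11) |>.sub
      (Bdd.const κ₂)) (((b1.sub b3).add (b2.sub b4)).sub b5) key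
  rw [integral_sub ((((Bdd.const (kap / (2 * Δ))).mul b10).add (b9.sub b8)).sub
      ((Bdd.const κ₁).mul b11)).integrable (Bdd.const κ₂).integrable,
    integral_sub (((Bdd.const (kap / (2 * Δ))).mul b10).add (b9.sub b8)).integrable
      ((Bdd.const κ₁).mul b11).integrable,
    integral_add ((Bdd.const (kap / (2 * Δ))).mul b10).integrable (b9.sub b8).integrable,
    integral_sub b9.integrable b8.integrable, integral_const_mul, integral_const_mul,
    integral_sub ((b1.sub b3).add (b2.sub b4)).integrable b5.integrable,
    integral_add (b1.sub b3).integrable (b2.sub b4).integrable,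
    integral_sub b1.integrable b3.integrable, integral_sub b2.integrable b4.integrable,
    integral_const, probReal_univ, one_smul] at hint
  refine hint.trans (le_of_eq ?_)
  -- Both schemes are tested with the increment `g` of the error. As `g_ρ = q' - q` almost
  -- everywhere, the residual `F` appears as a time difference.
  have q1 := A.eqn m hm g hg'
  have q2 := heq g hg'
  have q3 : ∫ ρ, inner ℝ (F m ρ) (deriv g ρ) ∂muI =
      (∫ ρ, inner ℝ (F m ρ) (q' ρ) ∂muI) - ∫ ρ, inner ℝ (F m ρ) (q ρ) ∂muI := by
    rw [← integral_sub b6.integrable b7.integrable]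
    refine integral_congr_ae ?_
    filter_upwards [dg] with ρ hρ
    rw [hρ, inner_sub_right]
  linarith

/-- The energy of the error `y - X` at one time level. -/
def energy (φ : E d → ℝ) (kap B : ℝ) (F y X : ℝ → E d) : ℝ :=
  (∫ ρ, breg φ (deriv y ρ) (deriv y ρ - deriv X ρ) ∂muI) -
    (∫ ρ, inner ℝ (F ρ) (deriv y ρ - deriv X ρ) ∂muI) + B +
    kap / 4 * ∫ ρ, ‖y ρ - X ρ‖ ^ 2 ∂muI

theorem abs_integral_inner_le {F q : ℝ → E d} (hq : Bdd q) {b k : ℝ} (hk : 0 < k)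
    (hb : ∀ᵐ ρ ∂muI, ‖F ρ‖ ≤ b) :
    |∫ ρ, inner ℝ (F ρ) (q ρ) ∂muI| ≤ k / 4 * (∫ ρ, ‖q ρ‖ ^ 2 ∂muI) + k⁻¹ * b ^ 2 := by
  have h1 : ∀ᵐ ρ ∂muI, ‖(inner ℝ (F ρ) (q ρ) : ℝ)‖ ≤ k / 4 * ‖q ρ‖ ^ 2 + k⁻¹ * b ^ 2 := by
    filter_upwards [hb] with ρ hρ
    refine (norm_inner_le_norm _ _).trans (le_trans ?_ (mul_le_add_sq_div_four hk))
    gcongr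
  have h2 := norm_integral_le_of_norm_le
    (((Bdd.const (k / 4)).mul hq.norm_sq).add (Bdd.const (k⁻¹ * b ^ 2))).integrable h1
  rwa [integral_add ((Bdd.const (k / 4)).mul hq.norm_sq).integrable
    (Bdd.const (k⁻¹ * b ^ 2)).integrable, integral_const_mul, integral_const, probReal_univ,
    one_smul] at h2

/-- The term with `F` costs half of the lower bound `lam / 2` for `breg` plus a constant, which the
summand `B` is there to compensate. -/
theorem ConvexBounds.le_energy (h : ConvexBounds φ lam Lam) {F y X : ℝ → E d} {kap B b : ℝ}
    (hy : IsFE Q y) (hX : IsFE Q X) (hb : ∀ᵐ ρ ∂muI, ‖F ρ‖ ≤ b) :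
    lam / 4 * (∫ ρ, ‖deriv y ρ - deriv X ρ‖ ^ 2 ∂muI) + (B - lam⁻¹ * b ^ 2) +
      kap / 4 * (∫ ρ, ‖y ρ - X ρ‖ ^ 2 ∂muI) ≤ energy φ kap B F y X := by
  have bq : Bdd (fun ρ => deriv y ρ - deriv X ρ) := hy.bdd_deriv.sub hX.bdd_deriv
  have h1 := integral_mono_bdd ((Bdd.const (lam / 2)).mul bq.norm_sq)
    (h.bdd_breg hy.bdd_deriv bq) (Filter.Eventually.of_forall fun ρ => h.le_breg _ _)
  rw [integral_const_mul] at h1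
  have h2 := (le_abs_self _).trans (abs_integral_inner_le bq h.pos hb)
  unfold energy
  linarith

theorem ConvexBounds.energy_le (h : ConvexBounds φ lam Lam) {F y X : ℝ → E d} {kap B b : ℝ}
    (hy : IsFE Q y) (hX : IsFE Q X) (hb : ∀ᵐ ρ ∂muI, ‖F ρ‖ ≤ b) :
    energy φ kap B F y X ≤ (Lam + lam / 4) * (∫ ρ, ‖deriv y ρ - deriv X ρ‖ ^ 2 ∂muI) +
      (B + lam⁻¹ * b ^ 2) + kap / 4 * (∫ ρ, ‖y ρ - X ρ‖ ^ 2 ∂muI) := by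
  have bq : Bdd (fun ρ => deriv y ρ - deriv X ρ) := hy.bdd_deriv.sub hX.bdd_deriv
  have h1 := integral_mono_bdd (h.bdd_breg hy.bdd_deriv bq) ((Bdd.const Lam).mul bq.norm_sq)
    (Filter.Eventually.of_forall fun ρ => h.breg_le _ _)
  rw [integral_const_mul] at h1
  have h2 := (neg_le_abs _).trans (abs_integral_inner_le bq h.pos hb)
  unfold energy
  linarith

/-- The factor `2 / Δ` is calibrated: multiplied by the weight `kap / 4` of the `L²` part of the
energy it equals `kap / (2 * Δ)`, the dissipation left in `stability_pointwise`. -/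
theorem norm_sq_le_of_sub {a b : E d} {Δ : ℝ} (h0 : 0 < Δ) (h1 : Δ ≤ 1) :
    ‖a‖ ^ 2 ≤ (1 + Δ) * ‖b‖ ^ 2 + 2 / Δ * ‖a - b‖ ^ 2 := by
  have h2 : ‖a‖ ≤ ‖b‖ + ‖a - b‖ := by
    have := norm_add_le b (a - b)
    rwa [add_sub_cancel] at this
  have h3 : ‖a‖ ^ 2 ≤ (‖b‖ + ‖a - b‖) ^ 2 := by gcongr
  refine h3.trans ?_
  set s := ‖b‖
  set t := ‖a - b‖
  have h4 : 1 + Δ⁻¹ ≤ 2 / Δ := by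
    rw [div_eq_mul_inv]
    have := one_le_inv₀ h0 |>.mpr h1
    linarith
  have h5 : (1 + Δ⁻¹) * t ^ 2 ≤ 2 / Δ * t ^ 2 := by gcongr
  have h6 : 0 ≤ Δ⁻¹ * (Δ * s - t) ^ 2 := by positivity
  have h7 : Δ⁻¹ * (Δ * s - t) ^ 2 = Δ * s ^ 2 + Δ⁻¹ * t ^ 2 - 2 * (s * t) := by
    field_simp
    ring
  linarith [add_sq s t]

/-- The growth of the energy in one time step. -/
theorem ApproxScheme.energy_succ_le (S : Setup φ mob T x c₀ C₀ L K lam Lam kap P Ψ Hh)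
    (A : ApproxScheme φ Hh Q M Δ L C (3 / 4 * c₀) (5 / 4 * C₀) y v R F) (hΔ : 0 < Δ)
    (hΔ1 : Δ ≤ 1) (hC : 0 < C) (hm : m < M) (hX : IsFE Q X) (hX' : IsFE Q X')
    (hn : ∀ᵐ ρ ∂muI, ‖deriv (y m) ρ - deriv X ρ‖ ≤ c₀ / 4)
    (heq : ∀ η, IsFE Q η → (∫ ρ, inner ℝ (Hh (deriv X ρ) (Δ⁻¹ • (X' ρ - X ρ))) (η ρ) ∂muI) +
      ∫ ρ, inner ℝ (gradient (Phi φ) (deriv X' ρ)) (deriv η ρ) ∂muI = 0) :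
    energy φ kap ((lam⁻¹ * C ^ 2 + 1) * (Q.size ^ 2 + Δ) ^ 2) (F m) (y (m + 1)) X' ≤
      (1 + (4 / lam * (K * L + kap⁻¹ * (K * L) ^ 2 + C) + kap⁻¹ * C ^ 2 + C + 1) * Δ) *
      energy φ kap ((lam⁻¹ * C ^ 2 + 1) * (Q.size ^ 2 + Δ) ^ 2) (F (m - 1)) (y m) X := by
  have hy := A.fe m hm.le
  have hy' := A.fe (m + 1) hm
  have hlam := S.convex.pos
  have hk := S.kap_pos
  have hK := S.K_pos
  have hL := S.L_pos
  have hh := Q.size_pos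
  have hm1 : m - 1 < M := by omega
  set ε := Q.size ^ 2 + Δ with hε
  set B := (lam⁻¹ * C ^ 2 + 1) * ε ^ 2 with hB
  set c₁ := K * L + kap⁻¹ * (K * L) ^ 2 with hc₁
  set C₇ := 4 / lam * (c₁ + C) + kap⁻¹ * C ^ 2 + C + 1 with hC₇
  have hstep := A.energy_estimate S hΔ hm hX hX' hn heq
  rw [← hε, ← hc₁] at hstep
  have hlow := S.convex.le_energy (kap := kap) (B := B) hy hX (A.F_le _ hm1)
  -- Cost of replacing `F m` by `F (m - 1)` at level `m`. The choice `k = 4 * C * Δ` balances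
  -- Young's inequality so that both resulting terms carry a factor `Δ`.
  have hFd := abs_integral_inner_le
    (F := fun ρ => F m ρ - F (m - 1) ρ) (hy.bdd_deriv.sub hX.bdd_deriv) (k := 4 * C * Δ) (by positivity) (A.F_step m hm)
  have hFs : ∫ ρ, inner ℝ (F m ρ - F (m - 1) ρ) (deriv (y m) ρ - deriv X ρ) ∂muI =
      (∫ ρ, inner ℝ (F m ρ) (deriv (y m) ρ - deriv X ρ) ∂muI) -
        ∫ ρ, inner ℝ (F (m - 1) ρ) (deriv (y m) ρ - deriv X ρ) ∂muI := by
    rw [← integral_sub ((A.bddF m hm).inner (hy.bdd_deriv.sub hX.bdd_deriv)).integrable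
      ((A.bddF _ hm1).inner (hy.bdd_deriv.sub hX.bdd_deriv)).integrable]
    simp only [inner_sub_left]
  rw [hFs] at hFd
  have hL2 : ∫ ρ, ‖y (m + 1) ρ - X' ρ‖ ^ 2 ∂muI ≤ (1 + Δ) * (∫ ρ, ‖y m ρ - X ρ‖ ^ 2 ∂muI) +
      2 / Δ * ∫ ρ, ‖(y (m + 1) ρ - X' ρ) - (y m ρ - X ρ)‖ ^ 2 ∂muI := by
    have e := (hy.bdd.sub hX.bdd)
    have e' := (hy'.bdd.sub hX'.bdd)
    have b1 := (Bdd.const (1 + Δ)).mul e.norm_sq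
    have b2 := (Bdd.const (2 / Δ)).mul (e'.sub e).norm_sq
    have := integral_mono_bdd e'.norm_sq (b1.add b2)
      (Filter.Eventually.of_forall fun ρ => norm_sq_le_of_sub hΔ hΔ1)
    rwa [integral_add b1.integrable b2.integrable, integral_const_mul, integral_const_mul] at this
  have hL2' := mul_le_mul_of_nonneg_left hL2 (show 0 ≤ kap / 4 by positivity)
  have nD : 0 ≤ ∫ ρ, ‖deriv (y m) ρ - deriv X ρ‖ ^ 2 ∂muI := integral_nonneg fun _ => by positivity
  have nE : 0 ≤ ∫ ρ, ‖y m ρ - X ρ‖ ^ 2 ∂muI := integral_nonneg fun _ => by positivity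
  set D := ∫ ρ, ‖deriv (y m) ρ - deriv X ρ‖ ^ 2 ∂muI
  set N := ∫ ρ, ‖y m ρ - X ρ‖ ^ 2 ∂muI
  set N' := ∫ ρ, ‖y (m + 1) ρ - X' ρ‖ ^ 2 ∂muI
  set W := ∫ ρ, ‖(y (m + 1) ρ - X' ρ) - (y m ρ - X ρ)‖ ^ 2 ∂muI
  have hh2 : Q.size ^ 2 ≤ ε := by rw [hε]; linarith
  have hhε : (Q.size ^ 2) ^ 2 ≤ ε ^ 2 := by gcongr
  -- The first part of `B` absorbs the loss from `F`; its extra `ε ^ 2` lets the energy dominate the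
  -- residuals, so that the recursion is purely multiplicative.
  have hlow' : lam / 4 * D + ε ^ 2 + kap / 4 * N ≤ energy φ kap B (F (m - 1)) (y m) X := by
    refine le_trans ?_ hlow
    have : lam⁻¹ * (C * Q.size ^ 2) ^ 2 ≤ lam⁻¹ * C ^ 2 * ε ^ 2 := by
      rw [mul_pow, mul_assoc]
      gcongr
    rw [hB]
    linarith
  have hFd' := (neg_le_abs _).trans hFd
  have r1 : (4 * C * Δ)⁻¹ * (C * Q.size ^ 2 * Δ) ^ 2 ≤ Δ * C * ε ^ 2 := by
    have : (4 * C * Δ)⁻¹ * (C * Q.size ^ 2 * Δ) ^ 2 = Δ * C * (Q.size ^ 2) ^ 2 / 4 := by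
      field_simp
    rw [this]
    have : Δ * C * (Q.size ^ 2) ^ 2 ≤ Δ * C * ε ^ 2 := by gcongr
    have : 0 ≤ Δ * C * ε ^ 2 := by positivity
    linarith
  have e1 : kap / 4 * (2 / Δ * W) = kap / (2 * Δ) * W := by field_simp; ring
  have e2 : Δ * (kap⁻¹ * (C * ε) ^ 2) = Δ * (kap⁻¹ * C ^ 2) * ε ^ 2 := by ring
  have main : energy φ kap B (F m) (y (m + 1)) X' - energy φ kap B (F (m - 1)) (y m) X ≤
      Δ * ((c₁ + C) * D + (kap⁻¹ * C ^ 2 + C) * ε ^ 2 + kap / 4 * N) := by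
    unfold energy
    rw [e2] at hstep
    linarith
  have h8 : (c₁ + C) * D + (kap⁻¹ * C ^ 2 + C) * ε ^ 2 + kap / 4 * N ≤
      C₇ * (lam / 4 * D + ε ^ 2 + kap / 4 * N) := by
    have n1 : 0 ≤ 4 / lam * (c₁ + C) := by positivity
    have n2 : 0 ≤ kap⁻¹ * C ^ 2 + C + 1 := by positivity
    have n3 : 4 / lam * (c₁ + C) * (lam / 4 * D) = (c₁ + C) * D := by field_simp
    have n4 : 0 ≤ lam / 4 * D := by positivity
    have n5 : 0 ≤ ε ^ 2 + kap / 4 * N := by positivity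
    have n6 : 0 ≤ kap⁻¹ * C ^ 2 + C := by positivity
    have n7 : 0 ≤ kap / 4 * N := by positivity
    have n8 := mul_nonneg n2 n4
    have n9 := mul_nonneg n1 n5
    have n10 := mul_nonneg n6 n7
    have n11 := sq_nonneg ε
    rw [hC₇]
    linarith
  have hC7 : 0 < C₇ := by positivity
  have h9 := mul_le_mul_of_nonneg_left (h8.trans (mul_le_mul_of_nonneg_left hlow' hC7.le)) hΔ.le
  linarith

end Stability

/-! ### Existence of discrete solutions -/

section Solvability

variable {d J : ℕ} {Q : Mesh J}

/-- The functional `η ↦ ∫ f · η + ∫ g · η_ρ` on the finite element space. -/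
def feFunctional (Q : Mesh J) {f g : ℝ → E d} (hf : Bdd f) (hg : Bdd g) : FESpace d Q →ₗ[ℝ] ℝ where
  toFun w := (∫ ρ, inner ℝ (f ρ) (w.1 ρ) ∂muI) + ∫ ρ, inner ℝ (g ρ) (deriv w.1 ρ) ∂muI
  map_add' u v := by
    have hu : IsFE Q u.1 := u.2
    have hv : IsFE Q v.1 := v.2
    have e1 : ∫ ρ, inner ℝ (f ρ) ((u + v : FESpace d Q).1 ρ) ∂muI =
        (∫ ρ, inner ℝ (f ρ) (u.1 ρ) ∂muI) + ∫ ρ, inner ℝ (f ρ) (v.1 ρ) ∂muI := by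
      rw [← integral_add (hf.inner hu.bdd).integrable (hf.inner hv.bdd).integrable]
      exact integral_congr_ae (Filter.Eventually.of_forall fun ρ => inner_add_right _ _ _)
    have e2 : ∫ ρ, inner ℝ (g ρ) (deriv (u + v : FESpace d Q).1 ρ) ∂muI =
        (∫ ρ, inner ℝ (g ρ) (deriv u.1 ρ) ∂muI) + ∫ ρ, inner ℝ (g ρ) (deriv v.1 ρ) ∂muI := by
      rw [← integral_add (hg.inner hu.bdd_deriv).integrable (hg.inner hv.bdd_deriv).integrable]
      refine integral_congr_ae ?_
      filter_upwards [hu.ae_deriv_add hv] with ρ hρ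
      change inner ℝ _ (deriv (u.1 + v.1) ρ) = _
      rw [hρ, inner_add_right]
    rw [e1, e2]
    ring
  map_smul' r u := by
    have e1 : ∫ ρ, inner ℝ (f ρ) ((r • u : FESpace d Q).1 ρ) ∂muI =
        r * ∫ ρ, inner ℝ (f ρ) (u.1 ρ) ∂muI := by
      rw [← integral_const_mul]
      exact integral_congr_ae (Filter.Eventually.of_forall fun ρ => real_inner_smul_right _ _ _)
    have e2 : ∫ ρ, inner ℝ (g ρ) (deriv (r • u : FESpace d Q).1 ρ) ∂muI =
        r * ∫ ρ, inner ℝ (g ρ) (deriv u.1 ρ) ∂muI := by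
      rw [← integral_const_mul]
      refine integral_congr_ae (Filter.Eventually.of_forall fun ρ => ?_)
      change inner ℝ _ (deriv (r • u.1) ρ) = _
      rw [IsFE.deriv_smul, real_inner_smul_right]
    rw [e1, e2, RingHom.id_apply, smul_eq_mul]
    ring

theorem sq_integral_inner_le {f u w : ℝ → E d} {K : ℝ} (hu : Bdd u) (hw : Bdd w)
    (hK : ∀ᵐ ρ ∂muI, ‖f ρ‖ ≤ K * ‖u ρ‖) :
    (∫ ρ, inner ℝ (f ρ) (w ρ) ∂muI) ^ 2 ≤
      K ^ 2 * ((∫ ρ, ‖u ρ‖ ^ 2 ∂muI) * ∫ ρ, ‖w ρ‖ ^ 2 ∂muI) := by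
  have h1 : ∀ᵐ ρ ∂muI, ‖(inner ℝ (f ρ) (w ρ) : ℝ)‖ ≤ K * (‖u ρ‖ * ‖w ρ‖) := by
    filter_upwards [hK] with ρ hρ
    refine (norm_inner_le_norm _ _).trans ?_
    rw [← mul_assoc]
    gcongr
  have h2 := norm_integral_le_of_norm_le ((Bdd.const K).mul (hu.norm_mul hw)).integrable h1
  rw [integral_const_mul, Real.norm_eq_abs] at h2
  have h3 := sq_le_sq' (neg_le_of_abs_le h2) (le_of_abs_le h2)
  refine h3.trans ?_
  rw [mul_pow]
  exact mul_le_mul_of_nonneg_left (sq_integral_norm_mul_norm_le hu hw) (sq_nonneg K)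

/-- Unique solvability of strongly monotone second order problems in the finite element space. -/
theorem existsUnique_fe (Q : Mesh J) {α β : ℝ → E d → E d} {c K : ℝ} (hc : 0 < c) (hK : 0 ≤ K)
    (hα : ∀ u, Bdd u → Bdd (fun ρ => α ρ (u ρ))) (hβ : ∀ u, Bdd u → Bdd (fun ρ => β ρ (u ρ)))
    (hαm : ∀ᵐ ρ ∂muI, ∀ p q, c * ‖p - q‖ ^ 2 ≤ inner ℝ (α ρ p - α ρ q) (p - q))
    (hβm : ∀ᵐ ρ ∂muI, ∀ p q, c * ‖p - q‖ ^ 2 ≤ inner ℝ (β ρ p - β ρ q) (p - q))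
    (hαl : ∀ᵐ ρ ∂muI, ∀ p q, ‖α ρ p - α ρ q‖ ≤ K * ‖p - q‖)
    (hβl : ∀ᵐ ρ ∂muI, ∀ p q, ‖β ρ p - β ρ q‖ ≤ K * ‖p - q‖) :
    ∃! u, IsFE Q u ∧ ∀ η, IsFE Q η → (∫ ρ, inner ℝ (α ρ (u ρ)) (η ρ) ∂muI) +
      ∫ ρ, inner ℝ (β ρ (deriv u ρ)) (deriv η ρ) ∂muI = 0 := by
  have fe : ∀ u : FESpace d Q, IsFE Q u.1 := fun u => u.2
  set a : FESpace d Q → FESpace d Q →ₗ[ℝ] ℝ := fun u =>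
    feFunctional Q (hα _ (fe u).bdd) (hβ _ (fe u).bdd_deriv) with ha
  have hdiff : ∀ u v w, a u w - a v w =
      (∫ ρ, inner ℝ (α ρ (u.1 ρ) - α ρ (v.1 ρ)) (w.1 ρ) ∂muI) +
      ∫ ρ, inner ℝ (β ρ (deriv u.1 ρ) - β ρ (deriv v.1 ρ)) (deriv w.1 ρ) ∂muI := by
    intro u v w
    have e : ∀ u, a u w = (∫ ρ, inner ℝ (α ρ (u.1 ρ)) (w.1 ρ) ∂muI) +
      ∫ ρ, inner ℝ (β ρ (deriv u.1 ρ)) (deriv w.1 ρ) ∂muI := fun _ => rfl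
    rw [e, e]
    simp only [inner_sub_left]
    rw [integral_sub ((hα _ (fe u).bdd).inner (fe w).bdd).integrable
      ((hα _ (fe v).bdd).inner (fe w).bdd).integrable,
      integral_sub ((hβ _ (fe u).bdd_deriv).inner (fe w).bdd_deriv).integrable
      ((hβ _ (fe v).bdd_deriv).inner (fe w).bdd_deriv).integrable]
    ring
  have hsub : ∀ u v : FESpace d Q, ∀ᵐ ρ ∂muI,
      deriv (u - v : FESpace d Q).1 ρ = deriv u.1 ρ - deriv v.1 ρ :=
    fun u v => (fe u).ae_deriv_sub (fe v)
  -- The factor `2` is ample: `(A + B)² ≤ 2 A² + 2 B²`, and each square is at most `K²` times the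
  -- product of the two squared `H¹` norms.
  have key := existsUnique_variational (h1Core d Q) a hc (M := 2 * K) (by positivity)
    (fun u v => by
      have b1 := ((hα _ (fe u).bdd).sub (hα _ (fe v).bdd)).inner (fe (u - v)).bdd
      have b2 := ((hβ _ (fe u).bdd_deriv).sub (hβ _ (fe v).bdd_deriv)).inner (fe (u - v)).bdd_deriv
      have i1 := integral_mono_bdd ((Bdd.const c).mul (fe (u - v)).bdd.norm_sq) b1 (by
        filter_upwards [hαm] with ρ hρ
        exact hρ _ _)
      have i2 := integral_mono_bdd ((Bdd.const c).mul (fe (u - v)).bdd_deriv.norm_sq) b2 (by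
        filter_upwards [hβm, hsub u v] with ρ hρ e
        rw [e]
        exact hρ _ _)
      rw [integral_const_mul] at i1 i2
      rw [h1Core_inner_self, hdiff, mul_add]
      exact add_le_add i1 i2)
    (fun u v w => by
      rw [h1Core_inner_self, h1Core_inner_self, hdiff]
      have i1 := sq_integral_inner_le (f := fun ρ => α ρ (u.1 ρ) - α ρ (v.1 ρ)) (K := K)
        (fe (u - v)).bdd (fe w).bdd (by
          filter_upwards [hαl] with ρ hρ
          exact hρ _ _)
      have i2 := sq_integral_inner_le (f := fun ρ => β ρ (deriv u.1 ρ) - β ρ (deriv v.1 ρ)) (K := K)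
        (fe (u - v)).bdd_deriv (fe w).bdd_deriv (by
          filter_upwards [hβl, hsub u v] with ρ hρ e
          rw [e]
          exact hρ _ _)
      set A := ∫ ρ, inner ℝ (α ρ (u.1 ρ) - α ρ (v.1 ρ)) (w.1 ρ) ∂muI
      set B := ∫ ρ, inner ℝ (β ρ (deriv u.1 ρ) - β ρ (deriv v.1 ρ)) (deriv w.1 ρ) ∂muI
      have n1 : 0 ≤ ∫ ρ, ‖(u - v : FESpace d Q).1 ρ‖ ^ 2 ∂muI :=
        integral_nonneg fun _ => by positivity
      have n2 : 0 ≤ ∫ ρ, ‖deriv (u - v : FESpace d Q).1 ρ‖ ^ 2 ∂muI :=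
        integral_nonneg fun _ => by positivity
      have n3 : 0 ≤ ∫ ρ, ‖w.1 ρ‖ ^ 2 ∂muI := integral_nonneg fun _ => by positivity
      have n4 : 0 ≤ ∫ ρ, ‖deriv w.1 ρ‖ ^ 2 ∂muI := integral_nonneg fun _ => by positivity
      have n5 := mul_nonneg (sq_nonneg K) (mul_nonneg n1 n3)
      have n6 := mul_nonneg (sq_nonneg K) (mul_nonneg n2 n4)
      have n7 := mul_nonneg (sq_nonneg K) (mul_nonneg n1 n4)
      have n8 := mul_nonneg (sq_nonneg K) (mul_nonneg n2 n3)
      linarith [sq_nonneg (A - B), sub_sq A B, add_sq A B])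
  obtain ⟨u, hu, huniq⟩ := key
  exact ⟨u.1, ⟨fe u, fun η hη => hu ⟨η, hη⟩⟩, fun v hv =>
    congrArg Subtype.val (huniq ⟨v, hv.1⟩ fun w => hv.2 w.1 w.2)⟩

/-! ### The Ritz projection and single steps of the scheme -/

variable {φ mob : E d → ℝ} {T : ℝ} {x : ℝ → ℝ → E d} {c₀ C₀ L K lam Lam kap : ℝ} {P : E d → ℝ}
  {Ψ : E d → E d} {Hh : E d → E d →L[ℝ] E d}

theorem Setup.hess_eq (S : Setup φ mob T x c₀ C₀ L K lam Lam kap P Ψ Hh) {t : ℝ}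
    (ht : t ∈ Icc 0 T) (ρ : ℝ) :
    hess (Phi φ) (deriv (x t) ρ) = fderiv ℝ Ψ (deriv (x t) ρ) := by
  have h0 := S.c₀_pos
  have h1 := S.c₀_le
  have h2 := S.bounds t ht ρ
  exact (S.Ψ_fderiv _ (by linarith [h2.1]) (by linarith [h2.2])).symm

theorem isRitz_iff {y z : ℝ → E d} : IsRitz φ Q y z ↔ IsFE Q z ∧ ∀ η, IsFE Q η →
    (∫ ρ, inner ℝ (z ρ - y ρ) (η ρ) ∂muI) + (∫ ρ,
      inner ℝ (hess (Phi φ) (deriv y ρ) (deriv z ρ - deriv y ρ)) (deriv η ρ) ∂muI) = 0 := by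
  simp only [IsRitz, intervalIntegral.integral_of_le zero_le_one, add_comm]

theorem Setup.existsUnique_isRitz (S : Setup φ mob T x c₀ C₀ L K lam Lam kap P Ψ Hh) (Q : Mesh J)
    {t : ℝ} (ht : t ∈ Icc 0 T) : ∃! z, IsRitz φ Q (x t) z := by
  have hne : ∀ ρ, deriv (x t) ρ ≠ 0 := fun ρ h => by
    have := (S.bounds t ht ρ).1
    rw [h, norm_zero] at this
    linarith [S.c₀_pos]
  have hx : Bdd (x t) := .of_continuous
    (continuous_iff_continuousAt.mpr fun ρ => (S.curve.differentiable t ht ρ).continuousAt)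
  have hx' := S.bdd_deriv ht
  simp only [isRitz_iff]
  refine existsUnique_fe Q (α := fun ρ z => z - x t ρ)
    (β := fun ρ p => hess (Phi φ) (deriv (x t) ρ) (p - deriv (x t) ρ)) (c := min 1 lam)
    (K := max 1 Lam) (lt_min one_pos S.convex.pos) (by positivity) (fun u hu => hu.sub hx)
    (fun u hu => ?_) ?_ ?_ ?_ ?_
  · simp only [S.hess_eq ht]
    exact (S.Ψ_taylor.bdd_fderiv_comp hx').clm_apply (hu.sub hx')
  · refine Filter.Eventually.of_forall fun ρ p q => ?_
    rw [sub_sub_sub_cancel_right, real_inner_self_eq_norm_sq]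
    exact mul_le_of_le_one_left (by positivity) (min_le_left _ _)
  · refine Filter.Eventually.of_forall fun ρ p q => ?_
    rw [← map_sub, sub_sub_sub_cancel_right]
    exact (mul_le_mul_of_nonneg_right (min_le_right _ _) (by positivity)).trans
      (S.convex.hess_lower _ (hne ρ) _)
  · refine Filter.Eventually.of_forall fun ρ p q => ?_
    rw [sub_sub_sub_cancel_right]
    exact le_mul_of_one_le_left (norm_nonneg _) (le_max_left _ _)
  · refine Filter.Eventually.of_forall fun ρ p q => ?_
    rw [← map_sub, sub_sub_sub_cancel_right]
    refine (ContinuousLinearMap.le_opNorm _ _).trans ?_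
    gcongr
    exact (S.convex.hess_upper _ (hne ρ)).trans (le_max_right _ _)

/-- The Ritz projection is superclose to the interpolant. -/
theorem Setup.isRitz_error (S : Setup φ mob T x c₀ C₀ L K lam Lam kap P Ψ Hh) {t : ℝ}
    (ht : t ∈ Icc 0 T) {z : ℝ → E d} (hz : IsRitz φ Q (x t) z) :
    (∫ ρ, ‖Q.interp (x t) ρ - z ρ‖ ^ 2 ∂muI) / 2 +
      lam / 2 * (∫ ρ, ‖deriv (Q.interp (x t)) ρ - deriv z ρ‖ ^ 2 ∂muI) ≤
    (L ^ 2 + lam⁻¹ * (K * L ^ 2) ^ 2) * (Q.size ^ 2) ^ 2 := by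
  set y := Q.interp (x t) with hy
  have hyf : IsFE Q y := S.curve.isFE_interp Q ht
  obtain ⟨hzf, hzeq⟩ := isRitz_iff.mp hz
  have hef := hyf.sub hzf
  have hlam := S.convex.pos
  have hK := S.K_pos
  have hL := S.L_pos
  have hx : Bdd (x t) := .of_continuous
    (continuous_iff_continuousAt.mpr fun ρ => (S.curve.differentiable t ht ρ).continuousAt)
  have hx' := S.bdd_deriv ht
  have hne : ∀ ρ, deriv (x t) ρ ≠ 0 := fun ρ h => by
    have := (S.bounds t ht ρ).1
    rw [h, norm_zero] at this
    linarith [S.c₀_pos]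
  have h1 := hzeq _ hef
  have h2 := integral_interp_error_eq_zero S.Ψ_taylor (S.curve.differentiable t ht) hx' hyf
    (S.curve.interp_node Q ht) hef
  simp only [S.hess_eq ht] at h1
  have b1 := (hzf.bdd.sub hx).inner hef.bdd
  have b2 := ((S.Ψ_taylor.bdd_fderiv_comp hx').clm_apply (hzf.bdd_deriv.sub hx')).inner
    hef.bdd_deriv
  have b3 := ((S.Ψ_taylor.bdd_fderiv_comp hyf.bdd_deriv).clm_apply
    (hx'.sub hyf.bdd_deriv)).inner hef.bdd_deriv
  have c1 := (Bdd.const (1 / 2)).mul (hyf.bdd.sub hzf.bdd).norm_sq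
  have c2 := (Bdd.const (lam / 2)).mul (hyf.bdd_deriv.sub hzf.bdd_deriv).norm_sq
  set κ := (L ^ 2 + lam⁻¹ * (K * L ^ 2) ^ 2) * (Q.size ^ 2) ^ 2 with hκ
  -- The last summand on the left has zero integral by `h2`. Adding it leaves only `(Φ''(x_ρ) -
  -- Φ''(y_ρ)) (x - y)_ρ`, a product of two factors of order `h`, hence the supercloseness of order
  -- `h²`.
  have key : ∀ᵐ ρ ∂muI, (1 / 2 * ‖y ρ - z ρ‖ ^ 2 + lam / 2 * ‖deriv y ρ - deriv z ρ‖ ^ 2) +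
      (inner ℝ (z ρ - x t ρ) ((y - z) ρ) +
      inner ℝ (fderiv ℝ Ψ (deriv (x t) ρ) (deriv z ρ - deriv (x t) ρ)) (deriv (y - z) ρ)) +
      inner ℝ (fderiv ℝ Ψ (deriv y ρ) (deriv (x t) ρ - deriv y ρ)) (deriv (y - z) ρ) ≤ κ := by
    filter_upwards [S.curve.ae_interp_error Q ht, hyf.ae_deriv_sub hzf] with ρ r1 r2
    rw [r2, Pi.sub_apply]
    set e := y ρ - z ρ with he
    set q := deriv y ρ - deriv z ρ with hq
    have e1 : z ρ - x t ρ = (y ρ - x t ρ) - e := by rw [he]; abel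
    have e2 : deriv z ρ - deriv (x t) ρ = -(deriv (x t) ρ - deriv y ρ) - q := by rw [hq]; abel
    have a1 : inner ℝ (y ρ - x t ρ) e ≤ L * Q.size ^ 2 * ‖e‖ := by
      refine (real_inner_le_norm _ _).trans ?_
      rw [norm_sub_rev]
      gcongr
      exact r1.1
    have a2 : -inner ℝ ((fderiv ℝ Ψ (deriv (x t) ρ) - fderiv ℝ Ψ (deriv y ρ))
        (deriv (x t) ρ - deriv y ρ)) q ≤ K * L ^ 2 * Q.size ^ 2 * ‖q‖ := by
      refine (neg_le_abs _).trans ((abs_real_inner_le_norm _ _).trans ?_)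
      gcongr
      refine (norm_clm_apply_le _ ((S.Ψ_taylor.fderiv_lipschitz _ _).trans
        (mul_le_mul_of_nonneg_left r1.2 hK.le)) r1.2).trans (le_of_eq ?_)
      ring
    have a3 := S.convex.hess_lower _ (hne ρ) q
    rw [S.hess_eq ht] at a3
    have a4 := mul_le_add_sq_div_four (a := L * Q.size ^ 2) (b := ‖e‖) one_pos
    have a5 := mul_le_add_sq_div_four (a := K * L ^ 2 * Q.size ^ 2) (b := ‖q‖) hlam
    have e3 : (1 : ℝ)⁻¹ * (L * Q.size ^ 2) ^ 2 + lam⁻¹ * (K * L ^ 2 * Q.size ^ 2) ^ 2 = κ := by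
      rw [hκ]; ring
    have n1 : 0 ≤ 1 / 4 * ‖e‖ ^ 2 := by positivity
    have n2 : 0 ≤ lam / 4 * ‖q‖ ^ 2 := by positivity
    rw [e1, e2, inner_sub_left (y ρ - x t ρ), real_inner_self_eq_norm_sq, map_sub, map_neg,
      inner_sub_left (-_), inner_neg_left]
    rw [sub_apply, inner_sub_left] at a2
    linarith
  have hint := integral_mono_bdd (((c1.add c2).add (b1.add b2)).add b3) (Bdd.const κ) key
  rw [integral_add ((c1.add c2).add (b1.add b2)).integrable b3.integrable,
    integral_add (c1.add c2).integrable (b1.add b2).integrable,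
    integral_add c1.integrable c2.integrable, integral_add b1.integrable b2.integrable, h1, h2,
    integral_const, probReal_univ, one_smul, integral_const_mul, integral_const_mul] at hint
  linarith

/-- `X'` is obtained from `X` by one step of the scheme. -/
def IsStep (φ mob : E d → ℝ) (Q : Mesh J) (dt : ℝ) (X X' : ℝ → E d) : Prop :=
  IsFE Q X' ∧ ∀ η : ℝ → E d, IsFE Q η →
    1 / dt * (∫ ρ in (0 : ℝ)..1, inner ℝ (Hmat φ mob (deriv X ρ) (X' ρ - X ρ)) (η ρ)) +
    (∫ ρ in (0 : ℝ)..1, inner ℝ (gradient (Phi φ) (deriv X' ρ)) (deriv η ρ)) = 0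

variable {X : ℝ → E d}

theorem Setup.isStep_iff (S : Setup φ mob T x c₀ C₀ L K lam Lam kap P Ψ Hh) {Δ : ℝ}
    (hX : ∀ᵐ ρ ∂muI, c₀ / 8 ≤ ‖deriv X ρ‖ ∧ ‖deriv X ρ‖ ≤ 2 * C₀) {X' : ℝ → E d} :
    IsStep φ mob Q Δ X X' ↔ IsFE Q X' ∧ ∀ η, IsFE Q η →
      (∫ ρ, inner ℝ (Hh (deriv X ρ) (Δ⁻¹ • (X' ρ - X ρ))) (η ρ) ∂muI) +
      ∫ ρ, inner ℝ (gradient (Phi φ) (deriv X' ρ)) (deriv η ρ) ∂muI = 0 := by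
  have h : ∀ η : ℝ → E d,
      1 / Δ * (∫ ρ, inner ℝ (Hmat φ mob (deriv X ρ) (X' ρ - X ρ)) (η ρ) ∂muI) =
      ∫ ρ, inner ℝ (Hh (deriv X ρ) (Δ⁻¹ • (X' ρ - X ρ))) (η ρ) ∂muI := fun η => by
    rw [← integral_const_mul]
    refine integral_congr_ae ?_
    filter_upwards [hX] with ρ hρ
    rw [S.H_eq _ hρ.1 hρ.2, map_smul, real_inner_smul_left, one_div]
  simp only [IsStep, intervalIntegral.integral_of_le zero_le_one, h]

/-- The old curve fixes the matrix, so the first term is affine and coercive in `X'`, and the second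
is strongly monotone on all of `ℝ^d`. Nothing is assumed about the slopes of `X'`; uniqueness is
therefore unconditional. -/
theorem Setup.existsUnique_isStep (S : Setup φ mob T x c₀ C₀ L K lam Lam kap P Ψ Hh) {Δ : ℝ}
    (hΔ : 0 < Δ) (hXf : IsFE Q X)
    (hX : ∀ᵐ ρ ∂muI, c₀ / 8 ≤ ‖deriv X ρ‖ ∧ ‖deriv X ρ‖ ≤ 2 * C₀) :
    ∃! X', IsStep φ mob Q Δ X X' := by
  have hk := S.kap_pos
  have hK := S.K_pos
  simp only [S.isStep_iff hX]
  refine existsUnique_fe Q (α := fun ρ z => Hh (deriv X ρ) (Δ⁻¹ • (z - X ρ)))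
    (β := fun _ p => gradient (Phi φ) p) (c := min (Δ⁻¹ * kap) lam)
    (K := max (K * Δ⁻¹) Lam) (lt_min (by positivity) S.convex.pos)
    (le_trans (by positivity) (le_max_left _ _))
    (fun u hu => (S.H_taylor.bdd_comp hXf.bdd_deriv).clm_apply
      ((Bdd.const Δ⁻¹).smul (hu.sub hXf.bdd)))
    (fun u hu => Bdd.comp_lipschitz S.convex.lipschitz hu) ?_ ?_ ?_ ?_
  · filter_upwards [hX] with ρ hρ p q
    rw [← map_sub, ← smul_sub, sub_sub_sub_cancel_right, map_smul, real_inner_smul_left,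
      S.H_eq _ hρ.1 hρ.2]
    have h1 := S.coercive _ hρ.1 hρ.2 (p - q)
    calc _ ≤ Δ⁻¹ * kap * ‖p - q‖ ^ 2 := by gcongr; exact min_le_left _ _
      _ = Δ⁻¹ * (kap * ‖p - q‖ ^ 2) := by ring
      _ ≤ _ := by gcongr
  · refine Filter.Eventually.of_forall fun ρ p q => ?_
    exact (mul_le_mul_of_nonneg_right (min_le_right _ _) (by positivity)).trans
      (S.convex.monotone p q)
  · refine Filter.Eventually.of_forall fun ρ p q => ?_
    rw [← map_sub, ← smul_sub, sub_sub_sub_cancel_right]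
    have h1 : ‖Δ⁻¹ • (p - q)‖ ≤ Δ⁻¹ * ‖p - q‖ := by
      rw [norm_smul, Real.norm_of_nonneg (by positivity)]
    refine (norm_clm_apply_le _ (S.H_taylor.norm_le _) h1).trans ?_
    rw [← mul_assoc]
    gcongr
    exact le_max_left _ _
  · refine Filter.Eventually.of_forall fun ρ p q => ?_
    refine (S.convex.lipschitz p q).trans ?_
    gcongr
    exact le_max_right _ _

end Solvability

/-! ### Convergence -/

section Convergence

variable {d J : ℕ} {Q : Mesh J} {φ mob : E d → ℝ} {T : ℝ} {x : ℝ → ℝ → E d}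
  {c₀ C₀ L K lam Lam kap : ℝ} {P : E d → ℝ} {Ψ : E d → E d} {Hh : E d → E d →L[ℝ] E d}
  {M : ℕ} {Δ C : ℝ} {y v R F : ℕ → ℝ → E d} {X : ℝ → E d} {m : ℕ}

theorem ApproxScheme.error_le_of_energy_le (S : Setup φ mob T x c₀ C₀ L K lam Lam kap P Ψ Hh)
    (A : ApproxScheme φ Hh Q M Δ L C (3 / 4 * c₀) (5 / 4 * C₀) y v R F) (hΔ : 0 < Δ)
    (hM : 0 < M) (hm : m ≤ M) (hX : IsFE Q X) {N : ℝ}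
    (hE : energy φ kap ((lam⁻¹ * C ^ 2 + 1) * (Q.size ^ 2 + Δ) ^ 2) (F (m - 1)) (y m) X ≤
      N * (Q.size ^ 2 + Δ) ^ 2) :
    (∫ ρ, ‖y m ρ - X ρ‖ ^ 2 ∂muI) ≤ 4 / kap * N * (Q.size ^ 2 + Δ) ^ 2 ∧
      (∫ ρ, ‖deriv (y m) ρ - deriv X ρ‖ ^ 2 ∂muI) ≤ 4 / lam * N * (Q.size ^ 2 + Δ) ^ 2 := by
  have hlam := S.convex.pos
  have hk := S.kap_pos
  have hm1 : m - 1 < M := by omega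
  have hlow := S.convex.le_energy (kap := kap)
    (B := (lam⁻¹ * C ^ 2 + 1) * (Q.size ^ 2 + Δ) ^ 2) (A.fe m hm) hX (A.F_le _ hm1)
  have nD : 0 ≤ ∫ ρ, ‖deriv (y m) ρ - deriv X ρ‖ ^ 2 ∂muI := integral_nonneg fun _ => by positivity
  have nE : 0 ≤ ∫ ρ, ‖y m ρ - X ρ‖ ^ 2 ∂muI := integral_nonneg fun _ => by positivity
  have r1 : lam⁻¹ * (C * Q.size ^ 2) ^ 2 ≤ lam⁻¹ * C ^ 2 * (Q.size ^ 2 + Δ) ^ 2 := by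
    rw [mul_pow, mul_assoc]
    gcongr
    linarith
  have r2 := sq_nonneg (Q.size ^ 2 + Δ)
  have r3 := mul_nonneg hlam.le nD
  have r4 := mul_nonneg hk.le nE
  constructor
  · rw [div_mul_eq_mul_div, div_mul_eq_mul_div, le_div_iff₀ hk]
    linarith
  · rw [div_mul_eq_mul_div, div_mul_eq_mul_div, le_div_iff₀ hlam]
    linarith

/-- The inverse inequality loses one power of the mesh size, but an `H¹` error of order `h` still
forces a uniform bound of order `√h` on the slopes. -/
theorem IsFE.ae_norm_deriv_sub_le {z : ℝ → E d} (hz : IsFE Q z) (hX : IsFE Q X) {c κ b : ℝ}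
    (hc : ∀ j, Q.size ≤ c * Q.len j) (hc0 : 0 ≤ c) (hb : 0 ≤ b)
    (hD : ∫ ρ, ‖deriv z ρ - deriv X ρ‖ ^ 2 ∂muI ≤ κ * Q.size ^ 2)
    (hκ : c * κ * Q.size ≤ b ^ 2) : ∀ᵐ ρ ∂muI, ‖deriv z ρ - deriv X ρ‖ ≤ b := by
  have h1 := (hz.sub hX).ae_norm_deriv_sq_le hc
  have h2 := hz.ae_deriv_sub hX
  have e : ∫ ρ, ‖deriv (z - X) ρ‖ ^ 2 ∂muI = ∫ ρ, ‖deriv z ρ - deriv X ρ‖ ^ 2 ∂muI :=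
    integral_congr_ae (h2.mono fun ρ hρ => by simp only [hρ])
  rw [e] at h1
  have hs := Q.size_pos
  filter_upwards [h1, h2] with ρ r1 r2
  rw [r2] at r1
  refine abs_le_of_sq_le_sq' ?_ hb |>.2
  have r3 : Q.size * ‖deriv z ρ - deriv X ρ‖ ^ 2 ≤ Q.size * (c * κ * Q.size) := by
    refine r1.trans ((mul_le_mul_of_nonneg_left hD hc0).trans (le_of_eq ?_))
    ring
  exact (le_of_mul_le_mul_left r3 hs).trans hκ

/-- Start of the induction: by `isRitz_error` the Ritz projection differs from the interpolant by
`O(h²)` even in `H¹`. -/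
theorem Setup.energy_isRitz_le (S : Setup φ mob T x c₀ C₀ L K lam Lam kap P Ψ Hh)
    {F : ℝ → E d} (hΔ : 0 < Δ) {t : ℝ} (ht : t ∈ Icc 0 T) (hX : IsRitz φ Q (x t) X)
    (hF : ∀ᵐ ρ ∂muI, ‖F ρ‖ ≤ C * Q.size ^ 2) :
    energy φ kap ((lam⁻¹ * C ^ 2 + 1) * (Q.size ^ 2 + Δ) ^ 2) F (Q.interp (x t)) X ≤
      ((Lam + lam / 4) * (2 / lam * (L ^ 2 + lam⁻¹ * (K * L ^ 2) ^ 2)) + 2 * (lam⁻¹ * C ^ 2) + 1 +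
        kap / 4 * (2 * (L ^ 2 + lam⁻¹ * (K * L ^ 2) ^ 2))) * (Q.size ^ 2 + Δ) ^ 2 := by
  have hlam := S.convex.pos
  have hLam := S.convex.nonneg
  have hk := S.kap_pos
  have hy := S.curve.isFE_interp Q ht
  have h1 := S.convex.energy_le (kap := kap)
    (B := (lam⁻¹ * C ^ 2 + 1) * (Q.size ^ 2 + Δ) ^ 2) hy hX.1 hF
  have h2 := S.isRitz_error ht hX
  set κ := L ^ 2 + lam⁻¹ * (K * L ^ 2) ^ 2 with hκ
  set ε := Q.size ^ 2 + Δ with hε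
  have hκ0 : 0 ≤ κ := by positivity
  have hh2 : Q.size ^ 2 ≤ ε := by linarith
  have hhε : κ * (Q.size ^ 2) ^ 2 ≤ κ * ε ^ 2 := by gcongr
  have nD : 0 ≤ ∫ ρ, ‖deriv (Q.interp (x t)) ρ - deriv X ρ‖ ^ 2 ∂muI :=
    integral_nonneg fun _ => by positivity
  have nE : 0 ≤ ∫ ρ, ‖Q.interp (x t) ρ - X ρ‖ ^ 2 ∂muI := integral_nonneg fun _ => by positivity
  have r3 := mul_nonneg hlam.le nD
  have d1 : ∫ ρ, ‖deriv (Q.interp (x t)) ρ - deriv X ρ‖ ^ 2 ∂muI ≤ 2 / lam * κ * ε ^ 2 := by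
    rw [div_mul_eq_mul_div, div_mul_eq_mul_div, le_div_iff₀ hlam]
    linarith
  have d2 : ∫ ρ, ‖Q.interp (x t) ρ - X ρ‖ ^ 2 ∂muI ≤ 2 * κ * ε ^ 2 := by linarith
  have d3 := mul_le_mul_of_nonneg_left d1 (show 0 ≤ Lam + lam / 4 by positivity)
  have d4 := mul_le_mul_of_nonneg_left d2 (show 0 ≤ kap / 4 by positivity)
  have d5 : lam⁻¹ * (C * Q.size ^ 2) ^ 2 ≤ lam⁻¹ * C ^ 2 * ε ^ 2 := by
    rw [mul_pow, mul_assoc]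
    gcongr
  linarith

theorem one_add_mul_pow_le_exp {a Δ T : ℝ} (ha : 0 ≤ a) (hΔ : 0 ≤ Δ) {m : ℕ} (hm : m * Δ ≤ T) :
    (1 + a * Δ) ^ m ≤ Real.exp (a * T) := by
  have h1 : 1 + a * Δ ≤ Real.exp (a * Δ) := by
    rw [add_comm]
    exact Real.add_one_le_exp _
  calc (1 + a * Δ) ^ m ≤ Real.exp (a * Δ) ^ m := by gcongr
    _ = Real.exp (a * (m * Δ)) := by rw [← Real.exp_nat_mul]; ring_nf
    _ ≤ _ := by gcongr

/-- The iterates of the scheme. -/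
def iterates (φ mob : E d → ℝ) (Q : Mesh J) (Δ : ℝ) (X₀ : ℝ → E d) : ℕ → ℝ → E d
  | 0 => X₀
  | m + 1 => Classical.epsilon fun X' => IsStep φ mob Q Δ (iterates φ mob Q Δ X₀ m) X'

/-- `Classical.epsilon` picks a solution of the step if there is one and some arbitrary function
otherwise. The sequence can thus be defined before solvability is known, which is established level
by level. -/
theorem isStep_iterates {X₀ : ℝ → E d}
    (h : ∃ X', IsStep φ mob Q Δ (iterates φ mob Q Δ X₀ m) X') :
    IsStep φ mob Q Δ (iterates φ mob Q Δ X₀ m) (iterates φ mob Q Δ X₀ (m + 1)) :=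
  Classical.epsilon_spec h

theorem integral_norm_sq_le_of_interp {f g k : ℝ → E d} (hf : Bdd f) (hg : Bdd g) (hk : Bdd k)
    {a b : ℝ} (ha : ∀ᵐ ρ ∂muI, ‖f ρ - g ρ‖ ≤ a) (hb : ∫ ρ, ‖g ρ - k ρ‖ ^ 2 ∂muI ≤ b) :
    ∫ ρ, ‖f ρ - k ρ‖ ^ 2 ∂muI ≤ 2 * a ^ 2 + 2 * b := by
  have b1 := (Bdd.const (2 : ℝ)).mul (hg.sub hk).norm_sq
  have h := integral_mono_bdd (hf.sub hk).norm_sq ((Bdd.const (2 * a ^ 2)).add b1) (by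
    filter_upwards [ha] with ρ hρ
    have h1 : ‖f ρ - k ρ‖ ≤ ‖f ρ - g ρ‖ + ‖g ρ - k ρ‖ := norm_sub_le_norm_sub_add_norm_sub _ _ _
    have h2 : ‖f ρ - k ρ‖ ^ 2 ≤ (‖f ρ - g ρ‖ + ‖g ρ - k ρ‖) ^ 2 := by gcongr
    have h3 : ‖f ρ - g ρ‖ ^ 2 ≤ a ^ 2 := by gcongr
    have h4 := add_sq_le (a := ‖f ρ - g ρ‖) (b := ‖g ρ - k ρ‖)
    linarith)
  rw [integral_add (Bdd.const (2 * a ^ 2)).integrable b1.integrable, integral_const, probReal_univ,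
    one_smul, integral_const_mul] at h
  linarith

/-- Existence of the iterates and bounds for their distance to the interpolated solution. -/
theorem Setup.exists_iterates (S : Setup φ mob T x c₀ C₀ L K lam Lam kap P Ψ Hh) {c : ℝ}
    (hc : 0 < c) : ∃ h₀ > 0, h₀ ≤ 1 ∧ ∃ C > 0, ∀ (J : ℕ) (Q : Mesh J),
      (∀ j, Q.size ≤ c * Q.len j) → Q.size ≤ h₀ → ∀ M : ℕ, 0 < M → T / M ≤ Q.size →
      ∀ X₀, IsRitz φ Q (x 0) X₀ → ∃ X : ℕ → ℝ → E d, X 0 = X₀ ∧ (∀ m ≤ M, IsFE Q (X m)) ∧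
        (∀ m ≤ M, ∀ᵐ ρ ∂muI, c₀ / 8 ≤ ‖deriv (X m) ρ‖ ∧ ‖deriv (X m) ρ‖ ≤ 2 * C₀) ∧
        (∀ m < M, IsStep φ mob Q (T / M) (X m) (X (m + 1))) ∧
        ∀ m ≤ M, (∫ ρ, ‖Q.interp (x (m * (T / M))) ρ - X m ρ‖ ^ 2 ∂muI) ≤
          C * (Q.size ^ 2 + T / M) ^ 2 ∧
          (∫ ρ, ‖deriv (Q.interp (x (m * (T / M)))) ρ - deriv (X m) ρ‖ ^ 2 ∂muI) ≤
          C * (Q.size ^ 2 + T / M) ^ 2 := by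
  obtain ⟨C, hC, hA⟩ := S.exists_approxScheme
  have hlam := S.convex.pos
  have hLam := S.convex.nonneg
  have hk := S.kap_pos
  have hK := S.K_pos
  have hL := S.L_pos
  have hT := S.T_pos
  have h0 := S.c₀_pos
  have h1 := S.c₀_le
  set C₇ := 4 / lam * (K * L + kap⁻¹ * (K * L) ^ 2 + C) + kap⁻¹ * C ^ 2 + C + 1 with hC₇
  set C₅ := (Lam + lam / 4) * (2 / lam * (L ^ 2 + lam⁻¹ * (K * L ^ 2) ^ 2)) +
    2 * (lam⁻¹ * C ^ 2) + 1 + kap / 4 * (2 * (L ^ 2 + lam⁻¹ * (K * L ^ 2) ^ 2)) with hC₅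
  have hC7 : 0 < C₇ := by positivity
  have hC5 : 0 < C₅ := by positivity
  set N := Real.exp (C₇ * T) * C₅ with hN
  have hN0 : 0 < N := by positivity
  have hw : 0 < c * (16 / lam * N) := by positivity
  -- The three conditions on `h₀`: `1` gives `h² ≤ h` and `Δ ≤ 1`; `c₀ / 4 / L` keeps the slopes of
  -- the interpolant near those of `x`; the last makes the inverse inequality yield a slope error of
  -- at most `c₀ / 4`.
  refine ⟨min 1 (min (c₀ / 4 / L) ((c₀ / 4) ^ 2 / (c * (16 / lam * N)))), by positivity,
    min_le_left _ _, 4 / kap * N + 4 / lam * N, by positivity, ?_⟩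
  intro J Q hQ hsize M hM hdt X₀ hX₀
  have hs1 : Q.size ≤ 1 := hsize.trans (min_le_left _ _)
  have hs2 : L * Q.size ≤ c₀ / 4 := by
    have := hsize.trans ((min_le_right _ _).trans (min_le_left _ _))
    rwa [le_div_iff₀ hL, mul_comm] at this
  have hs3 : c * (16 / lam * N) * Q.size ≤ (c₀ / 4) ^ 2 := by
    have := hsize.trans ((min_le_right _ _).trans (min_le_right _ _))
    rwa [le_div_iff₀ hw, mul_comm] at this
  have hh := Q.size_pos
  have hM0 : (0 : ℝ) < M := by exact_mod_cast hM
  obtain ⟨v, R, F, A⟩ := hA Q hs2 M hM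
  set Δ := T / M with hΔ
  have hΔ0 : 0 < Δ := div_pos hT hM0
  have hMT : (M : ℝ) * Δ = T := by rw [hΔ]; field_simp
  set ε := Q.size ^ 2 + Δ with hε
  have hε0 : 0 < ε := by positivity
  -- The only place where a time step of the order of the mesh size is essential: it makes the
  -- squared `H¹` error small enough to pay for the inverse inequality.
  have hε2 : ε ^ 2 ≤ 4 * Q.size ^ 2 := by
    have h3 : ε ≤ 2 * Q.size := by
      have : Q.size ^ 2 ≤ Q.size := by
        rw [sq]
        exact mul_le_of_le_one_left hh.le hs1
      linarith
    calc ε ^ 2 ≤ (2 * Q.size) ^ 2 := by gcongr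
      _ = _ := by ring
  set y : ℕ → ℝ → E d := fun m => Q.interp (x (m * Δ)) with hy
  have hnear : ∀ m ≤ M, ∀ X, IsFE Q X →
      (∫ ρ, ‖deriv (y m) ρ - deriv X ρ‖ ^ 2 ∂muI) ≤ 4 / lam * N * ε ^ 2 →
      ∀ᵐ ρ ∂muI, ‖deriv (y m) ρ - deriv X ρ‖ ≤ c₀ / 4 := fun m hm X hX hD => by
    refine (A.fe m hm).ae_norm_deriv_sub_le hX (κ := 16 / lam * N) hQ hc.le (by positivity) ?_ hs3
    refine hD.trans ?_
    calc 4 / lam * N * ε ^ 2 ≤ 4 / lam * N * (4 * Q.size ^ 2) := by gcongr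
      _ = _ := by ring
  have hann : ∀ m ≤ M, ∀ X : ℝ → E d, (∀ᵐ ρ ∂muI, ‖deriv (y m) ρ - deriv X ρ‖ ≤ c₀ / 4) →
      ∀ᵐ ρ ∂muI, c₀ / 8 ≤ ‖deriv X ρ‖ ∧ ‖deriv X ρ‖ ≤ 2 * C₀ := fun m hm X hX => by
    filter_upwards [hX, A.range m hm] with ρ r1 r2
    have r3 := norm_sub_norm_le (deriv (y m) ρ) (deriv X ρ)
    have r4 := norm_sub_norm_le (deriv X ρ) (deriv (y m) ρ)
    rw [norm_sub_rev] at r4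
    constructor <;> linarith [r2.1, r2.2]
  set X := iterates φ mob Q Δ X₀ with hX
  set B := (lam⁻¹ * C ^ 2 + 1) * ε ^ 2 with hB
  have hpow : ∀ m ≤ M, (1 + C₇ * Δ) ^ m * (C₅ * ε ^ 2) ≤ N * ε ^ 2 := fun m hm => by
    have : (1 + C₇ * Δ) ^ m ≤ Real.exp (C₇ * T) := one_add_mul_pow_le_exp hC7.le hΔ0.le (by
      rw [← hMT]
      gcongr)
    rw [hN, mul_assoc]
    gcongr
  have herr : ∀ m ≤ M, IsFE Q (X m) →
      energy φ kap B (F (m - 1)) (y m) (X m) ≤ (1 + C₇ * Δ) ^ m * (C₅ * ε ^ 2) →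
      (∫ ρ, ‖y m ρ - X m ρ‖ ^ 2 ∂muI) ≤ 4 / kap * N * ε ^ 2 ∧
      (∫ ρ, ‖deriv (y m) ρ - deriv (X m) ρ‖ ^ 2 ∂muI) ≤ 4 / lam * N * ε ^ 2 :=
    fun m hm hXf hXe => A.error_le_of_energy_le S hΔ0 hM hm hXf (hXe.trans (hpow m hm))
  have hstep : ∀ m < M, IsFE Q (X m) →
      (∀ᵐ ρ ∂muI, c₀ / 8 ≤ ‖deriv (X m) ρ‖ ∧ ‖deriv (X m) ρ‖ ≤ 2 * C₀) →
      IsStep φ mob Q Δ (X m) (X (m + 1)) := fun m _ hXf hXa =>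
    isStep_iterates (S.existsUnique_isStep hΔ0 hXf hXa).exists
  -- The energy bound at one level puts the slopes of `X m` in the annulus, which makes the next
  -- step solvable and stable. The induction carries the exact power `(1 + C₇ Δ)^m`, bounded by `N`
  -- uniformly, so no constant deteriorates from level to level.
  have hind : ∀ m ≤ M, IsFE Q (X m) ∧
      energy φ kap B (F (m - 1)) (y m) (X m) ≤ (1 + C₇ * Δ) ^ m * (C₅ * ε ^ 2) := by
    intro m
    induction m with
    | zero =>
      intro _
      refine ⟨hX₀.1, ?_⟩
      have hy0 : y 0 = Q.interp (x 0) := by simp only [hy, Nat.cast_zero, zero_mul]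
      rw [pow_zero, one_mul, hy0]
      exact S.energy_isRitz_le hΔ0 (left_mem_Icc.mpr hT.le) hX₀ (A.F_le 0 hM)
    | succ m ih =>
      intro hm
      obtain ⟨hXf, hXe⟩ := ih (by omega)
      have hXn := hnear m (by omega) _ hXf (herr m (by omega) hXf hXe).2
      have hXa := hann m (by omega) _ hXn
      have hst := hstep m hm hXf hXa
      obtain ⟨hX'f, hX'e⟩ := (S.isStep_iff hXa).mp hst
      refine ⟨hst.1, ?_⟩
      have := A.energy_succ_le S hΔ0 (hdt.trans hs1) hC hm hXf hst.1 hXn hX'e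
      rw [Nat.add_sub_cancel, pow_succ']
      refine this.trans ?_
      rw [mul_assoc]
      exact mul_le_mul_of_nonneg_left hXe (by positivity)
  have hgood : ∀ m ≤ M, ∀ᵐ ρ ∂muI, c₀ / 8 ≤ ‖deriv (X m) ρ‖ ∧ ‖deriv (X m) ρ‖ ≤ 2 * C₀ :=
    fun m hm => hann m hm _
      (hnear m hm _ (hind m hm).1 (herr m hm (hind m hm).1 (hind m hm).2).2)
  refine ⟨X, rfl, fun m hm => (hind m hm).1, hgood,
    fun m hm => hstep m hm (hind m hm.le).1 (hgood m hm.le), fun m hm => ?_⟩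
  have := herr m hm (hind m hm).1 (hind m hm).2
  have n1 : 0 ≤ 4 / kap * N * ε ^ 2 := by positivity
  have n2 : 0 ≤ 4 / lam * N * ε ^ 2 := by positivity
  constructor
  · linarith [this.1]
  · linarith [this.2]

end Convergence

end ACSF

end

/-! ### The convergence theorem -/

theorem theorem3p2 (d : ℕ) (hd : 2 ≤ d) (φ mob : E d → ℝ) (hφ : IsAnisotropy φ)
    (hmob : IsMobility mob) (T : ℝ) (hT : 0 < T) (x : ℝ → ℝ → E d)
    (hreg : HasRegularity T x) (c₀ C₀ : ℝ) (hc₀ : 0 < c₀) (hC₀ : 0 < C₀)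
    (hx : ∀ t ∈ Set.Icc 0 T, ∀ ρ : ℝ, c₀ ≤ ‖deriv (x t) ρ‖ ∧ ‖deriv (x t) ρ‖ ≤ C₀)
    (hsol : IsWeakSolution φ mob T x) (c : ℝ) (hc : 0 < c) :
    ∃ δ > 0, ∃ h₀ > 0, ∃ C > 0, ∀ (J : ℕ) (Q : Mesh J), (∀ j, Q.size ≤ c * Q.len j) →
      Q.size ≤ h₀ → ∀ M : ℕ, 0 < M → T / M ≤ δ * Q.size →
        ∃ X : Fin (M + 1) → ℝ → E d,
          IsDiscreteSolution φ mob Q (T / M) (x 0) X ∧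
          (∀ Y : Fin (M + 1) → ℝ → E d,
            IsDiscreteSolution φ mob Q (T / M) (x 0) Y → Y = X) ∧
          (∀ m, ∀ᵐ ρ ∂muI, deriv (X m) ρ ≠ 0) ∧
          ∀ m : Fin (M + 1),
            errL2sq (x (m * (T / M))) (X m) ≤ C * (Q.size ^ 4 + (T / M) ^ 2) ∧
            errH1sq (x (m * (T / M))) (X m) ≤ C * (Q.size ^ 2 + (T / M) ^ 2) := by
  obtain ⟨L, K, lam, Lam, kap, P, Ψ, Hh, S⟩ := exists_setup hφ hmob hT hreg hc₀ hx hsol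
  obtain ⟨h₀, hh₀, hh₁, C, hC, hmain⟩ := S.exists_iterates hc
  have hL := S.L_pos
  -- `δ = 1` suffices. The triangle inequality through the interpolant gives `2 L²` from
  -- interpolation and `4 C` from `2 C (h² + Δt)² ≤ 4 C (h⁴ + Δt²)`. In `H¹` only the interpolation
  -- error is of order `h`.
  refine ⟨1, one_pos, h₀, hh₀, 2 * L ^ 2 + 4 * C, by positivity, ?_⟩
  intro J Q hQ hsize M hM hdt
  rw [one_mul] at hdt
  have h0T : (0 : ℝ) ∈ Set.Icc 0 T := Set.left_mem_Icc.mpr hT.le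
  have hM0 : (0 : ℝ) < M := by exact_mod_cast hM
  have hΔ0 : 0 < T / M := div_pos hT hM0
  obtain ⟨X₀, hX₀, hX₀u⟩ := S.existsUnique_isRitz Q h0T
  obtain ⟨X, rfl, hfe, hann, hstep, herr⟩ := hmain J Q hQ hsize M hM hdt X₀ hX₀
  have hle : ∀ m : Fin (M + 1), (m : ℕ) ≤ M := fun m => Nat.lt_succ_iff.mp m.2
  refine ⟨fun m => X m, ⟨hX₀, fun m => hfe m (hle m), fun m => (hstep m m.2).2⟩, ?_, ?_, ?_⟩
  -- Uniqueness propagates along the levels: once `Y` agrees with `X` at level `m`, its slopes there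
  -- lie in the annulus and the next step is uniquely solvable.
  · intro Y hY
    funext m
    induction m using Fin.induction with
    | zero => exact hX₀u _ hY.initial
    | succ m ih =>
      have hst : IsStep φ mob Q (T / M) (X m) (Y m.succ) := by
        have h := hY.step m
        rw [ih] at h
        exact ⟨hY.mem _, h⟩
      exact (S.existsUnique_isStep hΔ0 (hfe m m.2.le) (hann m m.2.le)).unique hst (hstep m m.2)
  · intro m
    filter_upwards [hann m (hle m)] with ρ hρ h
    rw [h, norm_zero] at hρ
    linarith [hρ.1]
  · intro m
    have ht : (m : ℝ) * (T / M) ∈ Set.Icc 0 T := by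
      refine ⟨by positivity, ?_⟩
      calc (m : ℝ) * (T / M) ≤ M * (T / M) := by
            gcongr
            exact hle m
        _ = T := by field_simp
    obtain ⟨e1, e2⟩ := herr m (hle m)
    have hi := S.curve.ae_interp_error Q ht
    have hxb : Bdd (x (m * (T / M))) := .of_continuous (continuous_iff_continuousAt.mpr fun ρ =>
      (S.curve.differentiable _ ht ρ).continuousAt)
    have hy := S.curve.isFE_interp Q ht
    have hXf := hfe m (hle m)
    have r1 := integral_norm_sq_le_of_interp hxb hy.bdd hXf.bdd (hi.mono fun _ h => h.1) e1
    have r2 := integral_norm_sq_le_of_interp (S.bdd_deriv ht) hy.bdd_deriv hXf.bdd_deriv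
      (hi.mono fun _ h => h.2) e2
    have hs := Q.size_pos
    have hs4 : Q.size ^ 4 ≤ Q.size ^ 2 := pow_le_pow_of_le_one hs.le (hsize.trans hh₁) (by norm_num)
    have r3 : C * (Q.size ^ 2 + T / M) ^ 2 ≤ C * (2 * (Q.size ^ 4 + (T / M) ^ 2)) := by
      refine mul_le_mul_of_nonneg_left (add_sq_le.trans (le_of_eq ?_)) hC.le
      ring
    have n1 : 0 ≤ L ^ 2 * (T / M) ^ 2 := by positivity
    have n2 := mul_le_mul_of_nonneg_left hs4 hC.le
    rw [errL2sq, errH1sq, intervalIntegral.integral_of_le zero_le_one,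
      intervalIntegral.integral_of_le zero_le_one]
    constructor
    · refine r1.trans ?_
      linarith
    · refine r2.trans ?_
      linarith
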